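/- **Setting.** Let $m\ge 1$ blocks, and consider $\min_{x\in\mathbb R^{d_x}}F(x)$, where $$F(x)=\frac1m\sum_{i=1}^m f_i\big(x,\alpha_i(x),y_i(x)\big),\qquad y_i(x)=\arg\min_{y\in\mathbb R^{d_y}} g_i(x,y),\qquad \alpha_i(x)=\arg\max_{\alpha\in\mathcal A} f_i\big(x,\alpha,y_i(x)\big),$$ with $\mathcal A\subset\mathbb R^{d_\alpha}$ nonempty, closed and convex. Norms are Euclidean, and spectral for matrices. **Assumption 1** (constants $\mu_f,\mu_g,L_f,L_g>0$ and $C_f,C_{gxy},L_{gxy},L_{gyy}\ge 0$). For every $i$: $f_i$ is differentiable at all $(x,\alpha,y)$ with $\alpha\in\mathcal A$ and $g_i$ is twice differentiable; on $\mathbb R^{d_x}\times\mathcal A\times\mathbb R^{d_y}$, $f_i$ is $\mu_f$-strongly concave in $\alpha$, $C_f$-Lipschitz and $L_f$-smooth; $g_i$ is $\mu_g$-strongly convex in $y$ and $L_g$-smooth; $\|\nabla^2_{xy}g_i\|\le C_{gxy}$; $\nabla^2_{xy}g_i$ and $\nabla^2_{yy}g_i$ are $L_{gxy}$- and $L_{gyy}$-Lipschitz.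 **Assumption 2.** For a batch $\mathcal B$ of $b\ge1$ i.i.d. samples for block $i$, the (jointly measurable) oracles $\nabla_xf_i(x,\alpha,y;\mathcal B)$, $\nabla_\alpha f_i(x,\alpha,y;\mathcal B)$, $\nabla_yf_i(x,\alpha,y;\mathcal B)$ $(\alpha\in\mathcal A)$, $\nabla_yg_i(x,y;\mathcal B)$, $\nabla^2_{xy}g_i(x,y;\mathcal B)$, $\nabla^2_{yy}g_i(x,y;\mathcal B)$ are unbiased with variance at most $\sigma^2/b$. **Algorithm.** Put $\Gamma=C_f/\mu_g$; $\Pi_{\mathcal A}$ is the projection onto $\mathcal A$ and $\Pi_\Gamma$ the projection onto $\{v\in\mathbb R^{d_y}:\|v\|\le\Gamma\}$. Start from deterministic $x_0,z_0$, $\alpha^0_i\in\mathcal A$, $y^0_i$, $\|v^0_i\|\le\Gamma$. At each step $t\ge 0$, independently of the past, draw a uniformly random set $I_t\subset\{1,\dots,m\}$ of fixed size $s$ ($1\le s\le m$) and, independently of $I_t$, batches $\mathcal B_i^t$ of size $b$. For $i\in I_t$ set $$\alpha_i^{t+1}=\Pi_{\mathcal A}\big[\alpha_i^t+\eta_1\nabla_\alpha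 f_i(x_t,\alpha_i^t,y_i^t;\mathcal B_i^t)\big],\qquad y_i^{t+1}=y_i^t-\eta_2\nabla_yg_i(x_t,y_i^t;\mathcal B_i^t),$$ $$v_i^{t+1}=\Pi_\Gamma\big[v_i^t-\eta_3\big(\nabla^2_{yy}g_i(x_t,y_i^t;\mathcal B_i^t)v_i^t-\nabla_yf_i(x_t,\alpha_i^t,y_i^t;\mathcal B_i^t)\big)\big],$$ and keep $\alpha_i,y_i,v_i$ unchanged for $i\notin I_t$. Then let $$\Delta^{t+1}=\frac1s\sum_{i\in I_t}\big[\nabla_xf_i(x_t,\alpha_i^t,y_i^t;\mathcal B_i^t)-\nabla^2_{xy}g_i(x_t,y_i^t;\mathcal B_i^t)v_i^t\big],\quad z_{t+1}=(1-\beta_0)z_t+\beta_0\Delta^{t+1},\quad x_{t+1}=x_t-\eta_0z_{t+1}.$$ Put $v_i(x)=[\nabla^2_{yy}g_i(x,y_i(x))]^{-1}\nabla_yf_i(x,\alpha_i(x),y_i(x))$, $\delta_{\alpha,0}=\sum_i\|\alpha_i^0-\alpha_i(x_0)\|^2$, $\delta_{y,0}=\sum_i\|y_i^0-y_i(x_0)\|^2$,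 $\delta_{v,0}=\sum_i\|v_i^0-v_i(x_0)\|^2$, $C_y=C_v=\mu_g^{-1}L_g$, $C_\alpha=\mu_f^{-1}L_f$. **Theorem.** There are constants $L_F,C_1,C_2,C_3>0$ depending only on the constants of Assumption 1, and for each $\sigma\ge0$ a constant $C_4>0$ depending only on these and $\sigma$, such that under Assumptions 1 and 2 $F$ is differentiable with $L_F$-Lipschitz gradient, and the following hold. (a) Let $\epsilon>0$, let $F(x_0)-F(x)\le\Delta_F$ for all $x$, and let $\eta_0,\eta_1,\eta_2,\eta_3>0$, $0<\beta_0\le1$ satisfy (bounds with $\sigma^2$ in the denominator being void if $\sigma=0$) $$\eta_1\le\min\Big\{\tfrac{\mu_f}{L_f^2},\tfrac1{\mu_f},\tfrac{4m}{\mu_fs},\tfrac{b\epsilon^2}{96C_1\mu_f\sigma^2}\Big\},\quad \eta_3\le\min\Big\{\tfrac{\mu_g}{L_g^2},\tfrac1{\mu_g},\tfrac{4m}{\mu_gs},\tfrac{b\epsilon^2}{96C_3\mu_g\sigma^2}\Big\},$$ $$\eta_2\le\min\Big\{\tfrac{\mu_g}{L_g^2},\tfrac{2m}{s\mu_g},\tfrac{\mu_gb\epsilon^2}{48C_2\sigma^2}\Big\},\quad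 \beta_0\le\tfrac{\min\{s,b\}\epsilon^2}{12C_4},$$ $$\eta_0\le\min\Big\{\tfrac1{2L_F},\tfrac{\beta_0}{8L_F},\tfrac{\eta_3\mu_gs}{32mC_v\sqrt{C_3}},\tfrac{\eta_1\mu_fs}{32mC_\alpha\sqrt{C_1}},\tfrac{s\eta_2\mu_g}{16mC_y\sqrt{C_2}}\Big\},$$ $$T\ge\max\Big\{\tfrac{32\Delta_F}{\eta_0\epsilon^2},\tfrac{15\,\mathbb E\|\nabla F(x_0)-z_1\|^2}{\beta_0\epsilon^2},\tfrac{60C_1\delta_{\alpha,0}}{\mu_fs\eta_1\epsilon^2},\tfrac{60C_3\delta_{v,0}}{\eta_3\mu_gs\epsilon^2},\tfrac{30C_2\delta_{y,0}}{s\eta_2\mu_g\epsilon^2}\Big\}.$$ If $\tau$ is uniform on $\{0,\dots,T\}$ and independent of the sampling, then (both expectations being finite) $$\mathbb E\|\nabla F(x_\tau)\|^2\le\epsilon^2,\qquad \mathbb E\|\nabla F(x_\tau)-z_{\tau+1}\|^2<2\epsilon^2. \qquad (*)$$ (b) There are $c_0,\dots,c_4>0$ depending only on the constants of Assumption 1 and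 $\sigma$, and for every $D$ a constant $K$ depending only on these and $D$, such that if $F(x_0)-F(x)\le D$ for all $x$, $\|z_0\|^2\le D$, $\delta_{\alpha,0},\delta_{y,0},\delta_{v,0}\le mD$, $\epsilon>0$ and $b\epsilon^2\le1$, then with $$\eta_1=c_1b\epsilon^2,\quad\eta_2=c_2b\epsilon^2,\quad\eta_3=c_3b\epsilon^2,\quad\beta_0=c_4\min\{s,b\}\epsilon^2,\quad\eta_0=c_0\min\Big\{\min\{s,b\}\epsilon^2,\frac{bs\epsilon^2}{m}\Big\}$$ the guarantee $(*)$ holds for every $$T\ge K\max\Big\{\frac{m}{s\,b\,\epsilon^4},\ \frac1{\min\{s,b\}\,\epsilon^4}\Big\},$$ i.e. $T=O\big(\max\{m/(|I_t||\mathcal B|\epsilon^4),1/(\min\{|I_t|,|\mathcal B|\}\epsilon^4)\}\big)$ iterations suffice. -/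

import Mathlib

open MeasureTheory ProbabilityTheory

universe u w

noncomputable section

namespace MinMaxBilevel

/-- Euclidean space `ℝⁿ`. -/
abbrev Vec (n : ℕ) := EuclideanSpace ℝ (Fin n)

/-- A Euclidean projection of `u` onto `K`: a point of `K` nearest to `u`
(it exists and is unique when `K` is nonempty, closed and convex). -/
def proj {n : ℕ} (K : Set (Vec n)) (u : Vec n) : Vec n :=
  Classical.epsilon fun p => p ∈ K ∧ ∀ q ∈ K, ‖u - p‖ ≤ ‖u - q‖

/-- The constants of the structural assumptions. -/
structure Params where
  μf : ℝ
  μg : ℝ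
  Cf : ℝ
  Lf : ℝ
  Lg : ℝ
  Cgxy : ℝ
  Lgxy : ℝ
  Lgyy : ℝ
  μf_pos : 0 < μf
  μg_pos : 0 < μg
  Cf_nonneg : 0 ≤ Cf
  Lf_pos : 0 < Lf
  Lg_pos : 0 < Lg
  Cgxy_nonneg : 0 ≤ Cgxy
  Lgxy_nonneg : 0 ≤ Lgxy
  Lgyy_nonneg : 0 ≤ Lgyy

namespace Params
variable (p : Params)

/-- Radius of the ball onto which the Hessian-inverse-vector iterates are projected. -/
def Γ : ℝ := p.Cf / p.μg
/-- `C_y = L_g / μ_g`. -/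
def Cy : ℝ := p.Lg / p.μg
/-- `C_α = L_f / μ_f`. -/
def Cα : ℝ := p.Lf / p.μf
/-- `C_v = L_g / μ_g`. -/
def Cv : ℝ := p.Lg / p.μg
/-- Strong convexity modulus of the quadratics `γ_i` in `v`. -/
def μγ : ℝ := p.μg
/-- Smoothness constant of the quadratics `γ_i` in `v`. -/
def Lγ : ℝ := p.Lg

end Params

/-- The data of a multi-block min-max bilevel problem with `m` blocks, together with the
stochastic oracles through which its derivatives are accessed. A batch for block `i` consists of
`b` samples in `Ξ i` (a sample may be a pair `(ξ, ζ)`, with `ξ` used for `f i` and `ζ` for `g i`),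
each of law `law i`. The fields named with a final `o` are the oracles evaluated on a batch. -/
structure Problem (m dX dA dY b : ℕ) (Ξ : Fin m → Type u) [∀ i, MeasurableSpace (Ξ i)] where
  /-- the feasible set of each dual block -/
  A : Set (Vec dA)
  /-- upper-level objectives -/
  f : Fin m → Vec dX → Vec dA → Vec dY → ℝ
  /-- lower-level objectives -/
  g : Fin m → Vec dX → Vec dY → ℝ
  law : ∀ i, Measure (Ξ i)
  gradXfo : ∀ i, Vec dX → Vec dA → Vec dY → (Fin b → Ξ i) → Vec dX
  gradAfo : ∀ i, Vec dX → Vec dA → Vec dY → (Fin b → Ξ i) → Vec dA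
  gradYfo : ∀ i, Vec dX → Vec dA → Vec dY → (Fin b → Ξ i) → Vec dY
  gradYgo : ∀ i, Vec dX → Vec dY → (Fin b → Ξ i) → Vec dY
  hessXYgo : ∀ i, Vec dX → Vec dY → (Fin b → Ξ i) → (Vec dY →L[ℝ] Vec dX)
  hessYYgo : ∀ i, Vec dX → Vec dY → (Fin b → Ξ i) → (Vec dY →L[ℝ] Vec dY)

/-- The five step-size / momentum parameters. -/
structure StepSizes where
  η0 : ℝ
  η1 : ℝ
  η2 : ℝ
  η3 : ℝ
  β0 : ℝ

/-- The variables maintained by the algorithm. -/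
structure State (m dX dA dY : ℕ) where
  x : Vec dX
  α : Fin m → Vec dA
  y : Fin m → Vec dY
  v : Fin m → Vec dY
  z : Vec dX

/-- `O`, as a random variable under the batch law `ν`, is an unbiased estimator of `target` with
variance (in norm) at most `var`. For operators the norm is the spectral norm. -/
def IsUnbiasedOracle {Ω E : Type*} [MeasurableSpace Ω] [NormedAddCommGroup E] [NormedSpace ℝ E]
    (ν : Measure Ω) (O : Ω → E) (target : E) (var : ℝ) : Prop :=
  MemLp O 2 ν ∧ ∫ ω, O ω ∂ν = target ∧ ∫ ω, ‖O ω - target‖ ^ 2 ∂ν ≤ var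

namespace Problem

variable {m dX dA dY b : ℕ} {Ξ : Fin m → Type u} [∀ i, MeasurableSpace (Ξ i)]
  (P : Problem m dX dA dY b Ξ)

/-- `∇ₓ f_i`. -/
def gradXf (i : Fin m) (x : Vec dX) (α : Vec dA) (y : Vec dY) : Vec dX :=
  gradient (fun x' => P.f i x' α y) x
/-- `∇_α f_i`. -/
def gradAf (i : Fin m) (x : Vec dX) (α : Vec dA) (y : Vec dY) : Vec dA :=
  gradient (fun α' => P.f i x α' y) α
/-- `∇_y f_i`. -/
def gradYf (i : Fin m) (x : Vec dX) (α : Vec dA) (y : Vec dY) : Vec dY :=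
  gradient (fun y' => P.f i x α y') y
/-- `∇ₓ g_i`. -/
def gradXg (i : Fin m) (x : Vec dX) (y : Vec dY) : Vec dX :=
  gradient (fun x' => P.g i x' y) x
/-- `∇_y g_i`. -/
def gradYg (i : Fin m) (x : Vec dX) (y : Vec dY) : Vec dY :=
  gradient (fun y' => P.g i x y') y
/-- `∇²_{xy} g_i`, the `dX × dY` matrix of mixed second derivatives, as a linear map. -/
def hessXYg (i : Fin m) (x : Vec dX) (y : Vec dY) : Vec dY →L[ℝ] Vec dX :=
  fderiv ℝ (fun y' => P.gradXg i x y') y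
/-- `∇²_{yy} g_i`. -/
def hessYYg (i : Fin m) (x : Vec dX) (y : Vec dY) : Vec dY →L[ℝ] Vec dY :=
  fderiv ℝ (fun y' => P.gradYg i x y') y

/-- `y_i(x) = argmin_y g_i(x, y)`. -/
def yStar (i : Fin m) (x : Vec dX) : Vec dY :=
  Classical.epsilon fun y => ∀ y', P.g i x y ≤ P.g i x y'

/-- `α_i(x) = argmax_{α ∈ A} f_i(x, α, y_i(x))`. -/
def αStar (i : Fin m) (x : Vec dX) : Vec dA :=
  Classical.epsilon fun α => α ∈ P.A ∧ ∀ α' ∈ P.A,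
    P.f i x α' (P.yStar i x) ≤ P.f i x α (P.yStar i x)

/-- `v_i(x) = [∇²_{yy} g_i(x, y_i(x))]⁻¹ ∇_y f_i(x, α_i(x), y_i(x))`. -/
def vStar (i : Fin m) (x : Vec dX) : Vec dY :=
  ContinuousLinearMap.inverse (P.hessYYg i x (P.yStar i x))
    (P.gradYf i x (P.αStar i x) (P.yStar i x))

/-- The objective `F(x) = (1/m) ∑ᵢ f_i(x, α_i(x), y_i(x))`. -/
def F (x : Vec dX) : ℝ :=
  (m : ℝ)⁻¹ * ∑ i, P.f i x (P.αStar i x) (P.yStar i x)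

/-- The structural assumptions on `f_i`, `g_i`. The functions `f_i` are only required to be
concave, Lipschitz and smooth over `α ∈ A`. -/
structure StructuralAssumptions (p : Params) : Prop where
  A_nonempty : P.A.Nonempty
  A_closed : IsClosed P.A
  A_convex : Convex ℝ P.A
  f_concave : ∀ i x y, StrongConcaveOn P.A p.μf (fun α => P.f i x α y)
  g_convex : ∀ i x, StrongConvexOn Set.univ p.μg (fun y => P.g i x y)
  f_lipschitz : ∀ i x x' y y', ∀ α ∈ P.A, ∀ α' ∈ P.A,
    |P.f i x α y - P.f i x' α' y'|
      ≤ p.Cf * √(‖x - x'‖ ^ 2 + ‖α - α'‖ ^ 2 + ‖y - y'‖ ^ 2)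
  f_differentiable : ∀ i x y, ∀ α ∈ P.A,
    DifferentiableAt ℝ (fun q : Vec dX × Vec dA × Vec dY => P.f i q.1 q.2.1 q.2.2) (x, α, y)
  f_smooth : ∀ i x x' y y', ∀ α ∈ P.A, ∀ α' ∈ P.A,
    √(‖P.gradXf i x α y - P.gradXf i x' α' y'‖ ^ 2 + ‖P.gradAf i x α y - P.gradAf i x' α' y'‖ ^ 2
        + ‖P.gradYf i x α y - P.gradYf i x' α' y'‖ ^ 2)
      ≤ p.Lf * √(‖x - x'‖ ^ 2 + ‖α - α'‖ ^ 2 + ‖y - y'‖ ^ 2)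
  g_differentiable : ∀ i, Differentiable ℝ (fun q : Vec dX × Vec dY => P.g i q.1 q.2)
  g_twice_differentiable : ∀ i,
    Differentiable ℝ (fderiv ℝ (fun q : Vec dX × Vec dY => P.g i q.1 q.2))
  g_smooth : ∀ i x x' y y',
    √(‖P.gradXg i x y - P.gradXg i x' y'‖ ^ 2 + ‖P.gradYg i x y - P.gradYg i x' y'‖ ^ 2)
      ≤ p.Lg * √(‖x - x'‖ ^ 2 + ‖y - y'‖ ^ 2)
  hessXYg_bounded : ∀ i x y, ‖P.hessXYg i x y‖ ^ 2 ≤ p.Cgxy ^ 2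
  hessXYg_lipschitz : ∀ i x x' y y',
    ‖P.hessXYg i x y - P.hessXYg i x' y'‖ ≤ p.Lgxy * √(‖x - x'‖ ^ 2 + ‖y - y'‖ ^ 2)
  hessYYg_lipschitz : ∀ i x x' y y',
    ‖P.hessYYg i x y - P.hessYYg i x' y'‖ ≤ p.Lgyy * √(‖x - x'‖ ^ 2 + ‖y - y'‖ ^ 2)

/-- The law of a batch of `b` independent samples for block `i`. -/
def batchLaw (i : Fin m) : Measure (Fin b → Ξ i) := Measure.pi fun _ => P.law i

/-- The oracle assumptions: (jointly measurable) unbiased oracles with variance at most `σ² / b`.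
Positive definiteness of each individual stochastic Hessian is not required. -/
structure OracleAssumptions (σ : ℝ) : Prop where
  law_prob : ∀ i, IsProbabilityMeasure (P.law i)
  gradXf_meas : ∀ i, Measurable fun q : Vec dX × Vec dA × Vec dY × (Fin b → Ξ i) =>
    P.gradXfo i q.1 q.2.1 q.2.2.1 q.2.2.2
  gradAf_meas : ∀ i, Measurable fun q : Vec dX × Vec dA × Vec dY × (Fin b → Ξ i) =>
    P.gradAfo i q.1 q.2.1 q.2.2.1 q.2.2.2
  gradYf_meas : ∀ i, Measurable fun q : Vec dX × Vec dA × Vec dY × (Fin b → Ξ i) =>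
    P.gradYfo i q.1 q.2.1 q.2.2.1 q.2.2.2
  gradYg_meas : ∀ i, Measurable fun q : Vec dX × Vec dY × (Fin b → Ξ i) =>
    P.gradYgo i q.1 q.2.1 q.2.2
  hessXYg_meas : ∀ i, Measurable fun q : Vec dX × Vec dY × (Fin b → Ξ i) =>
    P.hessXYgo i q.1 q.2.1 q.2.2
  hessYYg_meas : ∀ i, Measurable fun q : Vec dX × Vec dY × (Fin b → Ξ i) =>
    P.hessYYgo i q.1 q.2.1 q.2.2
  gradXf_oracle : ∀ i x y, ∀ α ∈ P.A,
    IsUnbiasedOracle (P.batchLaw i) (P.gradXfo i x α y) (P.gradXf i x α y) (σ ^ 2 / b)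
  gradAf_oracle : ∀ i x y, ∀ α ∈ P.A,
    IsUnbiasedOracle (P.batchLaw i) (P.gradAfo i x α y) (P.gradAf i x α y) (σ ^ 2 / b)
  gradYf_oracle : ∀ i x y, ∀ α ∈ P.A,
    IsUnbiasedOracle (P.batchLaw i) (P.gradYfo i x α y) (P.gradYf i x α y) (σ ^ 2 / b)
  gradYg_oracle : ∀ i x y,
    IsUnbiasedOracle (P.batchLaw i) (P.gradYgo i x y) (P.gradYg i x y) (σ ^ 2 / b)
  hessXYg_oracle : ∀ i x y,
    IsUnbiasedOracle (P.batchLaw i) (P.hessXYgo i x y) (P.hessXYg i x y) (σ ^ 2 / b)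
  hessYYg_oracle : ∀ i x y,
    IsUnbiasedOracle (P.batchLaw i) (P.hessYYgo i x y) (P.hessYYg i x y) (σ ^ 2 / b)

/-- The gradient estimator `Δ` computed from the sampled blocks `J` and batches `B`. -/
def gradEstimator (J : Finset (Fin m)) (B : ∀ i, Fin b → Ξ i) (S : State m dX dA dY) : Vec dX :=
  (J.card : ℝ)⁻¹ • ∑ i ∈ J,
    (P.gradXfo i S.x (S.α i) (S.y i) (B i) - P.hessXYgo i S.x (S.y i) (B i) (S.v i))

/-- One iteration of the algorithm, with sampled blocks `J` and batches `B`. -/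
def step (Γ : ℝ) (h : StepSizes) (J : Finset (Fin m)) (B : ∀ i, Fin b → Ξ i)
    (S : State m dX dA dY) : State m dX dA dY :=
  let z' : Vec dX := (1 - h.β0) • S.z + h.β0 • P.gradEstimator J B S
  { x := S.x - h.η0 • z'
    α := fun i => if i ∈ J then
        proj P.A (S.α i + h.η1 • P.gradAfo i S.x (S.α i) (S.y i) (B i))
      else S.α i
    y := fun i => if i ∈ J then S.y i - h.η2 • P.gradYgo i S.x (S.y i) (B i) else S.y i
    v := fun i => if i ∈ J then
        proj (Metric.closedBall 0 Γ) (S.v i - h.η3 •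
          (P.hessYYgo i S.x (S.y i) (B i) (S.v i) - P.gradYfo i S.x (S.α i) (S.y i) (B i)))
      else S.v i
    z := z' }

/-- The state at time `t`, `(x_t, α^t, y^t, v^t, z_t)`, driven by the random blocks `I` and
random batches `B`, started at `S₀`. -/
def iter {Ω : Type w} (Γ : ℝ) (h : StepSizes) (I : ℕ → Ω → Finset (Fin m))
    (B : ℕ → Ω → ∀ i, Fin b → Ξ i) (S₀ : State m dX dA dY) : ℕ → Ω → State m dX dA dY
  | 0, _ => S₀
  | t + 1, ω => P.step Γ h (I t ω) (B t ω) (iter Γ h I B S₀ t ω)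

/-- Sampling: at each step a uniformly random set of `s` blocks and, independently of it, a batch
of `b` i.i.d. samples for each block; different steps are independent. (Only the batches of
sampled blocks are used. Batches of different blocks in one step may be dependent.) -/
structure IsSampling {Ω : Type w} [MeasurableSpace Ω] (μ : Measure Ω) (s : ℕ)
    (I : ℕ → Ω → Finset (Fin m)) (B : ℕ → Ω → ∀ i, Fin b → Ξ i) : Prop where
  meas_I : ∀ t, Measurable (I t)
  meas_B : ∀ t, Measurable (B t)
  law_I : ∀ t, μ.map (I t) = uniformOn {J : Finset (Fin m) | J.card = s}
  law_B : ∀ t i, μ.map (fun ω => B t ω i) = P.batchLaw i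
  indep_I_B : ∀ t, IndepFun (I t) (B t) μ
  indep_steps : iIndepFun (fun t ω => (I t ω, B t ω)) μ

/-- Admissible (deterministic) initialisation: `α_i⁰ ∈ A` and `‖v_i⁰‖ ≤ Γ`. -/
def AdmissibleInit (Γ : ℝ) (S₀ : State m dX dA dY) : Prop :=
  ∀ i, S₀.α i ∈ P.A ∧ ‖S₀.v i‖ ≤ Γ

/-- `δ_α`. -/
def δα (S : State m dX dA dY) : ℝ := ∑ i, ‖S.α i - P.αStar i S.x‖ ^ 2
/-- `δ_y`. -/
def δy (S : State m dX dA dY) : ℝ := ∑ i, ‖S.y i - P.yStar i S.x‖ ^ 2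
/-- `δ_v`. -/
def δv (S : State m dX dA dY) : ℝ := ∑ i, ‖S.v i - P.vStar i S.x‖ ^ 2

/-- The guarantee for the random iterate:
`E‖∇F(x_τ)‖² ≤ ε²` and `E‖∇F(x_τ) - z_{τ+1}‖² < 2ε²`, both expectations being finite. -/
def Guarantee {Ω : Type w} [MeasurableSpace Ω] (μ : Measure Ω) (S : ℕ → Ω → State m dX dA dY)
    (τ : Ω → ℕ) (ε : ℝ) : Prop :=
  Integrable (fun ω => ‖gradient P.F (S (τ ω) ω).x‖ ^ 2) μ ∧
  ∫ ω, ‖gradient P.F (S (τ ω) ω).x‖ ^ 2 ∂μ ≤ ε ^ 2 ∧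
  Integrable (fun ω => ‖gradient P.F (S (τ ω) ω).x - (S (τ ω + 1) ω).z‖ ^ 2) μ ∧
  ∫ ω, ‖gradient P.F (S (τ ω) ω).x - (S (τ ω + 1) ω).z‖ ^ 2 ∂μ < 2 * ε ^ 2

/-- The lower bounds on the number `T` of iterations; `e₀` is `E‖∇F(x_0) - z_1‖²`. -/
def EnoughIterations (p : Params) (C1 C2 C3 : ℝ) (h : StepSizes) (s : ℕ) (ε ΔF e₀ : ℝ)
    (S₀ : State m dX dA dY) (T : ℕ) : Prop :=
  32 * ΔF / (h.η0 * ε ^ 2) ≤ T ∧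
  15 * e₀ / (h.β0 * ε ^ 2) ≤ T ∧
  60 * C1 * P.δα S₀ / (p.μf * s * h.η1 * ε ^ 2) ≤ T ∧
  60 * C3 * P.δv S₀ / (h.η3 * p.μg * s * ε ^ 2) ≤ T ∧
  30 * C2 * P.δy S₀ / (s * h.η2 * p.μg * ε ^ 2) ≤ T

end Problem

/-- `τ` is uniform on `{0, …, T}` and independent of the sampling. -/
structure IsRandomIndex {m b : ℕ} {Ξ : Fin m → Type u} [∀ i, MeasurableSpace (Ξ i)]
    {Ω : Type w} [MeasurableSpace Ω] (μ : Measure Ω) (T : ℕ) (τ : Ω → ℕ)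
    (I : ℕ → Ω → Finset (Fin m)) (B : ℕ → Ω → ∀ i, Fin b → Ξ i) : Prop where
  meas : Measurable τ
  law : μ.map τ = uniformOn (Set.Iic T)
  indep : IndepFun τ (fun ω t => (I t ω, B t ω)) μ

/-- The step-size conditions, for `m` blocks, block batches of size `s` and data batches of
size `b`. Bounds with `σ²` in a denominator are multiplied out, so that they are void for `σ = 0`. -/
structure StepConditions (p : Params) (LF C1 C2 C3 C4 σ ε : ℝ) (m s b : ℕ) (h : StepSizes) :
    Prop where
  η0_pos : 0 < h.η0
  η1_pos : 0 < h.η1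
  η2_pos : 0 < h.η2
  η3_pos : 0 < h.η3
  β0_pos : 0 < h.β0
  β0_le_one : h.β0 ≤ 1
  η1_le : h.η1 ≤ min (p.μf / p.Lf ^ 2) (min (1 / p.μf) (4 * m / (p.μf * s)))
  η1_noise : h.η1 * (96 * C1 * p.μf * σ ^ 2) ≤ b * ε ^ 2
  η3_le : h.η3 ≤ min (p.μγ / p.Lγ ^ 2) (min (1 / p.μγ) (4 * m / (p.μγ * s)))
  η3_noise : h.η3 * (96 * C3 * p.μg * σ ^ 2) ≤ b * ε ^ 2
  η2_le : h.η2 ≤ min (p.μg / p.Lg ^ 2) (2 * m / (s * p.μg))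
  η2_noise : h.η2 * (48 * C2 * σ ^ 2) ≤ p.μg * b * ε ^ 2
  β0_le : h.β0 ≤ (min s b : ℕ) * ε ^ 2 / (12 * C4)
  η0_le_LF : h.η0 ≤ min (1 / (2 * LF)) (h.β0 / (8 * LF))
  η0_le_v : h.η0 ≤ h.η3 * p.μg * s / (32 * m * p.Cv * √C3)
  η0_le_α : h.η0 ≤ h.η1 * p.μf * s / (32 * m * p.Cα * √C1)
  η0_le_y : h.η0 ≤ s * h.η2 * p.μg / (16 * m * p.Cy * √C2)

/-- The step sizes `η₁ = c₁ b ε²`, `η₂ = c₂ b ε²`, `η₃ = c₃ b ε²`, `β₀ = c₄ min{s,b} ε²`,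
`η₀ = c₀ min{min{s,b} ε², b s ε² / m}`. -/
def scaledSteps (c0 c1 c2 c3 c4 : ℝ) (m s b : ℕ) (ε : ℝ) : StepSizes where
  η0 := c0 * min ((min s b : ℕ) * ε ^ 2) (b * s * ε ^ 2 / m)
  η1 := c1 * (b * ε ^ 2)
  η2 := c2 * (b * ε ^ 2)
  η3 := c3 * (b * ε ^ 2)
  β0 := c4 * ((min s b : ℕ) * ε ^ 2)

end MinMaxBilevel

end

noncomputable section

namespace MinMaxBilevel

section

open Filter Topology Asymptotics

/-! ### Euclidean projections onto closed convex sets. -/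

section Projection

variable {n : ℕ} {K : Set (Vec n)}

/-! Strong convexity of `g i` in `y` and strong concavity of `f i` in `α` make the solution maps
`yStar`, `αStar`, `vStar` Lipschitz in `x`. The objective then has a Lipschitz gradient, the average
of the directions `dirStar` (∇ₓf − ∇²ₓᵧg · v at the solutions). Differentiability of the solution
maps is not needed (`hasGradientAt_block`). The first-order contribution of α is quadratically
small, since the variational inequalities at two nearby points squeeze it. The contribution of y is
rewritten by pairing the linearised equation ∇_y g(x, y(x)) = 0 with v.

One iteration contracts four squared errors in expectation. A block is updated with probability s/m,
so its error decays at a rate of order sημ/m (`devα_step_le`, `devy_step_le`, `devv_step_le`). The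
error in y feeds that in α, both feed that in v, and all three bias the momentum, whose own noise is
of order 1/min(s,b) (`err_step_le`). Replacing the target at x_t by the one at x_{t+1} costs a
multiple of η₀²‖z_{t+1}‖². Since x_{t+1} + η₀z_{t+1} = x_t, every error is a function of the current
state, and the expectation is passed along the trajectory by independence and Fubini
(`integral_iter_succ_le`).

Each recursion is summed over time (`mul_sum_le_of_contraction`) and multiplied by a weight C₁, C₂
or C₃ chosen so that the one-directional couplings are absorbed (`mul_add_add_le_of_cascade`). With
N = T + 1 and Z the sum of E‖z_{t+1}‖², the weighted block errors contribute at most 3Nε²/20 + Z/32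
to the momentum error, and the momentum recursion itself contributes the same amount again. So the
summed momentum error is at most 3Nε²/10 + Z/16. The descent inequality bounds the summed squared
gradients by 2Δ_F/η₀ plus the summed momentum error minus 3Z/4. The negative term absorbs Z/16,
which gives the first bound. Discarding the nonnegative gradients instead bounds Z by the momentum
error, which gives the second (`guarantee_of_enoughIterations`).

For the complexity statement, the scaled steps satisfy all step-size conditions once their constants
are small (`stepConditions_scaledSteps`), and every lower bound on T becomes a constant times m/(s b
ε⁴) or 1/(min(s,b) ε⁴) (`enoughIterations_scaledSteps`). -/

theorem proj_spec (hne : K.Nonempty) (hcl : IsClosed K) (hcv : Convex ℝ K) (u : Vec n) :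
    proj K u ∈ K ∧ ∀ q ∈ K, ‖u - proj K u‖ ≤ ‖u - q‖ := by
  have hex : ∃ p, p ∈ K ∧ ∀ q ∈ K, ‖u - p‖ ≤ ‖u - q‖ := by
    obtain ⟨p, hp, h⟩ := exists_norm_eq_iInf_of_complete_convex hne hcl.isComplete hcv u
    refine ⟨p, hp, fun q hq => ?_⟩
    rw [h]
    exact ciInf_le ⟨0, by rintro _ ⟨w, rfl⟩; positivity⟩ (⟨q, hq⟩ : K)
  exact Classical.epsilon_spec hex

theorem proj_inner_le (hne : K.Nonempty) (hcl : IsClosed K) (hcv : Convex ℝ K) (u : Vec n)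
    {q : Vec n} (hq : q ∈ K) : inner ℝ (u - proj K u) (q - proj K u) ≤ 0 := by
  obtain ⟨hp, h⟩ := proj_spec hne hcl hcv u
  refine (norm_eq_iInf_iff_real_inner_le_zero hcv hp).1 (le_antisymm ?_ ?_) q hq
  · have : Nonempty K := ⟨⟨_, hp⟩⟩
    exact le_ciInf fun w => h w w.2
  · exact ciInf_le ⟨0, by rintro _ ⟨w, rfl⟩; positivity⟩ (⟨_, hp⟩ : K)

/-- The two variational inequalities, each tested at the other projection, add up to firm
nonexpansiveness; Cauchy–Schwarz then finishes. -/
theorem norm_proj_sub_proj_le (hne : K.Nonempty) (hcl : IsClosed K) (hcv : Convex ℝ K)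
    (u w : Vec n) : ‖proj K u - proj K w‖ ≤ ‖u - w‖ := by
  have h1 := proj_inner_le hne hcl hcv u (proj_spec hne hcl hcv w).1
  have h2 := proj_inner_le hne hcl hcv w (proj_spec hne hcl hcv u).1
  set a := proj K u
  set c := proj K w
  have h3 : ‖a - c‖ ^ 2 ≤ inner ℝ (u - w) (a - c) := by
    rw [← real_inner_self_eq_norm_sq]
    have e1 : inner ℝ (u - a) (c - a) = - inner ℝ (u - a) (a - c) := by
      rw [← inner_neg_right, neg_sub]
    have e2 : inner ℝ (u - w) (a - c)
        = inner ℝ (u - a) (a - c) + inner ℝ (a - c) (a - c) - inner ℝ (w - c) (a - c) := by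
      rw [← inner_add_left, ← inner_sub_left]; congr 1; abel
    linarith
  have h4 := real_inner_le_norm (u - w) (a - c)
  by_contra hlt
  push Not at hlt
  nlinarith [norm_nonneg (u - w), norm_nonneg (a - c)]

theorem proj_eq_self_of_inner_le (hne : K.Nonempty) (hcl : IsClosed K) (hcv : Convex ℝ K)
    {u a : Vec n} (ha : a ∈ K) (h : ∀ q ∈ K, inner ℝ (u - a) (q - a) ≤ 0) : proj K u = a := by
  have h1 := proj_inner_le hne hcl hcv u ha
  have h2 := h _ (proj_spec hne hcl hcv u).1
  set c := proj K u
  have h3 : inner ℝ (c - a) (c - a) ≤ 0 := by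
    have e1 : inner ℝ (u - c) (a - c) = - inner ℝ (u - c) (c - a) := by
      rw [← inner_neg_right, neg_sub]
    have e2 : inner ℝ (u - a) (c - a) = inner ℝ (u - c) (c - a) + inner ℝ (c - a) (c - a) := by
      rw [← inner_add_left]; congr 1; abel
    linarith
  exact sub_eq_zero.1 (real_inner_self_nonpos.1 h3)

/-- If `d` lies in the normal cone of `K` at `a`, then `a` is a fixed point of the projected step
along `d`, so nonexpansiveness compares an inexact step with the exact one. It serves with `d` the
gradient at a constrained maximiser and with `d = 0`. -/
theorem norm_proj_sub_le (hne : K.Nonempty) (hcl : IsClosed K) (hcv : Convex ℝ K)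
    {u a : Vec n} {d : Vec n} (ha : a ∈ K) (h : ∀ q ∈ K, inner ℝ d (q - a) ≤ 0) {η : ℝ}
    (hη : 0 ≤ η) : ‖proj K u - a‖ ≤ ‖u - (a + η • d)‖ := by
  have : proj K (a + η • d) = a := proj_eq_self_of_inner_le hne hcl hcv ha fun q hq => by
    rw [add_sub_cancel_left, real_inner_smul_left]
    exact mul_nonpos_of_nonneg_of_nonpos hη (h q hq)
  calc ‖proj K u - a‖ = ‖proj K u - proj K (a + η • d)‖ := by rw [this]
    _ ≤ _ := norm_proj_sub_proj_le hne hcl hcv _ _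

end Projection

/-! ### First-order consequences of strong convexity on a set. -/

section StronglyConvex

variable {n : ℕ} {K : Set (Vec n)} {μ : ℝ} {φ : Vec n → ℝ}

/-- Strong convexity on the segment from `a` to `c`, divided by the parameter `t`, bounds the
difference quotient at `a`. The limit is taken from the right because only `0 < t < 1` gives points
of the segment. -/
theorem strongConvexOn_add_inner_gradient_le (hφ : StrongConvexOn K μ φ) {a c : Vec n} (ha : a ∈ K)
    (hc : c ∈ K) (hd : DifferentiableAt ℝ φ a) :
    φ a + inner ℝ (gradient φ a) (c - a) + μ / 2 * ‖c - a‖ ^ 2 ≤ φ c := by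
  have hder : HasDerivAt (fun t : ℝ => φ (a + t • (c - a))) (inner ℝ (gradient φ a) (c - a)) 0 := by
    have h1 : HasFDerivAt φ (InnerProductSpace.toDual ℝ _ (gradient φ a)) (a + (0 : ℝ) • (c - a)) := by
      simpa using hd.hasGradientAt.hasFDerivAt
    have h2 : HasDerivAt (fun t : ℝ => a + t • (c - a)) (c - a) 0 := by
      simpa using ((hasDerivAt_id (0 : ℝ)).smul_const (c - a)).const_add a
    have h3 := h1.comp_hasDerivAt 0 h2
    simp only [InnerProductSpace.toDual_apply_apply] at h3
    exact h3
  have hlim := hder.tendsto_slope_zero_right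
  have hlim2 : Tendsto (fun t : ℝ => φ c - φ a - (1 - t) * (μ / 2 * ‖c - a‖ ^ 2)) (𝓝[>] 0)
      (𝓝 (φ c - φ a - (1 - 0) * (μ / 2 * ‖c - a‖ ^ 2))) := by
    apply Tendsto.mono_left _ nhdsWithin_le_nhds
    apply Continuous.tendsto
    fun_prop
  have := le_of_tendsto_of_tendsto hlim hlim2 (by
    filter_upwards [Ioo_mem_nhdsGT (zero_lt_one' ℝ)] with t ht
    have h3 := hφ.2 ha hc (sub_nonneg.2 ht.2.le) ht.1.le (by ring)
    have e : (1 - t) • a + t • c = a + t • (c - a) := by rw [smul_sub, sub_smul, one_smul]; abel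
    rw [e, norm_sub_rev a c] at h3
    simp only [smul_eq_mul, zero_add, zero_smul, add_zero] at h3 ⊢
    rw [inv_mul_le_iff₀ ht.1]
    nlinarith)
  linarith

theorem strongConvexOn_mul_sq_le_inner_gradient_sub (hφ : StrongConvexOn K μ φ) {a c : Vec n}
    (ha : a ∈ K) (hc : c ∈ K) (hda : DifferentiableAt ℝ φ a) (hdc : DifferentiableAt ℝ φ c) :
    μ * ‖a - c‖ ^ 2 ≤ inner ℝ (gradient φ a - gradient φ c) (a - c) := by
  have h1 := strongConvexOn_add_inner_gradient_le hφ ha hc hda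
  have h2 := strongConvexOn_add_inner_gradient_le hφ hc ha hdc
  have e : inner ℝ (gradient φ a) (c - a) = - inner ℝ (gradient φ a) (a - c) := by
    rw [← inner_neg_right, neg_sub]
  rw [norm_sub_rev c a] at h1
  rw [inner_sub_left]
  linarith

theorem strongConvexOn_exists_isMinOn (hφ : StrongConvexOn K μ φ) (hμ : 0 < μ) (hne : K.Nonempty)
    (hcl : IsClosed K) (hd : ∀ a ∈ K, DifferentiableAt ℝ φ a) :
    ∃ a, a ∈ K ∧ ∀ c ∈ K, φ a ≤ φ c := by
  obtain ⟨a, ha⟩ := hne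
  have hcont : ContinuousOn φ K := fun c hc => (hd c hc).continuousAt.continuousWithinAt
  -- Coercivity: once `‖c - a‖` exceeds `2‖∇φ(a)‖/μ`, the quadratic term of the lower bound beats
  -- the linear one and `φ a ≤ φ c`.
  obtain ⟨p, hp, hmin⟩ := hcont.exists_isMinOn' hcl ha (by
    rw [eventually_inf_principal]
    have hb : ∀ᶠ c in cocompact (Vec n), 2 * ‖gradient φ a‖ / μ ≤ ‖c - a‖ := by
      have : Tendsto (fun c : Vec n => ‖c - a‖) (cocompact (Vec n)) atTop := by
        have h := tendsto_norm_cocompact_atTop (E := Vec n)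
        refine tendsto_atTop_mono (f := fun c => -‖a‖ + ‖c‖) (fun c => ?_)
          (tendsto_atTop_add_const_left _ _ h)
        linarith [norm_sub_norm_le c a]
      exact this.eventually_ge_atTop _
    filter_upwards [hb] with c hc hcK
    have h1 := strongConvexOn_add_inner_gradient_le hφ ha hcK (hd a ha)
    have h2 := neg_le_of_abs_le (abs_real_inner_le_norm (gradient φ a) (c - a))
    rw [div_le_iff₀ hμ] at hc
    nlinarith [norm_nonneg (c - a)])
  exact ⟨p, hp, fun c hc => hmin hc⟩

theorem inner_gradient_nonneg_of_isMinOn (hcv : Convex ℝ K) {a : Vec n} (ha : a ∈ K)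
    (hmin : ∀ c ∈ K, φ a ≤ φ c) (hd : DifferentiableAt ℝ φ a) {c : Vec n} (hc : c ∈ K) :
    0 ≤ inner ℝ (gradient φ a) (c - a) := by
  have h := (show IsMinOn φ K a from hmin).localize.hasFDerivWithinAt_nonneg (y := c - a)
    hd.hasGradientAt.hasFDerivAt.hasFDerivWithinAt
    (sub_mem_posTangentConeAt_of_segment_subset (hcv.segment_subset ha hc))
  simpa using h

end StronglyConvex

/-! ### Gradients of general functions and the descent inequality. -/

section GradientGeneral

theorem gradient_neg' {n : ℕ} (φ : Vec n → ℝ) (a : Vec n) :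
    gradient (fun x => - φ x) a = - gradient φ a := by
  unfold gradient
  rw [fderiv_fun_neg, map_neg]

theorem inner_gradient {n : ℕ} (φ : Vec n → ℝ) (a d : Vec n) :
    inner ℝ (gradient φ a) d = fderiv ℝ φ a d := by
  unfold gradient
  exact InnerProductSpace.toDual_symm_apply

theorem norm_gradient_le_of_lipschitz {n : ℕ} {φ : Vec n → ℝ} {C : ℝ} (hC : 0 ≤ C)
    (h : ∀ x x', |φ x - φ x'| ≤ C * ‖x - x'‖) (a : Vec n) : ‖gradient φ a‖ ≤ C := by
  unfold gradient
  rw [LinearIsometryEquiv.norm_map]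
  have : LipschitzWith ⟨C, hC⟩ φ := LipschitzWith.of_dist_le_mul fun x y => by
    rw [Real.dist_eq, dist_eq_norm]; exact h x y
  exact norm_fderiv_le_of_lipschitz ℝ this

/-- The mean value theorem along the segment replaces the usual integral of the gradient; this is
why the quadratic term carries `L` and not `L / 2`. -/
theorem le_add_inner_gradient_add_sq {n : ℕ} {φ : Vec n → ℝ} (hd : Differentiable ℝ φ) {L : ℝ}
    (hL : ∀ x x', ‖gradient φ x - gradient φ x'‖ ≤ L * ‖x - x'‖) (x h : Vec n) :
    φ (x + h) ≤ φ x + inner ℝ (gradient φ x) h + L * ‖h‖ ^ 2 := by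
  have hder : ∀ t : ℝ, HasDerivAt (fun t : ℝ => φ (x + t • h))
      (inner ℝ (gradient φ (x + t • h)) h) t := fun t => by
    have h1 : HasFDerivAt φ (InnerProductSpace.toDual ℝ _ (gradient φ (x + t • h))) (x + t • h) :=
      (hd _).hasGradientAt.hasFDerivAt
    have h2 : HasDerivAt (fun t : ℝ => x + t • h) h t := by
      simpa using ((hasDerivAt_id t).smul_const h).const_add x
    have h3 := h1.comp_hasDerivAt t h2
    simp only [InnerProductSpace.toDual_apply_apply] at h3
    exact h3
  obtain ⟨c, hc, hcd⟩ := exists_hasDerivAt_eq_slope (fun t : ℝ => φ (x + t • h))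
    (fun t => inner ℝ (gradient φ (x + t • h)) h) (zero_lt_one' ℝ)
    (fun t _ => (hder t).continuousAt.continuousWithinAt) (fun t _ => hder t)
  simp only [one_smul, zero_smul, add_zero, sub_zero, div_one] at hcd
  have h1 := real_inner_le_norm (gradient φ (x + c • h) - gradient φ x) h
  rw [inner_sub_left] at h1
  have h2 := hL (x + c • h) x
  rw [add_sub_cancel_left, norm_smul, Real.norm_of_nonneg hc.1.le] at h2
  have h3 : 0 ≤ L * ‖h‖ := by
    have := (norm_nonneg _).trans (hL (x + h) x)
    simpa using this
  nlinarith [norm_nonneg h, mul_le_mul_of_nonneg_right h2 (norm_nonneg h), hc.2, mul_nonneg h3 (norm_nonneg h)]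

end GradientGeneral

theorem sqrt_add_sq_le_add {a c : ℝ} (ha : 0 ≤ a) (hc : 0 ≤ c) : √(a ^ 2 + c ^ 2) ≤ a + c :=
  Real.sqrt_le_iff.2 ⟨by positivity, by nlinarith [mul_nonneg ha hc]⟩

theorem sqrt_add_sq_add_sq_le_add {a c d : ℝ} (ha : 0 ≤ a) (hc : 0 ≤ c) (hd : 0 ≤ d) :
    √(a ^ 2 + c ^ 2 + d ^ 2) ≤ a + c + d :=
  Real.sqrt_le_iff.2 ⟨by positivity,
    by nlinarith [mul_nonneg ha hc, mul_nonneg ha hd, mul_nonneg hc hd]⟩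

/-! ### Lipschitz constants of the solution maps and of the gradient of `F`. -/

namespace Params
variable (p : Params)

/-- A Lipschitz constant of `x ↦ α_i(x)`. -/
def lipα : ℝ := p.Cα * (1 + p.Cy)

/-- A Lipschitz constant of `x ↦ v_i(x)`. -/
def lipv : ℝ := (p.Lf * (1 + p.lipα + p.Cy) + p.Lgyy * (1 + p.Cy) * p.Γ) / p.μg

/-- A Lipschitz constant of `(x, α, y, v) ↦ ∇ₓ f_i - ∇²_{xy} g_i v` for the sum of the norms. -/
def lipDir : ℝ := p.Lf + p.Lgxy * p.Γ + p.Cgxy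

/-- A Lipschitz constant of `∇F`. -/
def lipGrad : ℝ := p.lipDir * (1 + p.lipα + p.Cy + p.lipv)

theorem Γ_nonneg : 0 ≤ p.Γ := div_nonneg p.Cf_nonneg p.μg_pos.le
theorem Cy_pos : 0 < p.Cy := div_pos p.Lg_pos p.μg_pos
theorem Cα_pos : 0 < p.Cα := div_pos p.Lf_pos p.μf_pos
theorem lipα_pos : 0 < p.lipα := by
  have := p.Cy_pos; have := p.Cα_pos; unfold lipα; positivity
theorem lipv_pos : 0 < p.lipv := by
  have := p.Cy_pos; have := p.lipα_pos; have := p.Γ_nonneg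
  have := p.Lgyy_nonneg; have := p.Lf_pos; have := p.μg_pos
  unfold lipv; positivity
theorem lipDir_pos : 0 < p.lipDir := by
  have := p.Γ_nonneg; have := p.Lgxy_nonneg; have := p.Cgxy_nonneg; have := p.Lf_pos
  unfold lipDir; positivity
theorem lipGrad_pos : 0 < p.lipGrad := by
  have := p.lipDir_pos; have := p.lipα_pos; have := p.Cy_pos; have := p.lipv_pos
  unfold lipGrad; positivity

end Params

namespace Problem

variable {m dX dA dY b : ℕ} {Ξ : Fin m → Type u} [∀ i, MeasurableSpace (Ξ i)]
  {P : Problem m dX dA dY b Ξ} {p : Params}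

namespace StructuralAssumptions

variable (H : P.StructuralAssumptions p) (i : Fin m)
include H

/-! ### Componentwise forms of the smoothness assumptions. -/

section SmoothnessBounds

theorem gradf_lipschitz {x x' : Vec dX} {α α' : Vec dA} {y y' : Vec dY} (hα : α ∈ P.A)
    (hα' : α' ∈ P.A) :
    √(‖P.gradXf i x α y - P.gradXf i x' α' y'‖ ^ 2 + ‖P.gradAf i x α y - P.gradAf i x' α' y'‖ ^ 2
        + ‖P.gradYf i x α y - P.gradYf i x' α' y'‖ ^ 2)
      ≤ p.Lf * (‖x - x'‖ + ‖α - α'‖ + ‖y - y'‖) :=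
  (H.f_smooth i x x' y y' α hα α' hα').trans
    (mul_le_mul_of_nonneg_left
      (sqrt_add_sq_add_sq_le_add (norm_nonneg _) (norm_nonneg _) (norm_nonneg _)) p.Lf_pos.le)

theorem gradXf_lipschitz {x x' : Vec dX} {α α' : Vec dA} {y y' : Vec dY} (hα : α ∈ P.A)
    (hα' : α' ∈ P.A) : ‖P.gradXf i x α y - P.gradXf i x' α' y'‖
      ≤ p.Lf * (‖x - x'‖ + ‖α - α'‖ + ‖y - y'‖) :=
  (Real.le_sqrt_of_sq_le (by
    linarith [sq_nonneg ‖P.gradAf i x α y - P.gradAf i x' α' y'‖,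
      sq_nonneg ‖P.gradYf i x α y - P.gradYf i x' α' y'‖])).trans (H.gradf_lipschitz i hα hα')

theorem gradAf_lipschitz {x x' : Vec dX} {α α' : Vec dA} {y y' : Vec dY} (hα : α ∈ P.A)
    (hα' : α' ∈ P.A) : ‖P.gradAf i x α y - P.gradAf i x' α' y'‖
      ≤ p.Lf * (‖x - x'‖ + ‖α - α'‖ + ‖y - y'‖) :=
  (Real.le_sqrt_of_sq_le (by
    linarith [sq_nonneg ‖P.gradXf i x α y - P.gradXf i x' α' y'‖,
      sq_nonneg ‖P.gradYf i x α y - P.gradYf i x' α' y'‖])).trans (H.gradf_lipschitz i hα hα')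

theorem gradYf_lipschitz {x x' : Vec dX} {α α' : Vec dA} {y y' : Vec dY} (hα : α ∈ P.A)
    (hα' : α' ∈ P.A) : ‖P.gradYf i x α y - P.gradYf i x' α' y'‖
      ≤ p.Lf * (‖x - x'‖ + ‖α - α'‖ + ‖y - y'‖) :=
  (Real.le_sqrt_of_sq_le (by
    linarith [sq_nonneg ‖P.gradXf i x α y - P.gradXf i x' α' y'‖,
      sq_nonneg ‖P.gradAf i x α y - P.gradAf i x' α' y'‖])).trans (H.gradf_lipschitz i hα hα')

theorem gradYg_lipschitz {x x' : Vec dX} {y y' : Vec dY} :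
    ‖P.gradYg i x y - P.gradYg i x' y'‖ ≤ p.Lg * (‖x - x'‖ + ‖y - y'‖) :=
  (Real.le_sqrt_of_sq_le (by linarith [sq_nonneg ‖P.gradXg i x y - P.gradXg i x' y'‖])).trans
    ((H.g_smooth i x x' y y').trans (mul_le_mul_of_nonneg_left
      (sqrt_add_sq_le_add (norm_nonneg _) (norm_nonneg _)) p.Lg_pos.le))

theorem hessXYg_lipschitz_add {x x' : Vec dX} {y y' : Vec dY} :
    ‖P.hessXYg i x y - P.hessXYg i x' y'‖ ≤ p.Lgxy * (‖x - x'‖ + ‖y - y'‖) :=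
  (H.hessXYg_lipschitz i x x' y y').trans (mul_le_mul_of_nonneg_left
    (sqrt_add_sq_le_add (norm_nonneg _) (norm_nonneg _)) p.Lgxy_nonneg)

theorem hessYYg_lipschitz_add {x x' : Vec dX} {y y' : Vec dY} :
    ‖P.hessYYg i x y - P.hessYYg i x' y'‖ ≤ p.Lgyy * (‖x - x'‖ + ‖y - y'‖) :=
  (H.hessYYg_lipschitz i x x' y y').trans (mul_le_mul_of_nonneg_left
    (sqrt_add_sq_le_add (norm_nonneg _) (norm_nonneg _)) p.Lgyy_nonneg)

theorem norm_hessXYg_le (x : Vec dX) (y : Vec dY) : ‖P.hessXYg i x y‖ ≤ p.Cgxy :=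
  (sq_le_sq₀ (norm_nonneg _) p.Cgxy_nonneg).1 (H.hessXYg_bounded i x y)

theorem norm_gradXf_le {x : Vec dX} {α : Vec dA} {y : Vec dY} (hα : α ∈ P.A) :
    ‖P.gradXf i x α y‖ ≤ p.Cf :=
  norm_gradient_le_of_lipschitz p.Cf_nonneg (fun x x' => by
    simpa [Real.sqrt_sq (norm_nonneg _)] using H.f_lipschitz i x x' y y α hα α hα) x

theorem norm_gradYf_le {x : Vec dX} {α : Vec dA} {y : Vec dY} (hα : α ∈ P.A) :
    ‖P.gradYf i x α y‖ ≤ p.Cf :=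
  norm_gradient_le_of_lipschitz p.Cf_nonneg (fun y y' => by
    simpa [Real.sqrt_sq (norm_nonneg _)] using H.f_lipschitz i x x y y' α hα α hα) y

end SmoothnessBounds

/-! ### Partial derivatives and symmetry of the second derivative of `g`. -/

section Partial

theorem f_partial_differentiableAt {x : Vec dX} {α : Vec dA} {y : Vec dY} (hα : α ∈ P.A) :
    DifferentiableAt ℝ (fun α' => P.f i x α' y) α :=
  (H.f_differentiable i x y α hα).comp (f := fun α' : Vec dA => (x, α', y)) α (by fun_prop)

theorem fderiv_f_apply {x : Vec dX} {α : Vec dA} {y : Vec dY} (hα : α ∈ P.A)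
    (h : Vec dX) (k : Vec dA) (l : Vec dY) :
    fderiv ℝ (fun q : Vec dX × Vec dA × Vec dY => P.f i q.1 q.2.1 q.2.2) (x, α, y) (h, k, l)
      = inner ℝ (P.gradXf i x α y) h + inner ℝ (P.gradAf i x α y) k
        + inner ℝ (P.gradYf i x α y) l := by
  have hd := H.f_differentiable i x y α hα
  have h1 : fderiv ℝ (fun x' => P.f i x' α y) x
      = (fderiv ℝ (fun q : Vec dX × Vec dA × Vec dY => P.f i q.1 q.2.1 q.2.2) (x, α, y)).comp
        (ContinuousLinearMap.inl ℝ _ _) :=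
    (HasFDerivAt.comp (f := fun x' : Vec dX => (x', α, y)) x hd.hasFDerivAt
      (hasFDerivAt_prodMk_left x (α, y))).fderiv
  have h2 : fderiv ℝ (fun α' => P.f i x α' y) α
      = (fderiv ℝ (fun q : Vec dX × Vec dA × Vec dY => P.f i q.1 q.2.1 q.2.2) (x, α, y)).comp
        ((ContinuousLinearMap.inr ℝ _ _).comp (ContinuousLinearMap.inl ℝ _ _)) :=
    (HasFDerivAt.comp (f := fun α' : Vec dA => (x, α', y)) α hd.hasFDerivAt
      (HasFDerivAt.comp (f := fun α' : Vec dA => (α', y)) α (hasFDerivAt_prodMk_right x (α, y))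
        (hasFDerivAt_prodMk_left α y))).fderiv
  have h3 : fderiv ℝ (fun y' => P.f i x α y') y
      = (fderiv ℝ (fun q : Vec dX × Vec dA × Vec dY => P.f i q.1 q.2.1 q.2.2) (x, α, y)).comp
        ((ContinuousLinearMap.inr ℝ _ _).comp (ContinuousLinearMap.inr ℝ _ _)) :=
    (HasFDerivAt.comp (f := fun y' : Vec dY => (x, α, y')) y hd.hasFDerivAt
      (HasFDerivAt.comp (f := fun y' : Vec dY => (α, y')) y (hasFDerivAt_prodMk_right x (α, y))
        (hasFDerivAt_prodMk_right α y))).fderiv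
  unfold gradXf gradAf gradYf
  rw [inner_gradient, inner_gradient, inner_gradient, h1, h2, h3]
  simp only [ContinuousLinearMap.comp_apply, ContinuousLinearMap.inl_apply,
    ContinuousLinearMap.inr_apply]
  rw [← map_add, ← map_add]
  simp

theorem g_partial_differentiable (x : Vec dX) : Differentiable ℝ (fun y => P.g i x y) :=
  fun y => (H.g_differentiable i (x, y)).comp (f := fun y' : Vec dY => (x, y')) y (by fun_prop)

theorem gradYg_eq (q : Vec dX × Vec dY) :
    P.gradYg i q.1 q.2 = (InnerProductSpace.toDual ℝ (Vec dY)).symm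
      ((fderiv ℝ (fun q : Vec dX × Vec dY => P.g i q.1 q.2) q).comp
        (ContinuousLinearMap.inr ℝ _ _)) := by
  have h : fderiv ℝ (fun y' => P.g i q.1 y') q.2
      = (fderiv ℝ (fun q : Vec dX × Vec dY => P.g i q.1 q.2) q).comp
        (ContinuousLinearMap.inr ℝ _ _) :=
    ((H.g_differentiable i (q.1, q.2)).hasFDerivAt.comp q.2
      (hasFDerivAt_prodMk_right q.1 q.2)).fderiv
  unfold gradYg gradient
  rw [h]

theorem gradXg_eq (q : Vec dX × Vec dY) :
    P.gradXg i q.1 q.2 = (InnerProductSpace.toDual ℝ (Vec dX)).symm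
      ((fderiv ℝ (fun q : Vec dX × Vec dY => P.g i q.1 q.2) q).comp
        (ContinuousLinearMap.inl ℝ _ _)) := by
  have h : fderiv ℝ (fun x' => P.g i x' q.2) q.1
      = (fderiv ℝ (fun q : Vec dX × Vec dY => P.g i q.1 q.2) q).comp
        (ContinuousLinearMap.inl ℝ _ _) :=
    (HasFDerivAt.comp (f := fun x' : Vec dX => (x', q.2)) q.1
      (H.g_differentiable i (q.1, q.2)).hasFDerivAt (hasFDerivAt_prodMk_left q.1 q.2)).fderiv
  unfold gradXg gradient
  rw [h]

theorem gradYg_joint_differentiable :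
    Differentiable ℝ (fun q : Vec dX × Vec dY => P.gradYg i q.1 q.2) := by
  have h := H.g_twice_differentiable i
  simp_rw [H.gradYg_eq i]
  exact (InnerProductSpace.toDual ℝ (Vec dY)).symm.toContinuousLinearEquiv.toContinuousLinearMap.differentiable.comp
    (h.clm_comp (differentiable_const _))

theorem gradXg_joint_differentiable :
    Differentiable ℝ (fun q : Vec dX × Vec dY => P.gradXg i q.1 q.2) := by
  have h := H.g_twice_differentiable i
  simp_rw [H.gradXg_eq i]
  exact (InnerProductSpace.toDual ℝ (Vec dX)).symm.toContinuousLinearEquiv.toContinuousLinearMap.differentiable.comp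
    (h.clm_comp (differentiable_const _))

theorem inner_fderiv_gradYg (q w : Vec dX × Vec dY) (k : Vec dY) :
    inner ℝ (fderiv ℝ (fun q : Vec dX × Vec dY => P.gradYg i q.1 q.2) q w) k
      = fderiv ℝ (fderiv ℝ (fun q : Vec dX × Vec dY => P.g i q.1 q.2)) q w (0, k) := by
  have h1 := ((H.gradYg_joint_differentiable i q).hasFDerivAt).inner ℝ (hasFDerivAt_const k q)
  have h2 := ((H.g_twice_differentiable i q).hasFDerivAt).clm_apply
    (hasFDerivAt_const ((0 : Vec dX), k) q)
  have e : (fun q : Vec dX × Vec dY => inner ℝ (P.gradYg i q.1 q.2) k)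
      = fun q => fderiv ℝ (fun q : Vec dX × Vec dY => P.g i q.1 q.2) q (0, k) := by
    funext q
    rw [H.gradYg_eq i q, InnerProductSpace.toDual_symm_apply]; rfl
  rw [e] at h1
  have h3 := congrArg (fun T => T w) (h1.unique h2)
  simpa using h3

theorem inner_fderiv_gradXg (q w : Vec dX × Vec dY) (h : Vec dX) :
    inner ℝ (fderiv ℝ (fun q : Vec dX × Vec dY => P.gradXg i q.1 q.2) q w) h
      = fderiv ℝ (fderiv ℝ (fun q : Vec dX × Vec dY => P.g i q.1 q.2)) q w (h, 0) := by
  have h1 := ((H.gradXg_joint_differentiable i q).hasFDerivAt).inner ℝ (hasFDerivAt_const h q)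
  have h2 := ((H.g_twice_differentiable i q).hasFDerivAt).clm_apply
    (hasFDerivAt_const (h, (0 : Vec dY)) q)
  have e : (fun q : Vec dX × Vec dY => inner ℝ (P.gradXg i q.1 q.2) h)
      = fun q => fderiv ℝ (fun q : Vec dX × Vec dY => P.g i q.1 q.2) q (h, 0) := by
    funext q
    rw [H.gradXg_eq i q, InnerProductSpace.toDual_symm_apply]; rfl
  rw [e] at h1
  have h3 := congrArg (fun T => T w) (h1.unique h2)
  simpa using h3

theorem hasFDerivAt_gradYg (x : Vec dX) (y : Vec dY) :
    HasFDerivAt (fun y' => P.gradYg i x y') (P.hessYYg i x y) y :=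
  ((H.gradYg_joint_differentiable i (x, y)).comp (f := fun y' : Vec dY => (x, y')) y
    (by fun_prop)).hasFDerivAt

theorem fderiv_gradYg_inr (x : Vec dX) (y k : Vec dY) :
    fderiv ℝ (fun q : Vec dX × Vec dY => P.gradYg i q.1 q.2) (x, y) (0, k)
      = P.hessYYg i x y k := by
  have h : P.hessYYg i x y
      = (fderiv ℝ (fun q : Vec dX × Vec dY => P.gradYg i q.1 q.2) (x, y)).comp
        (ContinuousLinearMap.inr ℝ _ _) :=
    ((H.gradYg_joint_differentiable i (x, y)).hasFDerivAt.comp y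
      (hasFDerivAt_prodMk_right x y)).fderiv
  rw [h]; rfl

theorem fderiv_gradXg_inr (x : Vec dX) (y k : Vec dY) :
    fderiv ℝ (fun q : Vec dX × Vec dY => P.gradXg i q.1 q.2) (x, y) (0, k)
      = P.hessXYg i x y k := by
  have h : P.hessXYg i x y
      = (fderiv ℝ (fun q : Vec dX × Vec dY => P.gradXg i q.1 q.2) (x, y)).comp
        (ContinuousLinearMap.inr ℝ _ _) :=
    ((H.gradXg_joint_differentiable i (x, y)).hasFDerivAt.comp y
      (hasFDerivAt_prodMk_right x y)).fderiv
  rw [h]; rfl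

theorem second_fderiv_g_symm (q v w : Vec dX × Vec dY) :
    fderiv ℝ (fderiv ℝ (fun q : Vec dX × Vec dY => P.g i q.1 q.2)) q v w
      = fderiv ℝ (fderiv ℝ (fun q : Vec dX × Vec dY => P.g i q.1 q.2)) q w v :=
  second_derivative_symmetric (fun y => (H.g_differentiable i y).hasFDerivAt)
    (H.g_twice_differentiable i q).hasFDerivAt v w

/-- Implicit differentiation of `∇_y g = 0` produces the `x`-derivative of `∇_y g`, while `hessXYg`
is the `y`-derivative of `∇ₓ g`. Symmetry of the second derivative says that they are adjoint. -/
theorem inner_fderiv_gradYg_inl (x h : Vec dX) (y k : Vec dY) :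
    inner ℝ (fderiv ℝ (fun q : Vec dX × Vec dY => P.gradYg i q.1 q.2) (x, y) (h, 0)) k
      = inner ℝ (P.hessXYg i x y k) h := by
  rw [H.inner_fderiv_gradYg, H.second_fderiv_g_symm, ← H.inner_fderiv_gradXg,
    H.fderiv_gradXg_inr]

theorem inner_hessYYg_comm (x : Vec dX) (y k l : Vec dY) :
    inner ℝ (P.hessYYg i x y k) l = inner ℝ (P.hessYYg i x y l) k := by
  rw [← H.fderiv_gradYg_inr, ← H.fderiv_gradYg_inr, H.inner_fderiv_gradYg,
    H.second_fderiv_g_symm, ← H.inner_fderiv_gradYg]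

end Partial

/-! ### Coercivity, boundedness and invertibility of the lower-level Hessian. -/

section Hessian

theorem gradYg_strongly_monotone (x : Vec dX) (y y' : Vec dY) :
    p.μg * ‖y - y'‖ ^ 2 ≤ inner ℝ (P.gradYg i x y - P.gradYg i x y') (y - y') :=
  strongConvexOn_mul_sq_le_inner_gradient_sub (H.g_convex i x) (Set.mem_univ _) (Set.mem_univ _)
    (H.g_partial_differentiable i x y) (H.g_partial_differentiable i x y')

/-- Strong monotonicity between `y + t • d` and `y`, divided by `t ^ 2`, passes to the limit `t ↓
0`. -/
theorem hessYYg_coercive (x : Vec dX) (y d : Vec dY) :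
    p.μg * ‖d‖ ^ 2 ≤ inner ℝ (P.hessYYg i x y d) d := by
  have h2 : HasDerivAt (fun t : ℝ => y + t • d) d 0 := by
    simpa using ((hasDerivAt_id (0 : ℝ)).smul_const d).const_add y
  have h1 : HasFDerivAt (fun y' => P.gradYg i x y') (P.hessYYg i x y) (y + (0 : ℝ) • d) := by
    simpa using H.hasFDerivAt_gradYg i x y
  have h3 := (h1.comp_hasDerivAt 0 h2).tendsto_slope_zero_right
  have h4 := h3.inner (tendsto_const_nhds (x := d)) (𝕜 := ℝ)
  refine ge_of_tendsto h4 ?_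
  filter_upwards [self_mem_nhdsWithin] with t (ht : 0 < t)
  have h5 := H.gradYg_strongly_monotone i x (y + t • d) y
  simp only [add_sub_cancel_left, norm_smul, Real.norm_of_nonneg ht.le, inner_smul_right] at h5
  simp only [Function.comp_apply, zero_add, zero_smul, add_zero, real_inner_smul_left]
  have h6 : t * (t * (p.μg * ‖d‖ ^ 2)) ≤ t * inner ℝ (P.gradYg i x (y + t • d) - P.gradYg i x y) d := by
    linarith [h5, mul_pow t ‖d‖ 2]
  have h7 := le_of_mul_le_mul_left h6 ht
  rwa [le_inv_mul_iff₀ ht]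

theorem norm_hessYYg_le (x : Vec dX) (y : Vec dY) : ‖P.hessYYg i x y‖ ≤ p.Lg := by
  have : LipschitzWith ⟨p.Lg, p.Lg_pos.le⟩ (fun y' => P.gradYg i x y') :=
    LipschitzWith.of_dist_le_mul fun y y' => by
      rw [dist_eq_norm, dist_eq_norm]
      refine (H.gradYg_lipschitz i).trans_eq ?_
      rw [sub_self, norm_zero, zero_add]; rfl
  exact norm_fderiv_le_of_lipschitz ℝ this

/-- `ContinuousLinearMap.inverse` is meaningful only at invertible operators. Coercivity gives
injectivity, and finite dimension turns this into an equivalence. -/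
theorem hessYYg_apply_inverse (x : Vec dX) (y w : Vec dY) :
    P.hessYYg i x y (ContinuousLinearMap.inverse (P.hessYYg i x y) w) = w := by
  have hinj : Function.Injective (P.hessYYg i x y : Vec dY →ₗ[ℝ] Vec dY) := by
    rw [← LinearMap.ker_eq_bot, LinearMap.ker_eq_bot']
    intro d hd
    have h1 := H.hessYYg_coercive i x y d
    have hd' : P.hessYYg i x y d = 0 := hd
    rw [hd', inner_zero_left] at h1
    have h2 : ‖d‖ ^ 2 ≤ 0 := nonpos_of_mul_nonpos_right h1 p.μg_pos
    simpa using le_antisymm h2 (sq_nonneg _)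
  let e : Vec dY ≃L[ℝ] Vec dY :=
    (LinearEquiv.ofInjectiveEndo (P.hessYYg i x y : Vec dY →ₗ[ℝ] Vec dY) hinj).toContinuousLinearEquiv
  have he : (e : Vec dY →L[ℝ] Vec dY) = P.hessYYg i x y := by
    ext1 d; rfl
  rw [← he, ContinuousLinearMap.inverse_equiv]
  simp

end Hessian

/-! ### Existence, optimality and Lipschitz dependence of the solution maps. -/

section Solutions

theorem yStar_spec (x : Vec dX) (y' : Vec dY) : P.g i x (P.yStar i x) ≤ P.g i x y' := by
  have hex : ∃ y, ∀ y', P.g i x y ≤ P.g i x y' := by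
    obtain ⟨y, -, hy⟩ := strongConvexOn_exists_isMinOn (H.g_convex i x) p.μg_pos Set.univ_nonempty
      isClosed_univ (fun y _ => H.g_partial_differentiable i x y)
    exact ⟨y, fun y' => hy y' (Set.mem_univ _)⟩
  exact Classical.epsilon_spec hex y'

theorem gradYg_yStar (x : Vec dX) : P.gradYg i x (P.yStar i x) = 0 := by
  have h : IsLocalMin (fun y => P.g i x y) (P.yStar i x) :=
    Eventually.of_forall fun y' => H.yStar_spec i x y'
  unfold gradYg gradient
  rw [h.fderiv_eq_zero, map_zero]

theorem yStar_lipschitz (x x' : Vec dX) :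
    ‖P.yStar i x - P.yStar i x'‖ ≤ p.Cy * ‖x - x'‖ := by
  set y := P.yStar i x with hy
  set y' := P.yStar i x' with hy'
  have h1 := H.gradYg_strongly_monotone i x y y'
  -- Both optimal gradients vanish, so `∇_y g(x, y)` may be replaced by `∇_y g(x', y')`; the
  -- remaining difference is at the common point `y'` and varies in `x` only.
  rw [H.gradYg_yStar i x, ← H.gradYg_yStar i x'] at h1
  have h2 := real_inner_le_norm (P.gradYg i x' y' - P.gradYg i x y') (y - y')
  have h3 := H.gradYg_lipschitz i (x := x') (x' := x) (y := y') (y' := y')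
  rw [sub_self, norm_zero, add_zero, norm_sub_rev x'] at h3
  have h4 : p.μg * ‖y - y'‖ ≤ p.Lg * ‖x - x'‖ := by
    rcases (norm_nonneg (y - y')).eq_or_lt with h0 | h0
    · rw [← h0, mul_zero]; exact mul_nonneg p.Lg_pos.le (norm_nonneg _)
    · refine le_of_mul_le_mul_right ?_ h0
      nlinarith [mul_le_mul_of_nonneg_right h3 h0.le]
  rw [Params.Cy, div_mul_eq_mul_div, le_div_iff₀ p.μg_pos]
  linarith

theorem αStar_spec (x : Vec dX) : P.αStar i x ∈ P.A ∧ ∀ α' ∈ P.A,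
    P.f i x α' (P.yStar i x) ≤ P.f i x (P.αStar i x) (P.yStar i x) := by
  have hex : ∃ α, α ∈ P.A ∧ ∀ α' ∈ P.A,
      P.f i x α' (P.yStar i x) ≤ P.f i x α (P.yStar i x) := by
    obtain ⟨α, hα, h⟩ := strongConvexOn_exists_isMinOn (φ := fun α => - P.f i x α (P.yStar i x))
      (H.f_concave i x (P.yStar i x)).neg p.μf_pos H.A_nonempty H.A_closed
      (fun α hα => (H.f_partial_differentiableAt i hα).neg)
    exact ⟨α, hα, fun α' hα' => neg_le_neg_iff.1 (h α' hα')⟩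
  exact Classical.epsilon_spec hex

theorem αStar_mem (x : Vec dX) : P.αStar i x ∈ P.A := (H.αStar_spec i x).1

theorem inner_gradAf_αStar_le (x : Vec dX) {α : Vec dA} (hα : α ∈ P.A) :
    inner ℝ (P.gradAf i x (P.αStar i x) (P.yStar i x)) (α - P.αStar i x) ≤ 0 := by
  have h := inner_gradient_nonneg_of_isMinOn (φ := fun α => - P.f i x α (P.yStar i x))
    H.A_convex (H.αStar_mem i x) (fun c hc => neg_le_neg ((H.αStar_spec i x).2 c hc))
    (H.f_partial_differentiableAt i (H.αStar_mem i x)).neg hα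
  rw [gradient_neg', inner_neg_left] at h
  exact neg_nonneg.1 h

theorem gradAf_strongly_monotone (x : Vec dX) (y : Vec dY) {α α' : Vec dA} (hα : α ∈ P.A)
    (hα' : α' ∈ P.A) :
    inner ℝ (P.gradAf i x α y - P.gradAf i x α' y) (α - α') ≤ - (p.μf * ‖α - α'‖ ^ 2) := by
  have h := strongConvexOn_mul_sq_le_inner_gradient_sub (φ := fun α => - P.f i x α y)
    (H.f_concave i x y).neg hα hα' (H.f_partial_differentiableAt i hα).neg
    (H.f_partial_differentiableAt i hα').neg
  rw [gradient_neg', gradient_neg', ← neg_sub', inner_neg_left] at h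
  exact le_neg_of_le_neg h

/-- A maximiser over `A` need not be stationary, so the variational inequalities at `x` and `x'`,
each tested at the other maximiser, play the role of vanishing gradients. With strong monotonicity
only the change of `∇_α f` in `(x, y)` at a fixed `α` remains. -/
theorem αStar_lipschitz (x x' : Vec dX) :
    ‖P.αStar i x - P.αStar i x'‖ ≤ p.lipα * ‖x - x'‖ := by
  have hy := H.yStar_lipschitz i x x'
  set α := P.αStar i x with hα
  set α' := P.αStar i x' with hα'
  have hm := H.αStar_mem i x
  have hm' := H.αStar_mem i x'
  have h1 := H.gradAf_strongly_monotone i x (P.yStar i x) hm hm'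
  have h2 := H.inner_gradAf_αStar_le i x hm'
  have h3 := H.inner_gradAf_αStar_le i x' hm
  rw [← hα, ← hα'] at h1
  have h4 := real_inner_le_norm (P.gradAf i x' α' (P.yStar i x') - P.gradAf i x α' (P.yStar i x))
    (α' - α)
  have h5 := H.gradAf_lipschitz i (x := x') (x' := x) (α := α') (α' := α') (y := P.yStar i x')
    (y' := P.yStar i x) hm' hm'
  rw [sub_self, norm_zero, add_zero, norm_sub_rev x', norm_sub_rev (P.yStar i x')] at h5
  rw [inner_sub_left] at h1 h4
  rw [norm_sub_rev α'] at h4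
  have e : ∀ c : Vec dA, inner ℝ c (α' - α) = - inner ℝ c (α - α') := fun c => by
    rw [← inner_neg_right, neg_sub]
  rw [e] at h2
  rw [e, e] at h4
  have h6 : p.μf * ‖α - α'‖ ≤ p.Lf * (1 + p.Cy) * ‖x - x'‖ := by
    have h7 : p.Lf * (‖x - x'‖ + ‖P.yStar i x - P.yStar i x'‖) ≤ p.Lf * (1 + p.Cy) * ‖x - x'‖ := by
      nlinarith [p.Lf_pos]
    rcases (norm_nonneg (α - α')).eq_or_lt with h0 | h0
    · rw [← h0, mul_zero]
      have := p.Lf_pos; have := p.Cy_pos; positivity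
    · refine le_of_mul_le_mul_right ?_ h0
      nlinarith [mul_le_mul_of_nonneg_right (h5.trans h7) h0.le]
  rw [Params.lipα, Params.Cα, div_mul_eq_mul_div, div_mul_eq_mul_div, le_div_iff₀ p.μf_pos]
  linarith

theorem hessYYg_vStar (x : Vec dX) : P.hessYYg i x (P.yStar i x) (P.vStar i x)
    = P.gradYf i x (P.αStar i x) (P.yStar i x) :=
  H.hessYYg_apply_inverse i x _ _

theorem mul_norm_le_norm_hessYYg (x : Vec dX) (y d : Vec dY) :
    p.μg * ‖d‖ ≤ ‖P.hessYYg i x y d‖ := by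
  have h1 := H.hessYYg_coercive i x y d
  have h2 := real_inner_le_norm (P.hessYYg i x y d) d
  rcases (norm_nonneg d).eq_or_lt with h0 | h0
  · rw [← h0, mul_zero]; exact norm_nonneg _
  · refine le_of_mul_le_mul_right ?_ h0
    nlinarith

theorem norm_vStar_le (x : Vec dX) : ‖P.vStar i x‖ ≤ p.Γ := by
  have h1 := H.mul_norm_le_norm_hessYYg i x (P.yStar i x) (P.vStar i x)
  rw [H.hessYYg_vStar] at h1
  rw [Params.Γ, le_div_iff₀ p.μg_pos]
  linarith [H.norm_gradYf_le i (x := x) (y := P.yStar i x) (H.αStar_mem i x)]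

theorem vStar_lipschitz (x x' : Vec dX) :
    ‖P.vStar i x - P.vStar i x'‖ ≤ p.lipv * ‖x - x'‖ := by
  have hy := H.yStar_lipschitz i x x'
  have hα := H.αStar_lipschitz i x x'
  have h1 := H.mul_norm_le_norm_hessYYg i x (P.yStar i x) (P.vStar i x - P.vStar i x')
  -- Subtracting the two linear systems puts the change into the right-hand side and into the
  -- Hessian acting on the second solution, whose norm is at most `Γ`.
  have e : P.hessYYg i x (P.yStar i x) (P.vStar i x - P.vStar i x')
      = (P.gradYf i x (P.αStar i x) (P.yStar i x) - P.gradYf i x' (P.αStar i x') (P.yStar i x'))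
        - (P.hessYYg i x (P.yStar i x) - P.hessYYg i x' (P.yStar i x')) (P.vStar i x') := by
    rw [map_sub, sub_apply, H.hessYYg_vStar, H.hessYYg_vStar]; abel
  rw [e] at h1
  have h2 := norm_sub_le (P.gradYf i x (P.αStar i x) (P.yStar i x)
    - P.gradYf i x' (P.αStar i x') (P.yStar i x'))
    ((P.hessYYg i x (P.yStar i x) - P.hessYYg i x' (P.yStar i x')) (P.vStar i x'))
  have h3 := H.gradYf_lipschitz i (x := x) (x' := x') (y := P.yStar i x) (y' := P.yStar i x')
    (H.αStar_mem i x) (H.αStar_mem i x')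
  have h4 := (ContinuousLinearMap.le_opNorm_of_le
    (P.hessYYg i x (P.yStar i x) - P.hessYYg i x' (P.yStar i x')) (H.norm_vStar_le i x'))
  have h5 := H.hessYYg_lipschitz_add i (x := x) (x' := x') (y := P.yStar i x) (y' := P.yStar i x')
  have h6 : ‖x - x'‖ + ‖P.αStar i x - P.αStar i x'‖ + ‖P.yStar i x - P.yStar i x'‖
      ≤ (1 + p.lipα + p.Cy) * ‖x - x'‖ := by linarith
  have h7 : ‖x - x'‖ + ‖P.yStar i x - P.yStar i x'‖ ≤ (1 + p.Cy) * ‖x - x'‖ := by linarith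
  have h8 := mul_le_mul_of_nonneg_left h6 p.Lf_pos.le
  have h9 := mul_le_mul_of_nonneg_right
    (h5.trans (mul_le_mul_of_nonneg_left h7 p.Lgyy_nonneg)) p.Γ_nonneg
  rw [Params.lipv, div_mul_eq_mul_div, le_div_iff₀ p.μg_pos]
  linarith

end Solutions

end StructuralAssumptions

end Problem

/-! ### The hypergradient formula and smoothness of `F`. -/

namespace Problem

variable {m dX dA dY b : ℕ} {Ξ : Fin m → Type u} [∀ i, MeasurableSpace (Ξ i)]
  {P : Problem m dX dA dY b Ξ} {p : Params}

/-- The direction `∇ₓ f_i - ∇²_{xy} g_i v`. -/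
def dir (P : Problem m dX dA dY b Ξ) (i : Fin m) (x : Vec dX) (α : Vec dA) (y v : Vec dY) : Vec dX :=
  P.gradXf i x α y - P.hessXYg i x y v

/-- The gradient of `x ↦ f_i(x, α_i(x), y_i(x))`. -/
def dirStar (P : Problem m dX dA dY b Ξ) (i : Fin m) (x : Vec dX) : Vec dX :=
  P.dir i x (P.αStar i x) (P.yStar i x) (P.vStar i x)

namespace StructuralAssumptions

variable (H : P.StructuralAssumptions p) (i : Fin m)
include H

/-- The product is split so that the change of the Hessian acts on `v'` and the change of `v` meets
the Hessian bounded by `Cgxy`. Hence only `v'` has to lie in the ball of radius `Γ`. -/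
theorem dir_lipschitz {x x' : Vec dX} {α α' : Vec dA} {y y' v v' : Vec dY} (hα : α ∈ P.A)
    (hα' : α' ∈ P.A) (hv' : ‖v'‖ ≤ p.Γ) :
    ‖P.dir i x α y v - P.dir i x' α' y' v'‖
      ≤ p.lipDir * (‖x - x'‖ + ‖α - α'‖ + ‖y - y'‖ + ‖v - v'‖) := by
  have e : P.dir i x α y v - P.dir i x' α' y' v'
      = (P.gradXf i x α y - P.gradXf i x' α' y')
        - (P.hessXYg i x y (v - v') + (P.hessXYg i x y - P.hessXYg i x' y') v') := by
    rw [dir, dir, map_sub, sub_apply]; abel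
  rw [e]
  have h1 := norm_sub_le (P.gradXf i x α y - P.gradXf i x' α' y')
    (P.hessXYg i x y (v - v') + (P.hessXYg i x y - P.hessXYg i x' y') v')
  have h2 := norm_add_le (P.hessXYg i x y (v - v')) ((P.hessXYg i x y - P.hessXYg i x' y') v')
  have h3 := H.gradXf_lipschitz i (x := x) (x' := x') (y := y) (y' := y') hα hα'
  have h4 := (P.hessXYg i x y).le_of_opNorm_le (H.norm_hessXYg_le i x y) (v - v')
  have h5 := (P.hessXYg i x y - P.hessXYg i x' y').le_opNorm_of_le hv'
  have h6 := mul_le_mul_of_nonneg_right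
    (H.hessXYg_lipschitz_add i (x := x) (x' := x') (y := y) (y' := y')) p.Γ_nonneg
  have n1 := norm_nonneg (x - x')
  have n2 := norm_nonneg (α - α')
  have n3 := norm_nonneg (y - y')
  have n4 := norm_nonneg (v - v')
  have h7 : 0 ≤ p.Lgxy * p.Γ := mul_nonneg p.Lgxy_nonneg p.Γ_nonneg
  unfold Params.lipDir
  nlinarith [mul_nonneg h7 n2, mul_nonneg h7 n4, mul_nonneg p.Lf_pos.le n4,
    mul_nonneg p.Cgxy_nonneg n1, mul_nonneg p.Cgxy_nonneg n2, mul_nonneg p.Cgxy_nonneg n3]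

theorem norm_dir_le {x : Vec dX} {α : Vec dA} {y v : Vec dY} (hα : α ∈ P.A) (hv : ‖v‖ ≤ p.Γ) :
    ‖P.dir i x α y v‖ ≤ p.Cf + p.Cgxy * p.Γ :=
  (norm_sub_le _ _).trans (add_le_add (H.norm_gradXf_le i hα)
    ((ContinuousLinearMap.le_opNorm_of_le _ hv).trans
      (mul_le_mul_of_nonneg_right (H.norm_hessXYg_le i x y) p.Γ_nonneg)))

theorem dirStar_lipschitz (x x' : Vec dX) :
    ‖P.dirStar i x - P.dirStar i x'‖ ≤ p.lipGrad * ‖x - x'‖ := by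
  refine (H.dir_lipschitz i (H.αStar_mem i x) (H.αStar_mem i x') (H.norm_vStar_le i x')).trans ?_
  rw [Params.lipGrad, mul_assoc]
  refine mul_le_mul_of_nonneg_left ?_ p.lipDir_pos.le
  linarith [H.αStar_lipschitz i x x', H.yStar_lipschitz i x x', H.vStar_lipschitz i x x']

theorem isBigO_yStar (x : Vec dX) :
    (fun x' => P.yStar i x' - P.yStar i x) =O[𝓝 x] fun x' => x' - x :=
  IsBigO.of_bound _ (Eventually.of_forall fun x' => H.yStar_lipschitz i x' x)

theorem isBigO_αStar (x : Vec dX) :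
    (fun x' => P.αStar i x' - P.αStar i x) =O[𝓝 x] fun x' => x' - x :=
  IsBigO.of_bound _ (Eventually.of_forall fun x' => H.αStar_lipschitz i x' x)

theorem continuous_yStar : Continuous (P.yStar i) :=
  (LipschitzWith.of_dist_le_mul (K := ⟨p.Cy, p.Cy_pos.le⟩) fun x x' => by
    rw [dist_eq_norm, dist_eq_norm]; exact H.yStar_lipschitz i x x').continuous

theorem continuous_αStar : Continuous (P.αStar i) :=
  (LipschitzWith.of_dist_le_mul (K := ⟨p.lipα, p.lipα_pos.le⟩) fun x x' => by
    rw [dist_eq_norm, dist_eq_norm]; exact H.αStar_lipschitz i x x').continuous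

theorem continuous_vStar : Continuous (P.vStar i) :=
  (LipschitzWith.of_dist_le_mul (K := ⟨p.lipv, p.lipv_pos.le⟩) fun x x' => by
    rw [dist_eq_norm, dist_eq_norm]; exact H.vStar_lipschitz i x x').continuous

/-- The pairing is nonpositive by optimality at `x`. Optimality at `x'` makes the same pairing with
the gradient at `x'` nonnegative, so its size is at most the change of the gradient times the change
of the maximiser, both of order `‖x' - x‖`. -/
theorem abs_inner_gradAf_αStar_le (x x' : Vec dX) :
    |inner ℝ (P.gradAf i x (P.αStar i x) (P.yStar i x)) (P.αStar i x' - P.αStar i x)|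
      ≤ p.Lf * (1 + p.lipα + p.Cy) * p.lipα * ‖x' - x‖ ^ 2 := by
  have h1 := H.inner_gradAf_αStar_le i x (H.αStar_mem i x')
  have h2 := H.inner_gradAf_αStar_le i x' (H.αStar_mem i x)
  have h3 := real_inner_le_norm (P.gradAf i x' (P.αStar i x') (P.yStar i x')
    - P.gradAf i x (P.αStar i x) (P.yStar i x)) (P.αStar i x' - P.αStar i x)
  have h4 := H.gradAf_lipschitz i (x := x') (x' := x) (y := P.yStar i x') (y' := P.yStar i x)
    (H.αStar_mem i x') (H.αStar_mem i x)
  have h5 := H.yStar_lipschitz i x' x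
  have h6 := H.αStar_lipschitz i x' x
  rw [← neg_sub, inner_neg_right] at h2
  rw [inner_sub_left] at h3
  have h7 : p.Lf * (‖x' - x‖ + ‖P.αStar i x' - P.αStar i x‖ + ‖P.yStar i x' - P.yStar i x‖)
      ≤ p.Lf * ((1 + p.lipα + p.Cy) * ‖x' - x‖) :=
    mul_le_mul_of_nonneg_left (by linarith) p.Lf_pos.le
  have h8 := mul_le_mul (h4.trans h7) h6 (norm_nonneg _)
    (mul_nonneg p.Lf_pos.le (mul_nonneg
      (by have := p.lipα_pos; have := p.Cy_pos; positivity) (norm_nonneg _)))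
  rw [abs_le]
  constructor
  · linarith
  · refine h1.trans ?_
    have := p.lipα_pos; have := p.Cy_pos; have := p.Lf_pos
    positivity

/-- An envelope argument that uses only Lipschitz continuity of the solution maps: `f` is expanded
jointly, the `α` term is of second order, and the `y` term is converted by the linearised
lower-level equation tested against `v`. -/
theorem hasGradientAt_block (x : Vec dX) :
    HasGradientAt (fun x => P.f i x (P.αStar i x) (P.yStar i x)) (P.dirStar i x) x := by
  have hid : (fun x' : Vec dX => x' - x) =O[𝓝 x] fun x' => x' - x := isBigO_refl _ _
  have hy := H.isBigO_yStar i x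
  have hα := H.isBigO_αStar i x
  set y := P.yStar i x with hydef
  set α := P.αStar i x with hαdef
  set v := P.vStar i x with hvdef
  have hf := (H.f_differentiable i x y α (H.αStar_mem i x)).hasFDerivAt.isLittleO.comp_tendsto
    (k := fun x' => (x', P.αStar i x', P.yStar i x')) (l' := 𝓝 x)
    ((continuous_id.prodMk ((H.continuous_αStar i).prodMk (H.continuous_yStar i))).tendsto x)
  have hf2 := hf.trans_isBigO (hid.prod_left (hα.prod_left hy))
  have hg := (H.gradYg_joint_differentiable i (x, y)).hasFDerivAt.isLittleO.comp_tendsto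
    (k := fun x' => (x', P.yStar i x')) (l' := 𝓝 x)
    ((continuous_id.prodMk (H.continuous_yStar i)).tendsto x)
  have hg2 := hg.trans_isBigO (hid.prod_left hy)
  -- `∇_y g` vanishes at both `(x, y(x))` and `(x', y(x'))`, so its linearisation along the solution
  -- path is itself `o(x' - x)`; this is that fact paired with `v`.
  have hg3 : (fun x' => inner ℝ (P.hessYYg i x y (P.yStar i x' - y)) v
      + inner ℝ (P.hessXYg i x y v) (x' - x)) =o[𝓝 x] fun x' => x' - x := by
    refine ((isBigO_of_le' (c := ‖v‖) _ fun x' => ?_).trans_isLittleO hg2)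
    have e : inner ℝ (P.hessYYg i x y (P.yStar i x' - y)) v + inner ℝ (P.hessXYg i x y v) (x' - x)
        = inner ℝ (fderiv ℝ (fun q : Vec dX × Vec dY => P.gradYg i q.1 q.2) (x, y)
          (x' - x, P.yStar i x' - y)) v := by
      rw [← H.fderiv_gradYg_inr, ← H.inner_fderiv_gradYg_inl, ← inner_add_left, ← map_add]
      simp
    rw [e]
    simp only [Function.comp_apply, Prod.mk_sub_mk]
    rw [H.gradYg_yStar i x', hydef, H.gradYg_yStar i x, sub_zero, zero_sub, norm_neg, mul_comm]
    exact abs_real_inner_le_norm _ _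
  have hA : (fun x' => inner ℝ (P.gradAf i x α y) (P.αStar i x' - α)) =o[𝓝 x] fun x' => x' - x := by
    have h1 : (fun x' => inner ℝ (P.gradAf i x α y) (P.αStar i x' - α))
        =O[𝓝 x] fun x' => ‖x' - x‖ ^ 2 :=
      IsBigO.of_bound (p.Lf * (1 + p.lipα + p.Cy) * p.lipα) (Eventually.of_forall fun x' => by
        rw [Real.norm_eq_abs, Real.norm_of_nonneg (sq_nonneg _)]
        exact H.abs_inner_gradAf_αStar_le i x x')
    refine h1.trans_isLittleO ?_
    have h2 : (fun x' : Vec dX => ‖x' - x‖) =o[𝓝 x] fun _ => (1 : ℝ) := by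
      rw [isLittleO_one_iff]
      have : Continuous fun x' : Vec dX => ‖x' - x‖ := by fun_prop
      simpa using this.tendsto x
    have h4 : (fun x' : Vec dX => ‖x' - x‖ ^ 2) =o[𝓝 x] fun x' => (1 : ℝ) * ‖x' - x‖ := by
      simpa only [sq] using h2.mul_isBigO (isBigO_refl (fun x' : Vec dX => ‖x' - x‖) _)
    simpa using h4
  rw [hasGradientAt_iff_isLittleO]
  -- Since `∇_y f` is the Hessian applied to `v` and the Hessian is symmetric, the `y` increments in
  -- `hf2` and `hg3` cancel, and `hA` removes the `α` increment. What is left is the expansion with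
  -- gradient `dirStar`.
  refine ((hf2.add hA).add hg3).congr_left fun x' => ?_
  simp only [Function.comp_apply, Prod.mk_sub_mk]
  rw [H.fderiv_f_apply i (H.αStar_mem i x), H.inner_hessYYg_comm, hvdef, hydef, H.hessYYg_vStar,
    dirStar, dir, inner_sub_left]
  ring

theorem hasGradientAt_F (x : Vec dX) :
    HasGradientAt P.F ((m : ℝ)⁻¹ • ∑ i, P.dirStar i x) x := by
  have h : HasFDerivAt (fun x => ∑ i, P.f i x (P.αStar i x) (P.yStar i x))
      (∑ i, InnerProductSpace.toDual ℝ _ (P.dirStar i x)) x :=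
    HasFDerivAt.fun_sum fun i _ => (H.hasGradientAt_block i x).hasFDerivAt
  have h2 := h.const_mul (m : ℝ)⁻¹
  rw [hasGradientAt_iff_hasFDerivAt, map_smul, map_sum]
  exact h2

theorem gradient_F (x : Vec dX) : gradient P.F x = (m : ℝ)⁻¹ • ∑ i, P.dirStar i x :=
  (H.hasGradientAt_F x).gradient

theorem differentiable_F : Differentiable ℝ P.F := fun x => (H.hasGradientAt_F x).differentiableAt

end StructuralAssumptions

theorem norm_average_le {E : Type*} [NormedAddCommGroup E] [NormedSpace ℝ E] (hm : 1 ≤ m)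
    {a : Fin m → E} {C : ℝ} (h : ∀ i, ‖a i‖ ≤ C) : ‖(m : ℝ)⁻¹ • ∑ i, a i‖ ≤ C := by
  have hm' : (0 : ℝ) < m := by exact_mod_cast hm
  rw [norm_smul, norm_inv, Real.norm_of_nonneg hm'.le, inv_mul_le_iff₀ hm']
  exact (norm_sum_le_of_le _ fun i _ => h i).trans (by simp)

namespace StructuralAssumptions

variable (H : P.StructuralAssumptions p)
include H

theorem gradient_F_lipschitz (hm : 1 ≤ m) (x x' : Vec dX) :
    ‖gradient P.F x - gradient P.F x'‖ ≤ p.lipGrad * ‖x - x'‖ := by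
  rw [H.gradient_F, H.gradient_F, ← smul_sub, ← Finset.sum_sub_distrib]
  exact norm_average_le hm fun i => H.dirStar_lipschitz i x x'

theorem norm_gradient_F_le (hm : 1 ≤ m) (x : Vec dX) :
    ‖gradient P.F x‖ ≤ p.Cf + p.Cgxy * p.Γ := by
  rw [H.gradient_F]
  exact norm_average_le hm fun i => H.norm_dir_le i (H.αStar_mem i x) (H.norm_vStar_le i x)

theorem F_add_le (hm : 1 ≤ m) (x h : Vec dX) :
    P.F (x + h) ≤ P.F x + inner ℝ (gradient P.F x) h + p.lipGrad * ‖h‖ ^ 2 :=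
  le_add_inner_gradient_add_sq H.differentiable_F (H.gradient_F_lipschitz hm) x h

end StructuralAssumptions

end Problem

end

/-! ### First and second moments of a uniformly random set of blocks. -/

section UniformSubset

variable {m s : ℕ}

/-- The law of a uniformly random set of `s` blocks. -/
def subsetLaw (m s : ℕ) : Measure (Finset (Fin m)) :=
  uniformOn {J : Finset (Fin m) | J.card = s}

theorem isProbabilityMeasure_subsetLaw (hs : s ≤ m) : IsProbabilityMeasure (subsetLaw m s) := by
  refine isProbabilityMeasure_uniformOn (Set.toFinite _) ?_
  obtain ⟨J, -, hJ⟩ := Finset.exists_subset_card_eq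
    (show s ≤ (Finset.univ : Finset (Fin m)).card by simpa using hs)
  exact ⟨J, hJ⟩

theorem ae_card_eq_subsetLaw : ∀ᵐ J ∂(subsetLaw m s), J.card = s := by
  unfold subsetLaw uniformOn
  exact ae_cond_mem (Set.toFinite _).measurableSet

theorem integral_subsetLaw (f : Finset (Fin m) → ℝ) :
    ∫ J, f J ∂(subsetLaw m s)
      = ((m.choose s : ℕ) : ℝ)⁻¹ * ∑ J ∈ Finset.powersetCard s Finset.univ, f J := by
  have e : {J : Finset (Fin m) | J.card = s}
      = ((Finset.powersetCard s Finset.univ : Finset (Finset (Fin m))) : Set _) := by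
    ext J; simp [Finset.mem_powersetCard]
  unfold subsetLaw uniformOn ProbabilityTheory.cond
  rw [integral_smul_measure, e, setIntegral_finset _ (Integrable.of_finite.integrableOn),
    Measure.count_apply_finset, Finset.card_powersetCard]
  simp [Measure.real]

theorem sum_powersetCard_map_perm (σ : Equiv.Perm (Fin m)) (f : Finset (Fin m) → ℝ) :
    ∑ J ∈ Finset.powersetCard s Finset.univ, f (J.map σ.toEmbedding)
      = ∑ J ∈ Finset.powersetCard s Finset.univ, f J := by
  refine Finset.sum_equiv (Equiv.finsetCongr σ) (fun J => ?_) (fun J _ => rfl)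
  simp [Finset.mem_powersetCard]

/-- The indicator of `i ∈ J`. -/
def memInd (i : Fin m) (J : Finset (Fin m)) : ℝ := if i ∈ J then 1 else 0

theorem memInd_nonneg (i : Fin m) (J : Finset (Fin m)) : 0 ≤ memInd i J := by
  unfold memInd; split_ifs <;> norm_num

theorem memInd_map (σ : Equiv.Perm (Fin m)) (i : Fin m) (J : Finset (Fin m)) :
    memInd (σ i) (J.map σ.toEmbedding) = memInd i J := by
  simp [memInd]

theorem sum_memInd_smul {E : Type*} [AddCommGroup E] [Module ℝ E] (J : Finset (Fin m))
    (a : Fin m → E) : ∑ i, memInd i J • a i = ∑ i ∈ J, a i := by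
  simp [memInd, ite_smul]

theorem sum_memInd (J : Finset (Fin m)) : ∑ i, memInd i J = J.card := by
  simp [memInd]

/-- By exchangeability all inclusion probabilities agree, and they sum to the fixed cardinality `s`.
-/
theorem integral_memInd (hs : s ≤ m) (hm : 1 ≤ m) (i : Fin m) :
    ∫ J, memInd i J ∂(subsetLaw m s) = s / m := by
  have := isProbabilityMeasure_subsetLaw hs
  have hsymm : ∀ j, ∫ J, memInd j J ∂(subsetLaw m s) = ∫ J, memInd i J ∂(subsetLaw m s) := by
    intro j
    rw [integral_subsetLaw, integral_subsetLaw, ← sum_powersetCard_map_perm (Equiv.swap i j)]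
    congr 1
    refine Finset.sum_congr rfl fun J _ => ?_
    have h := memInd_map (Equiv.swap i j) i J
    rwa [Equiv.swap_apply_left] at h
  have htot : ∑ j, ∫ J, memInd j J ∂(subsetLaw m s) = s := by
    rw [← integral_finsetSum _ fun j _ => Integrable.of_finite]
    simp_rw [sum_memInd]
    rw [integral_congr_ae (g := fun _ => (s : ℝ))]
    · simp
    · filter_upwards [ae_card_eq_subsetLaw] with J hJ
      rw [hJ]
  rw [Finset.sum_congr rfl fun j _ => hsymm j] at htot
  simp only [Finset.sum_const, Finset.card_univ, Fintype.card_fin, nsmul_eq_mul] at htot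
  have hm' : (0 : ℝ) < m := by exact_mod_cast hm
  rw [eq_div_iff hm'.ne']
  linarith

/-- Permutations act transitively on ordered pairs of distinct indices. Only the sign and the common
value of the pair probability matter later, so it is never computed. -/
theorem exists_integral_memInd_mul_memInd (m s : ℕ) : ∃ q : ℝ, 0 ≤ q ∧ ∀ i j : Fin m, i ≠ j →
    ∫ J, memInd i J * memInd j J ∂(subsetLaw m s) = q := by
  by_cases h : ∃ i j : Fin m, i ≠ j
  · obtain ⟨i₀, j₀, h₀⟩ := h
    refine ⟨∫ J, memInd i₀ J * memInd j₀ J ∂(subsetLaw m s), integral_nonneg fun J =>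
      mul_nonneg (memInd_nonneg _ _) (memInd_nonneg _ _), fun i j hij => ?_⟩
    obtain ⟨σ, hσi, hσj⟩ : ∃ σ : Equiv.Perm (Fin m), σ i₀ = i ∧ σ j₀ = j := by
      refine ⟨(Equiv.swap i₀ i).trans (Equiv.swap (Equiv.swap i₀ i j₀) j), ?_, ?_⟩
      · rw [Equiv.trans_apply, Equiv.swap_apply_left]
        refine Equiv.swap_apply_of_ne_of_ne (fun h => h₀ ?_) hij
        have := congrArg (Equiv.swap i₀ i) h
        rwa [Equiv.swap_apply_right, Equiv.swap_apply_self] at this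
      · rw [Equiv.trans_apply, Equiv.swap_apply_left]
    rw [integral_subsetLaw, integral_subsetLaw, ← sum_powersetCard_map_perm σ]
    congr 1
    refine Finset.sum_congr rfl fun J _ => ?_
    rw [← hσi, ← hσj, memInd_map, memInd_map]
  · push Not at h
    exact ⟨0, le_rfl, fun i j hij => absurd (h i j) hij⟩

/-- Off the diagonal every expectation is `q` times an inner product. As the vectors sum to zero,
these terms add up to `-q` times the sum of squares, which may be dropped: sampling without
replacement does not exceed the independent bound. -/
theorem integral_norm_sq_sum_memInd_le {E : Type*} [NormedAddCommGroup E] [InnerProductSpace ℝ E]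
    (hs : s ≤ m) (hm : 1 ≤ m) (a : Fin m → E) (ha : ∑ i, a i = 0) :
    ∫ J, ‖∑ i, memInd i J • a i‖ ^ 2 ∂(subsetLaw m s) ≤ s / m * ∑ i, ‖a i‖ ^ 2 := by
  have := isProbabilityMeasure_subsetLaw hs
  obtain ⟨q, hq, hqe⟩ := exists_integral_memInd_mul_memInd m s
  have e : ∀ J : Finset (Fin m), ‖∑ i, memInd i J • a i‖ ^ 2
      = ∑ i, ∑ j, memInd i J * memInd j J * inner ℝ (a i) (a j) := fun J => by
    rw [← real_inner_self_eq_norm_sq, sum_inner]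
    refine Finset.sum_congr rfl fun i _ => ?_
    rw [inner_sum]
    refine Finset.sum_congr rfl fun j _ => ?_
    rw [real_inner_smul_left, real_inner_smul_right]; ring
  simp_rw [e]
  rw [integral_finsetSum _ fun i _ => Integrable.of_finite]
  have h1 : ∀ i, ∫ J, ∑ j, memInd i J * memInd j J * inner ℝ (a i) (a j) ∂(subsetLaw m s)
      = (s / m - q) * ‖a i‖ ^ 2 := fun i => by
    rw [integral_finsetSum _ fun i _ => Integrable.of_finite]
    have h2 : ∀ j, ∫ J, memInd i J * memInd j J * inner ℝ (a i) (a j) ∂(subsetLaw m s)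
        = q * inner ℝ (a i) (a j) + if i = j then (s / m - q) * ‖a i‖ ^ 2 else 0 := fun j => by
      rw [integral_mul_const]
      split_ifs with hij
      · subst hij
        have h3 : ∀ J, memInd i J * memInd i J = memInd i J := fun J => by
          unfold memInd; split_ifs <;> norm_num
        simp_rw [h3]
        rw [integral_memInd hs hm, real_inner_self_eq_norm_sq]; ring
      · rw [hqe i j hij, add_zero]
    simp_rw [h2]
    rw [Finset.sum_add_distrib, ← Finset.mul_sum, ← inner_sum, ha, inner_zero_right, mul_zero,
      zero_add, Finset.sum_ite_eq]
    simp
  simp_rw [h1]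
  rw [← Finset.mul_sum]
  exact mul_le_mul_of_nonneg_right (by linarith) (Finset.sum_nonneg fun i _ => sq_nonneg _)

end UniformSubset

/-! ### Stochastic oracles before and after projection. -/

section Oracle

variable {Ω : Type*} [MeasurableSpace Ω] {ν : Measure Ω}

section Normed

theorem norm_add_sq_le_two {E : Type*} [NormedAddCommGroup E] (a c : E) : ‖a + c‖ ^ 2 ≤ 2 * ‖a‖ ^ 2 + 2 * ‖c‖ ^ 2 := by
  have := norm_add_le a c
  nlinarith [norm_nonneg (a + c), sq_nonneg (‖a‖ - ‖c‖)]

theorem norm_sub_sq_le_two {E : Type*} [NormedAddCommGroup E] (a c : E) : ‖a - c‖ ^ 2 ≤ 2 * ‖a‖ ^ 2 + 2 * ‖c‖ ^ 2 := by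
  simpa [sub_eq_add_neg] using norm_add_sq_le_two a (-c)

variable {E : Type*} [NormedAddCommGroup E] [NormedSpace ℝ E] {O : Ω → E} {c : E} {var : ℝ}

variable [IsProbabilityMeasure ν]

theorem IsUnbiasedOracle.integrable_norm_sub_sq (h : IsUnbiasedOracle ν O c var) :
    Integrable (fun ω => ‖O ω - c‖ ^ 2) ν :=
  (h.1.sub (memLp_const c)).integrable_norm_pow (p := 2) two_ne_zero

/-- Both oracles may use the same batch, so no independence is available and the two variances are
combined with a factor 2; the bound on `v` costs `Γ ^ 2`. -/
theorem IsUnbiasedOracle.sub_apply {E' : Type*} [NormedAddCommGroup E'] [NormedSpace ℝ E']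
    (h : IsUnbiasedOracle ν O c var) {T : Ω → E' →L[ℝ] E} {c' : E' →L[ℝ] E}
    (h' : IsUnbiasedOracle ν T c' var) {v : E'} {Γ : ℝ} (hv : ‖v‖ ≤ Γ) :
    IsUnbiasedOracle ν (fun ω => O ω - T ω v) (c - c' v) (2 * (1 + Γ ^ 2) * var) := by
  have hΓ : 0 ≤ Γ := (norm_nonneg v).trans hv
  have hT : MemLp (fun ω => T ω v) 2 ν :=
    h'.1.continuousLinearMap_comp (ContinuousLinearMap.apply ℝ E v)
  refine ⟨h.1.sub hT, ?_, ?_⟩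
  · rw [integral_sub (h.1.integrable one_le_two) (hT.integrable one_le_two), h.2.1,
      ← ContinuousLinearMap.integral_apply (h'.1.integrable one_le_two), h'.2.1]
  · have hb : ∀ ω, ‖O ω - T ω v - (c - c' v)‖ ^ 2
        ≤ 2 * ‖O ω - c‖ ^ 2 + 2 * (Γ ^ 2 * ‖T ω - c'‖ ^ 2) := fun ω => by
      have e : O ω - T ω v - (c - c' v) = (O ω - c) - (T ω - c') v := by
        rw [_root_.sub_apply]; abel
      rw [e]
      refine (norm_sub_sq_le_two _ _).trans ?_
      have h1 : ‖(T ω - c') v‖ ^ 2 ≤ (‖T ω - c'‖ * Γ) ^ 2 :=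
        pow_le_pow_left₀ (norm_nonneg _) ((T ω - c').le_opNorm_of_le hv) 2
      rw [mul_pow] at h1
      linarith
    have hint := (h.integrable_norm_sub_sq.const_mul 2).add
      ((h'.integrable_norm_sub_sq.const_mul (Γ ^ 2)).const_mul 2)
    refine (integral_mono ?_ hint hb).trans ?_
    · exact ((h.1.sub hT).sub (memLp_const _)).integrable_norm_pow (p := 2) two_ne_zero
    · simp only [Pi.add_apply]
      rw [integral_add (h.integrable_norm_sub_sq.const_mul 2)
        ((h'.integrable_norm_sub_sq.const_mul (Γ ^ 2)).const_mul 2), integral_const_mul,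
        integral_const_mul, integral_const_mul]
      nlinarith [h.2.2, h'.2.2, sq_nonneg Γ, mul_le_mul_of_nonneg_left h'.2.2 (sq_nonneg Γ)]

end Normed

variable [IsProbabilityMeasure ν]

variable {n : ℕ} {O : Ω → Vec n} {c : Vec n} {var : ℝ}

theorem integrable_norm_add_smul_sq {X : Ω → Vec n} (hX : MemLp X 2 ν) (w : Vec n) (β : ℝ) :
    Integrable (fun ω => ‖w + β • X ω‖ ^ 2) ν :=
  ((memLp_const w).add (hX.const_smul β)).integrable_norm_pow (p := 2) two_ne_zero

theorem integral_norm_add_smul_sq {X : Ω → Vec n} (hX : MemLp X 2 ν) (h0 : ∫ ω, X ω ∂ν = 0)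
    (w : Vec n) (β : ℝ) :
    ∫ ω, ‖w + β • X ω‖ ^ 2 ∂ν = ‖w‖ ^ 2 + β ^ 2 * ∫ ω, ‖X ω‖ ^ 2 ∂ν := by
  have e : ∀ ω, ‖w + β • X ω‖ ^ 2 = ‖w‖ ^ 2 + (2 * β) * inner ℝ w (X ω) + β ^ 2 * ‖X ω‖ ^ 2 :=
    fun ω => by
      rw [norm_add_sq_real, real_inner_smul_right, norm_smul, mul_pow, Real.norm_eq_abs, sq_abs]
      ring
  have hi := hX.integrable one_le_two
  have hi' : Integrable (fun ω => ‖w‖ ^ 2 + (2 * β) * inner ℝ w (X ω)) ν :=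
    (integrable_const _).add ((hi.const_inner w).const_mul _)
  simp_rw [e]
  rw [integral_add hi' ((hX.integrable_norm_pow (p := 2) two_ne_zero).const_mul _),
    integral_add (integrable_const _) ((hi.const_inner w).const_mul _), integral_const_mul,
    integral_const_mul, integral_inner hi, h0]
  simp

theorem IsUnbiasedOracle.integrable_norm_add_smul_sub_sq (h : IsUnbiasedOracle ν O c var)
    (u a : Vec n) (η : ℝ) : Integrable (fun ω => ‖u + η • O ω - a‖ ^ 2) ν := by
  refine (integrable_norm_add_smul_sq h.1 (u - a) η).congr (Filter.Eventually.of_forall fun ω => ?_)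
  simp only
  congr 2; abel

theorem IsUnbiasedOracle.integral_norm_add_smul_sub_sq_le (h : IsUnbiasedOracle ν O c var)
    (u a : Vec n) (η : ℝ) :
    ∫ ω, ‖u + η • O ω - a‖ ^ 2 ∂ν ≤ ‖u + η • c - a‖ ^ 2 + η ^ 2 * var := by
  have e : ∀ ω, u + η • O ω - a = (u + η • c - a) + η • (O ω - c) := fun ω => by
    rw [smul_sub]; abel
  simp_rw [e]
  rw [integral_norm_add_smul_sq (X := fun ω => O ω - c) (h.1.sub (memLp_const c))]
  · exact add_le_add le_rfl (mul_le_mul_of_nonneg_left h.2.2 (sq_nonneg _))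
  · rw [integral_sub (h.1.integrable one_le_two) (integrable_const _), h.2.1]
    simp

variable {K : Set (Vec n)}

theorem continuous_proj (hne : K.Nonempty) (hcl : IsClosed K) (hcv : Convex ℝ K) :
    Continuous (proj K) :=
  (LipschitzWith.of_dist_le_mul (K := 1) fun x x' => by
    rw [dist_eq_norm, dist_eq_norm, NNReal.coe_one, one_mul]
    exact norm_proj_sub_proj_le hne hcl hcv x x').continuous

theorem IsUnbiasedOracle.integrable_norm_proj_sub_sq (hne : K.Nonempty) (hcl : IsClosed K)
    (hcv : Convex ℝ K) (h : IsUnbiasedOracle ν O c var) (u : Vec n) {a : Vec n} (ha : a ∈ K)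
    (η : ℝ) : Integrable (fun ω => ‖proj K (u + η • O ω) - a‖ ^ 2) ν := by
  refine (h.integrable_norm_add_smul_sub_sq u a η).mono' ?_ (Filter.Eventually.of_forall fun ω => ?_)
  · have h1 : AEStronglyMeasurable (fun ω => proj K (u + η • O ω)) ν :=
      (continuous_proj hne hcl hcv).comp_aestronglyMeasurable
        (aestronglyMeasurable_const.add (h.1.1.const_smul η))
    exact ((h1.sub aestronglyMeasurable_const).norm.pow 2)
  · rw [Real.norm_of_nonneg (sq_nonneg _)]
    refine pow_le_pow_left₀ (norm_nonneg _) ?_ 2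
    simpa using norm_proj_sub_le hne hcl hcv (u := u + η • O ω) (d := 0) (η := 0) ha (by simp)
      le_rfl

/-- Projection destroys unbiasedness, so nonexpansiveness is applied pointwise first; the
bias–variance identity is used only for the unprojected step. -/
theorem IsUnbiasedOracle.integral_norm_proj_sub_sq_le (hne : K.Nonempty) (hcl : IsClosed K)
    (hcv : Convex ℝ K) (h : IsUnbiasedOracle ν O c var) (u : Vec n) {a d : Vec n} (ha : a ∈ K)
    (hd : ∀ q ∈ K, inner ℝ d (q - a) ≤ 0) {η : ℝ} (hη : 0 ≤ η) :
    ∫ ω, ‖proj K (u + η • O ω) - a‖ ^ 2 ∂ν ≤ ‖u + η • c - (a + η • d)‖ ^ 2 + η ^ 2 * var :=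
  (integral_mono (h.integrable_norm_proj_sub_sq hne hcl hcv u ha η)
    (h.integrable_norm_add_smul_sub_sq u (a + η • d) η) fun _ =>
      pow_le_pow_left₀ (norm_nonneg _) (norm_proj_sub_le hne hcl hcv ha hd hη) 2).trans
    (h.integral_norm_add_smul_sub_sq_le u (a + η • d) η)

end Oracle

/-! ### Deterministic contraction of a perturbed gradient step. -/

section Contraction

variable {n : ℕ} {d M e : Vec n} {μ L η : ℝ}

/-- The condition on `η` makes the quadratic term `η²‖M‖²` at most half of the gain `2ημ‖d‖²` from
monotonicity. -/
theorem norm_sub_smul_sq_le (hη : 0 ≤ η) (hL : 0 < L) (h : η ≤ μ / L ^ 2)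
    (hmono : μ * ‖d‖ ^ 2 ≤ inner ℝ M d) (hlip : ‖M‖ ≤ L * ‖d‖) :
    ‖d - η • M‖ ^ 2 ≤ (1 - η * μ) * ‖d‖ ^ 2 := by
  rw [norm_sub_sq_real, real_inner_smul_right, norm_smul, mul_pow, Real.norm_eq_abs, sq_abs,
    real_inner_comm]
  have h1 : ‖M‖ ^ 2 ≤ L ^ 2 * ‖d‖ ^ 2 := by
    rw [← mul_pow]; exact pow_le_pow_left₀ (norm_nonneg _) hlip 2
  rw [le_div_iff₀ (by positivity)] at h
  nlinarith [mul_le_mul_of_nonneg_left h1 (sq_nonneg η), mul_le_mul_of_nonneg_left hmono hη,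
    mul_le_mul_of_nonneg_right h (mul_nonneg hη (sq_nonneg ‖d‖))]

theorem norm_add_sq_le_mul {κ : ℝ} (hκ : 0 < κ) (a c : Vec n) :
    ‖a + c‖ ^ 2 ≤ (1 + κ) * ‖a‖ ^ 2 + (1 + 1 / κ) * ‖c‖ ^ 2 := by
  have h1 := norm_add_le a c
  have h2 : 2 * (‖a‖ * ‖c‖) ≤ κ * ‖a‖ ^ 2 + 1 / κ * ‖c‖ ^ 2 := by
    have e : κ * ‖a‖ ^ 2 + 1 / κ * ‖c‖ ^ 2 - 2 * (‖a‖ * ‖c‖) = (κ * ‖a‖ - ‖c‖) ^ 2 / κ := by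
      field_simp; ring
    have : 0 ≤ (κ * ‖a‖ - ‖c‖) ^ 2 / κ := by positivity
    linarith
  nlinarith [norm_nonneg (a + c)]

/-- Young's inequality with parameter `ημ/2` spends half of the contraction on the perturbation; `ημ
≤ 1` then gives the constant 3. -/
theorem norm_sub_smul_add_smul_sq_le (hη : 0 < η) (hμ : 0 < μ) (hL : 0 < L) (h : η ≤ μ / L ^ 2)
    (h1 : η ≤ 1 / μ) (hmono : μ * ‖d‖ ^ 2 ≤ inner ℝ M d) (hlip : ‖M‖ ≤ L * ‖d‖) :
    ‖d - η • M + η • e‖ ^ 2 ≤ (1 - η * μ / 2) * ‖d‖ ^ 2 + 3 * η / μ * ‖e‖ ^ 2 := by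
  have hκ : 0 < η * μ / 2 := by positivity
  rw [le_div_iff₀ hμ] at h1
  refine (norm_add_sq_le_mul hκ _ _).trans (add_le_add ?_ ?_)
  · have h2 := norm_sub_smul_sq_le hη.le hL h hmono hlip
    calc (1 + η * μ / 2) * ‖d - η • M‖ ^ 2
        ≤ (1 + η * μ / 2) * ((1 - η * μ) * ‖d‖ ^ 2) :=
          mul_le_mul_of_nonneg_left h2 (by positivity)
      _ ≤ (1 - η * μ / 2) * ‖d‖ ^ 2 := by
          nlinarith [mul_nonneg (sq_nonneg (η * μ)) (sq_nonneg ‖d‖)]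
  · rw [norm_smul, mul_pow, Real.norm_of_nonneg hη.le, ← mul_assoc]
    refine mul_le_mul_of_nonneg_right ?_ (sq_nonneg _)
    have : (1 + 1 / (η * μ / 2)) * η ^ 2 = η * (η * μ + 2) / μ := by field_simp
    rw [this]
    refine div_le_div_of_nonneg_right ?_ hμ.le
    nlinarith

end Contraction

/-! ### One-step estimates for the block errors. -/

namespace Problem

variable {m dX dA dY b s : ℕ} {Ξ : Fin m → Type u} [∀ i, MeasurableSpace (Ξ i)]
  {P : Problem m dX dA dY b Ξ} {p : Params} {σ : ℝ}

section StepLaw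

theorem measurePreserving_batch {ρ : Measure (∀ i, Fin b → Ξ i)} (hρ : ∀ i, ρ.map (fun B => B i) = P.batchLaw i) (i : Fin m) :
    MeasurePreserving (fun B : ∀ i, Fin b → Ξ i => B i) ρ (P.batchLaw i) :=
  ⟨measurable_pi_apply i, hρ i⟩

variable {ρ : Measure (∀ i, Fin b → Ξ i)}
  {E : Type*} [NormedAddCommGroup E] [NormedSpace ℝ E]

theorem isProbabilityMeasure_batchLaw [IsProbabilityMeasure ρ]
    (hρ : ∀ i, ρ.map (fun B => B i) = P.batchLaw i) (i : Fin m) :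
    IsProbabilityMeasure (P.batchLaw i) := by
  rw [← hρ i]
  exact Measure.isProbabilityMeasure_map (measurable_pi_apply i).aemeasurable

theorem integrable_memInd_smul [SFinite ρ] (hs : s ≤ m) (hρ : ∀ i, ρ.map (fun B => B i) = P.batchLaw i)
    (i : Fin m) {h : (Fin b → Ξ i) → E} (hh : Integrable h (P.batchLaw i)) :
    Integrable (fun q : Finset (Fin m) × (∀ i, Fin b → Ξ i) => memInd i q.1 • h (q.2 i))
      ((subsetLaw m s).prod ρ) := by
  have := isProbabilityMeasure_subsetLaw hs
  exact Integrable.smul_prod (Integrable.of_finite (f := memInd i))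
    ((measurePreserving_batch hρ i).integrable_comp_of_integrable hh)

theorem integral_memInd_smul [SFinite ρ] (hs : s ≤ m) (hm : 1 ≤ m)
    (hρ : ∀ i, ρ.map (fun B => B i) = P.batchLaw i) (i : Fin m) {h : (Fin b → Ξ i) → E}
    (hh : Integrable h (P.batchLaw i)) :
    ∫ q : Finset (Fin m) × (∀ i, Fin b → Ξ i), memInd i q.1 • h (q.2 i) ∂((subsetLaw m s).prod ρ)
      = ((s : ℝ) / m) • ∫ B, h B ∂(P.batchLaw i) := by
  have := isProbabilityMeasure_subsetLaw hs
  rw [integral_prod_smul (fun J => memInd i J) (fun B : ∀ i, Fin b → Ξ i => h (B i)),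
    integral_memInd hs hm, ← hρ i,
    integral_map (measurable_pi_apply i).aemeasurable (by rw [hρ i]; exact hh.1)]

/-- Each summand is `k i` plus the indicator of `i ∈ J` times the change. The set of blocks is
independent of the batches, so the expected change is multiplied by `s / m`. Only the marginal laws
of the batches enter, hence dependence between blocks is allowed. -/
theorem integral_sum_ite_le [IsProbabilityMeasure ρ] (hs : s ≤ m) (hm : 1 ≤ m)
    (hρ : ∀ i, ρ.map (fun B => B i) = P.batchLaw i) (h : ∀ i, (Fin b → Ξ i) → ℝ) (k r : Fin m → ℝ)
    (hh : ∀ i, Integrable (h i) (P.batchLaw i)) (hr : ∀ i, ∫ B, h i B ∂(P.batchLaw i) ≤ r i) :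
    Integrable (fun q : Finset (Fin m) × (∀ i, Fin b → Ξ i) =>
      ∑ i, if i ∈ q.1 then h i (q.2 i) else k i) ((subsetLaw m s).prod ρ) ∧
    ∫ q : Finset (Fin m) × (∀ i, Fin b → Ξ i), ∑ i, (if i ∈ q.1 then h i (q.2 i) else k i)
      ∂((subsetLaw m s).prod ρ) ≤ ∑ i, (k i + (s : ℝ) / m * (r i - k i)) := by
  have := isProbabilityMeasure_subsetLaw hs
  have hp := isProbabilityMeasure_batchLaw hρ
  have e : ∀ i (q : Finset (Fin m) × (∀ i, Fin b → Ξ i)),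
      (if i ∈ q.1 then h i (q.2 i) else k i) = k i + memInd i q.1 • (h i (q.2 i) - k i) :=
    fun i q => by unfold memInd; split_ifs <;> simp
  have hI : ∀ i, Integrable (fun B => h i B - k i) (P.batchLaw i) := fun i =>
    (hh i).sub (integrable_const _)
  have hi : ∀ i, Integrable (fun q : Finset (Fin m) × (∀ i, Fin b → Ξ i) =>
      memInd i q.1 • (h i (q.2 i) - k i)) ((subsetLaw m s).prod ρ) := fun i =>
    integrable_memInd_smul hs hρ i (hI i)
  have hki : ∀ i, Integrable (fun q : Finset (Fin m) × (∀ i, Fin b → Ξ i) =>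
      k i + memInd i q.1 • (h i (q.2 i) - k i)) ((subsetLaw m s).prod ρ) := fun i =>
    (integrable_const _).add (hi i)
  simp_rw [e]
  refine ⟨integrable_finsetSum _ fun i _ => hki i, ?_⟩
  rw [integral_finsetSum _ fun i _ => hki i]
  refine Finset.sum_le_sum fun i _ => ?_
  rw [integral_add (integrable_const _) (hi i), integral_memInd_smul hs hm hρ i (hI i),
    integral_sub (hh i) (integrable_const _)]
  simp only [integral_const, probReal_univ, smul_eq_mul, one_mul]
  gcongr
  exact hr i

end StepLaw

section StateFunctions

variable (P)

/-- The error of the dual variables with respect to `α_i(x + η z)`. If the state is the outcome of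
an iteration with step size `η`, the point `x + η z` is the previous value of `x`. -/
def devα (η : ℝ) (S : State m dX dA dY) : ℝ := ∑ i, ‖S.α i - P.αStar i (S.x + η • S.z)‖ ^ 2

/-- The error of the lower-level variables with respect to `y_i(x + η z)`. -/
def devy (η : ℝ) (S : State m dX dA dY) : ℝ := ∑ i, ‖S.y i - P.yStar i (S.x + η • S.z)‖ ^ 2

/-- The error of the Hessian-inverse-vector variables with respect to `v_i(x + η z)`. -/
def devv (η : ℝ) (S : State m dX dA dY) : ℝ := ∑ i, ‖S.v i - P.vStar i (S.x + η • S.z)‖ ^ 2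

/-- The error of the momentum with respect to `∇F(x + η z)`. -/
def err (η : ℝ) (S : State m dX dA dY) : ℝ := ‖S.z - gradient P.F (S.x + η • S.z)‖ ^ 2

end StateFunctions

/-- The previous point is recovered from the new state, so errors relative to the old `x` are
functions of the new state alone. -/
theorem step_x_add (Γ : ℝ) (h : StepSizes) (J : Finset (Fin m)) (B : ∀ i, Fin b → Ξ i)
    (S : State m dX dA dY) :
    (P.step Γ h J B S).x + h.η0 • (P.step Γ h J B S).z = S.x :=
  sub_add_cancel _ _

section OneStep

variable (H : P.StructuralAssumptions p) (O : P.OracleAssumptions σ)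
  {ρ : Measure (∀ i, Fin b → Ξ i)} [IsProbabilityMeasure ρ]
  (hρ : ∀ i, ρ.map (fun B => B i) = P.batchLaw i) (hs : s ≤ m) (hm : 1 ≤ m)
  {S : State m dX dA dY} (hS : P.AdmissibleInit p.Γ S) (h : StepSizes)

include H in
theorem admissible_step (J : Finset (Fin m)) (B : ∀ i, Fin b → Ξ i)
    (hS : P.AdmissibleInit p.Γ S) : P.AdmissibleInit p.Γ (P.step p.Γ h J B S) := by
  intro i
  simp only [step]
  split_ifs with hi
  · refine ⟨(proj_spec H.A_nonempty H.A_closed H.A_convex _).1, ?_⟩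
    have := (proj_spec (K := Metric.closedBall (0 : Vec dY) p.Γ)
      ⟨0, Metric.mem_closedBall_self p.Γ_nonneg⟩ Metric.isClosed_closedBall
      (convex_closedBall _ _) (S.v i - h.η3 • (P.hessYYgo i S.x (S.y i) (B i) (S.v i)
        - P.gradYfo i S.x (S.α i) (S.y i) (B i)))).1
    simpa using this
  · exact hS i

include H O hρ hs hm hS in
-- The maximiser is a fixed point of the exact projected ascent step. The actual step differs by
-- zero-mean noise and by using `y_i` in place of the exact lower-level solution; the latter is the
-- perturbation that couples `δy` into the bound.
theorem devα_step_le (h1 : 0 < h.η1) (h2 : h.η1 ≤ p.μf / p.Lf ^ 2) (h3 : h.η1 ≤ 1 / p.μf) :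
    Integrable (fun q : Finset (Fin m) × (∀ i, Fin b → Ξ i) =>
      P.devα h.η0 (P.step p.Γ h q.1 q.2 S)) ((subsetLaw m s).prod ρ) ∧
    ∫ q : Finset (Fin m) × (∀ i, Fin b → Ξ i), P.devα h.η0 (P.step p.Γ h q.1 q.2 S)
      ∂((subsetLaw m s).prod ρ)
      ≤ (1 - s * h.η1 * p.μf / (2 * m)) * P.δα S
        + s / m * (3 * h.η1 / p.μf * p.Lf ^ 2) * P.δy S + s * (h.η1 ^ 2 * (σ ^ 2 / b)) := by
  have hp := isProbabilityMeasure_batchLaw hρ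
  have hm' : (0 : ℝ) < m := by exact_mod_cast hm
  have e : ∀ q : Finset (Fin m) × (∀ i, Fin b → Ξ i), P.devα h.η0 (P.step p.Γ h q.1 q.2 S)
      = ∑ i, if i ∈ q.1 then ‖proj P.A (S.α i + h.η1 • P.gradAfo i S.x (S.α i) (S.y i) (q.2 i))
          - P.αStar i S.x‖ ^ 2 else ‖S.α i - P.αStar i S.x‖ ^ 2 := fun q => by
    rw [devα, step_x_add]
    refine Finset.sum_congr rfl fun i _ => ?_
    simp only [step]
    split_ifs <;> rfl
  simp_rw [e]
  have key := integral_sum_ite_le hs hm hρ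
    (fun i B => ‖proj P.A (S.α i + h.η1 • P.gradAfo i S.x (S.α i) (S.y i) B)
      - P.αStar i S.x‖ ^ 2) (fun i => ‖S.α i - P.αStar i S.x‖ ^ 2)
    (fun i => (1 - h.η1 * p.μf / 2) * ‖S.α i - P.αStar i S.x‖ ^ 2
      + 3 * h.η1 / p.μf * (p.Lf ^ 2 * ‖S.y i - P.yStar i S.x‖ ^ 2) + h.η1 ^ 2 * (σ ^ 2 / b))
    (fun i => (O.gradAf_oracle i S.x (S.y i) (S.α i) (hS i).1).integrable_norm_proj_sub_sq
      H.A_nonempty H.A_closed H.A_convex _ (H.αStar_mem i S.x) _)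
    (fun i => by
      refine ((O.gradAf_oracle i S.x (S.y i) (S.α i) (hS i).1).integral_norm_proj_sub_sq_le
        H.A_nonempty H.A_closed H.A_convex (S.α i) (H.αStar_mem i S.x)
        (fun q hq => H.inner_gradAf_αStar_le i S.x hq) h1.le).trans (add_le_add ?_ le_rfl)
      -- The monotone part compares two values of `α` at the exact `y`; the perturbation compares
      -- two values of `y` at the current `α`.
      have e2 : S.α i + h.η1 • P.gradAf i S.x (S.α i) (S.y i)
          - (P.αStar i S.x + h.η1 • P.gradAf i S.x (P.αStar i S.x) (P.yStar i S.x))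
          = (S.α i - P.αStar i S.x) - h.η1 • (P.gradAf i S.x (P.αStar i S.x) (P.yStar i S.x)
              - P.gradAf i S.x (S.α i) (P.yStar i S.x))
            + h.η1 • (P.gradAf i S.x (S.α i) (S.y i) - P.gradAf i S.x (S.α i) (P.yStar i S.x)) := by
        simp only [smul_sub]; abel
      rw [e2]
      refine (norm_sub_smul_add_smul_sq_le h1 p.μf_pos p.Lf_pos h2 h3 ?_ ?_).trans
        (add_le_add le_rfl (mul_le_mul_of_nonneg_left ?_ (by have := p.μf_pos; positivity)))
      · have := H.gradAf_strongly_monotone i S.x (P.yStar i S.x) (hS i).1 (H.αStar_mem i S.x)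
        rw [← neg_sub (P.gradAf i S.x (S.α i) _), inner_neg_left]
        linarith
      · refine (H.gradAf_lipschitz i (H.αStar_mem i S.x) (hS i).1).trans_eq ?_
        rw [sub_self, sub_self, norm_zero, norm_zero, norm_sub_rev]; ring
      · rw [← mul_pow]
        refine pow_le_pow_left₀ (norm_nonneg _) ((H.gradAf_lipschitz i (hS i).1 (hS i).1).trans_eq ?_) 2
        rw [sub_self, sub_self, norm_zero, norm_zero]; ring)
  refine ⟨key.1, key.2.trans_eq ?_⟩
  rw [δα, δy, Finset.mul_sum, Finset.mul_sum, ← Finset.sum_add_distrib]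
  have e3 : (s : ℝ) * (h.η1 ^ 2 * (σ ^ 2 / b)) = ∑ _i : Fin m, (s : ℝ) / m * (h.η1 ^ 2 * (σ ^ 2 / b)) := by
    rw [Finset.sum_const, Finset.card_univ, Fintype.card_fin, nsmul_eq_mul]
    field_simp
  rw [e3, ← Finset.sum_add_distrib]
  refine Finset.sum_congr rfl fun i _ => ?_
  field_simp
  ring

include H O hρ hs hm in
theorem devy_step_le (h1 : 0 < h.η2) (h2 : h.η2 ≤ p.μg / p.Lg ^ 2) :
    Integrable (fun q : Finset (Fin m) × (∀ i, Fin b → Ξ i) =>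
      P.devy h.η0 (P.step p.Γ h q.1 q.2 S)) ((subsetLaw m s).prod ρ) ∧
    ∫ q : Finset (Fin m) × (∀ i, Fin b → Ξ i), P.devy h.η0 (P.step p.Γ h q.1 q.2 S)
      ∂((subsetLaw m s).prod ρ)
      ≤ (1 - s * h.η2 * p.μg / m) * P.δy S + s * (h.η2 ^ 2 * (σ ^ 2 / b)) := by
  have hp := isProbabilityMeasure_batchLaw hρ
  have hm' : (0 : ℝ) < m := by exact_mod_cast hm
  have e : ∀ q : Finset (Fin m) × (∀ i, Fin b → Ξ i), P.devy h.η0 (P.step p.Γ h q.1 q.2 S)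
      = ∑ i, if i ∈ q.1 then ‖S.y i + (-h.η2) • P.gradYgo i S.x (S.y i) (q.2 i)
          - P.yStar i S.x‖ ^ 2 else ‖S.y i - P.yStar i S.x‖ ^ 2 := fun q => by
    rw [devy, step_x_add]
    refine Finset.sum_congr rfl fun i _ => ?_
    simp only [step, neg_smul, ← sub_eq_add_neg]
    split_ifs <;> rfl
  simp_rw [e]
  have key := integral_sum_ite_le hs hm hρ
    (fun i B => ‖S.y i + (-h.η2) • P.gradYgo i S.x (S.y i) B - P.yStar i S.x‖ ^ 2)
    (fun i => ‖S.y i - P.yStar i S.x‖ ^ 2)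
    (fun i => (1 - h.η2 * p.μg) * ‖S.y i - P.yStar i S.x‖ ^ 2 + (-h.η2) ^ 2 * (σ ^ 2 / b))
    (fun i => (O.gradYg_oracle i S.x (S.y i)).integrable_norm_add_smul_sub_sq _ _ _)
    (fun i => by
      refine ((O.gradYg_oracle i S.x (S.y i)).integral_norm_add_smul_sub_sq_le _ _ _).trans
        (add_le_add ?_ le_rfl)
      have e2 : S.y i + (-h.η2) • P.gradYg i S.x (S.y i) - P.yStar i S.x
          = (S.y i - P.yStar i S.x)
            - h.η2 • (P.gradYg i S.x (S.y i) - P.gradYg i S.x (P.yStar i S.x)) := by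
        rw [H.gradYg_yStar, sub_zero, neg_smul]; abel
      rw [e2]
      refine norm_sub_smul_sq_le h1.le p.Lg_pos h2 (H.gradYg_strongly_monotone i _ _ _) ?_
      refine (H.gradYg_lipschitz i).trans_eq ?_
      rw [sub_self, norm_zero, zero_add])
  refine ⟨key.1, key.2.trans_eq ?_⟩
  rw [δy, Finset.mul_sum]
  have e3 : (s : ℝ) * (h.η2 ^ 2 * (σ ^ 2 / b)) = ∑ _i : Fin m, (s : ℝ) / m * (h.η2 ^ 2 * (σ ^ 2 / b)) := by
    rw [Finset.sum_const, Finset.card_univ, Fintype.card_fin, nsmul_eq_mul]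
    field_simp
  rw [e3, ← Finset.sum_add_distrib]
  refine Finset.sum_congr rfl fun i _ => ?_
  field_simp
  ring

include H O hρ hs hm hS in
-- The target solves the linear system at the exact solutions and lies in the ball of radius `Γ`.
-- The current Hessian drives the contraction, while the errors of `α` and `y` enter through the
-- changed Hessian and right-hand side.
theorem devv_step_le (h1 : 0 < h.η3) (h2 : h.η3 ≤ p.μg / p.Lg ^ 2) (h3 : h.η3 ≤ 1 / p.μg) :
    Integrable (fun q : Finset (Fin m) × (∀ i, Fin b → Ξ i) =>
      P.devv h.η0 (P.step p.Γ h q.1 q.2 S)) ((subsetLaw m s).prod ρ) ∧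
    ∫ q : Finset (Fin m) × (∀ i, Fin b → Ξ i), P.devv h.η0 (P.step p.Γ h q.1 q.2 S)
      ∂((subsetLaw m s).prod ρ)
      ≤ (1 - s * h.η3 * p.μg / (2 * m)) * P.δv S
        + s / m * (6 * h.η3 / p.μg * (p.Lf + p.Lgyy * p.Γ) ^ 2) * (P.δα S + P.δy S)
        + s * (h.η3 ^ 2 * (2 * (1 + p.Γ ^ 2) * (σ ^ 2 / b))) := by
  have hp := isProbabilityMeasure_batchLaw hρ
  have hm' : (0 : ℝ) < m := by exact_mod_cast hm
  have hK : (Metric.closedBall (0 : Vec dY) p.Γ).Nonempty :=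
    ⟨0, Metric.mem_closedBall_self p.Γ_nonneg⟩
  have horacle : ∀ i, IsUnbiasedOracle (P.batchLaw i) (fun B =>
      P.gradYfo i S.x (S.α i) (S.y i) B - P.hessYYgo i S.x (S.y i) B (S.v i))
      (P.gradYf i S.x (S.α i) (S.y i) - P.hessYYg i S.x (S.y i) (S.v i))
      (2 * (1 + p.Γ ^ 2) * (σ ^ 2 / b)) := fun i =>
    (O.gradYf_oracle i S.x (S.y i) (S.α i) (hS i).1).sub_apply (O.hessYYg_oracle i S.x (S.y i))
      (hS i).2
  have hmem : ∀ i, P.vStar i S.x ∈ Metric.closedBall (0 : Vec dY) p.Γ := fun i => by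
    simpa using H.norm_vStar_le i S.x
  have e : ∀ q : Finset (Fin m) × (∀ i, Fin b → Ξ i), P.devv h.η0 (P.step p.Γ h q.1 q.2 S)
      = ∑ i, if i ∈ q.1 then ‖proj (Metric.closedBall 0 p.Γ) (S.v i + h.η3 •
          (P.gradYfo i S.x (S.α i) (S.y i) (q.2 i) - P.hessYYgo i S.x (S.y i) (q.2 i) (S.v i)))
          - P.vStar i S.x‖ ^ 2 else ‖S.v i - P.vStar i S.x‖ ^ 2 := fun q => by
    rw [devv, step_x_add]
    refine Finset.sum_congr rfl fun i _ => ?_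
    have e4 : S.v i + h.η3 •
          (P.gradYfo i S.x (S.α i) (S.y i) (q.2 i) - P.hessYYgo i S.x (S.y i) (q.2 i) (S.v i))
        = S.v i - h.η3 •
          (P.hessYYgo i S.x (S.y i) (q.2 i) (S.v i) - P.gradYfo i S.x (S.α i) (S.y i) (q.2 i)) := by
      simp only [smul_sub]; abel
    rw [e4]
    simp only [step]
    split_ifs <;> rfl
  simp_rw [e]
  have key := integral_sum_ite_le hs hm hρ
    (fun i B => ‖proj (Metric.closedBall 0 p.Γ) (S.v i + h.η3 •
          (P.gradYfo i S.x (S.α i) (S.y i) B - P.hessYYgo i S.x (S.y i) B (S.v i)))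
          - P.vStar i S.x‖ ^ 2) (fun i => ‖S.v i - P.vStar i S.x‖ ^ 2)
    (fun i => (1 - h.η3 * p.μg / 2) * ‖S.v i - P.vStar i S.x‖ ^ 2
      + 3 * h.η3 / p.μg * ((p.Lf + p.Lgyy * p.Γ) ^ 2 * (2 * ‖S.α i - P.αStar i S.x‖ ^ 2
        + 2 * ‖S.y i - P.yStar i S.x‖ ^ 2)) + h.η3 ^ 2 * (2 * (1 + p.Γ ^ 2) * (σ ^ 2 / b)))
    (fun i => (horacle i).integrable_norm_proj_sub_sq
      hK Metric.isClosed_closedBall (convex_closedBall _ _) _ (hmem i) _)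
    (fun i => by
      -- The normal direction is `0`: the target already solves its linear system, so the ball
      -- constraint contributes no force.
      refine ((horacle i).integral_norm_proj_sub_sq_le hK Metric.isClosed_closedBall
        (convex_closedBall _ _) (S.v i) (hmem i) (d := 0) (by simp) h1.le).trans
        (add_le_add ?_ le_rfl)
      -- The current Hessian acts on the error in `v`, and the Hessian difference on the exact
      -- vector, which is bounded by `Γ`.
      have e2 : S.v i + h.η3 • (P.gradYf i S.x (S.α i) (S.y i) - P.hessYYg i S.x (S.y i) (S.v i))
          - (P.vStar i S.x + h.η3 • 0)
          = (S.v i - P.vStar i S.x) - h.η3 • P.hessYYg i S.x (S.y i) (S.v i - P.vStar i S.x)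
            + h.η3 • ((P.gradYf i S.x (S.α i) (S.y i)
                - P.gradYf i S.x (P.αStar i S.x) (P.yStar i S.x))
              - (P.hessYYg i S.x (S.y i) - P.hessYYg i S.x (P.yStar i S.x)) (P.vStar i S.x)) := by
        rw [sub_apply, H.hessYYg_vStar, map_sub]
        simp only [smul_sub, smul_zero]; abel
      rw [e2]
      refine (norm_sub_smul_add_smul_sq_le h1 p.μg_pos p.Lg_pos h2 h3
        (H.hessYYg_coercive i _ _ _) ?_).trans
        (add_le_add le_rfl (mul_le_mul_of_nonneg_left ?_ (by have := p.μg_pos; positivity)))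
      · exact (P.hessYYg i S.x (S.y i)).le_of_opNorm_le (H.norm_hessYYg_le i _ _) _
      · have n1 := H.gradYf_lipschitz i (x := S.x) (x' := S.x) (y := S.y i) (y' := P.yStar i S.x)
          (hS i).1 (H.αStar_mem i S.x)
        have n2 := (P.hessYYg i S.x (S.y i) - P.hessYYg i S.x (P.yStar i S.x)).le_opNorm_of_le
          (H.norm_vStar_le i S.x)
        have n3 := mul_le_mul_of_nonneg_right (H.hessYYg_lipschitz_add i (x := S.x) (x' := S.x)
          (y := S.y i) (y' := P.yStar i S.x)) p.Γ_nonneg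
        rw [sub_self, norm_zero, zero_add] at n1 n3
        have n4 := (norm_sub_le (P.gradYf i S.x (S.α i) (S.y i)
                - P.gradYf i S.x (P.αStar i S.x) (P.yStar i S.x))
              ((P.hessYYg i S.x (S.y i) - P.hessYYg i S.x (P.yStar i S.x)) (P.vStar i S.x)))
        have n5 : 0 ≤ p.Lgyy * p.Γ := mul_nonneg p.Lgyy_nonneg p.Γ_nonneg
        have n6 := norm_nonneg (S.α i - P.αStar i S.x)
        have n7 : ‖(P.gradYf i S.x (S.α i) (S.y i)
                - P.gradYf i S.x (P.αStar i S.x) (P.yStar i S.x))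
              - (P.hessYYg i S.x (S.y i) - P.hessYYg i S.x (P.yStar i S.x)) (P.vStar i S.x)‖
            ≤ (p.Lf + p.Lgyy * p.Γ) * (‖S.α i - P.αStar i S.x‖ + ‖S.y i - P.yStar i S.x‖) := by
          nlinarith [mul_nonneg n5 n6]
        refine (pow_le_pow_left₀ (norm_nonneg _) n7 2).trans ?_
        rw [mul_pow]
        refine mul_le_mul_of_nonneg_left ?_ (sq_nonneg _)
        nlinarith [sq_nonneg (‖S.α i - P.αStar i S.x‖ - ‖S.y i - P.yStar i S.x‖)])
  refine ⟨key.1, key.2.trans_eq ?_⟩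
  rw [δα, δy, δv, ← Finset.sum_add_distrib, Finset.mul_sum, Finset.mul_sum,
    ← Finset.sum_add_distrib]
  have e3 : (s : ℝ) * (h.η3 ^ 2 * (2 * (1 + p.Γ ^ 2) * (σ ^ 2 / b)))
      = ∑ _i : Fin m, (s : ℝ) / m * (h.η3 ^ 2 * (2 * (1 + p.Γ ^ 2) * (σ ^ 2 / b))) := by
    rw [Finset.sum_const, Finset.card_univ, Fintype.card_fin, nsmul_eq_mul]
    field_simp
  rw [e3, ← Finset.sum_add_distrib]
  refine Finset.sum_congr rfl fun i _ => ?_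
  field_simp
  ring

end OneStep

end Problem

/-! ### Bias and variance of the gradient estimator, and the momentum error. -/

namespace Params
variable (p : Params)

/-- A bound for the norm of `∇F` and of the directions `∇ₓ f_i - ∇²_{xy} g_i v`, `‖v‖ ≤ Γ`. -/
def boundDir : ℝ := p.Cf + p.Cgxy * p.Γ

/-- The variance of the gradient estimator is at most `varDir σ / min s b`. -/
def varDir (σ : ℝ) : ℝ := 4 * (1 + p.Γ ^ 2) * σ ^ 2 + 8 * p.boundDir ^ 2

theorem boundDir_nonneg : 0 ≤ p.boundDir := by
  have := p.Cf_nonneg; have := p.Cgxy_nonneg; have := p.Γ_nonneg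
  unfold boundDir; positivity

theorem varDir_nonneg (σ : ℝ) : 0 ≤ p.varDir σ := by
  unfold varDir; positivity

end Params

theorem norm_sum_sq_le_card_mul {ι E : Type*} [NormedAddCommGroup E] (J : Finset ι) (a : ι → E) :
    ‖∑ i ∈ J, a i‖ ^ 2 ≤ J.card * ∑ i ∈ J, ‖a i‖ ^ 2 :=
  (pow_le_pow_left₀ (norm_nonneg _) (norm_sum_le _ _) 2).trans sq_sum_le_card_mul_sum_sq

theorem norm_inv_smul_sum_sq_le {m : ℕ} {E : Type*} [NormedAddCommGroup E] [NormedSpace ℝ E]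
    (hm : 1 ≤ m) (a : Fin m → E) :
    ‖(m : ℝ)⁻¹ • ∑ i, a i‖ ^ 2 ≤ (m : ℝ)⁻¹ * ∑ i, ‖a i‖ ^ 2 := by
  have hm' : (0 : ℝ) < m := by exact_mod_cast hm
  have h := norm_sum_sq_le_card_mul Finset.univ a
  rw [Finset.card_univ, Fintype.card_fin] at h
  rw [norm_smul, mul_pow, norm_inv, Real.norm_of_nonneg hm'.le]
  calc ((m : ℝ)⁻¹) ^ 2 * ‖∑ i, a i‖ ^ 2 ≤ ((m : ℝ)⁻¹) ^ 2 * (m * ∑ i, ‖a i‖ ^ 2) :=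
        mul_le_mul_of_nonneg_left h (by positivity)
    _ = _ := by field_simp

theorem norm_convexComb_sq_le {E : Type*} [NormedAddCommGroup E] [NormedSpace ℝ E] {β : ℝ}
    (h0 : 0 ≤ β) (h1 : β ≤ 1) (a c : E) :
    ‖(1 - β) • a + β • c‖ ^ 2 ≤ (1 - β) * ‖a‖ ^ 2 + β * ‖c‖ ^ 2 := by
  have h2 : ‖(1 - β) • a + β • c‖ ≤ (1 - β) * ‖a‖ + β * ‖c‖ := by
    refine (norm_add_le _ _).trans_eq ?_
    rw [norm_smul, norm_smul, Real.norm_of_nonneg h0, Real.norm_of_nonneg (sub_nonneg.2 h1)]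
  refine (pow_le_pow_left₀ (norm_nonneg _) h2 2).trans ?_
  nlinarith [mul_nonneg (mul_nonneg h0 (sub_nonneg.2 h1)) (sq_nonneg (‖a‖ - ‖c‖))]

namespace Problem

variable {m dX dA dY b s : ℕ} {Ξ : Fin m → Type u} [∀ i, MeasurableSpace (Ξ i)]
  {P : Problem m dX dA dY b Ξ} {p : Params} {σ : ℝ}

/-- The mean of the gradient estimator. -/
def meanDir (P : Problem m dX dA dY b Ξ) (S : State m dX dA dY) : Vec dX :=
  (m : ℝ)⁻¹ • ∑ i, P.dir i S.x (S.α i) (S.y i) (S.v i)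

section OneStep

variable (H : P.StructuralAssumptions p) (O : P.OracleAssumptions σ)
  {ρ : Measure (∀ i, Fin b → Ξ i)} [IsProbabilityMeasure ρ]
  (hρ : ∀ i, ρ.map (fun B => B i) = P.batchLaw i) (hs : s ≤ m) (hs1 : 1 ≤ s)
  {S : State m dX dA dY} (hS : P.AdmissibleInit p.Γ S) (h : StepSizes)

include O hS in
theorem dir_oracle (i : Fin m) [IsProbabilityMeasure (P.batchLaw i)] :
    IsUnbiasedOracle (P.batchLaw i)
      (fun B => P.gradXfo i S.x (S.α i) (S.y i) B - P.hessXYgo i S.x (S.y i) B (S.v i))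
      (P.dir i S.x (S.α i) (S.y i) (S.v i)) (2 * (1 + p.Γ ^ 2) * (σ ^ 2 / b)) :=
  (O.gradXf_oracle i S.x (S.y i) (S.α i) (hS i).1).sub_apply (O.hessXYg_oracle i S.x (S.y i))
    (hS i).2

theorem gradEstimator_ae_eq {ρ : Measure (∀ i, Fin b → Ξ i)} [SFinite ρ]
    {S : State m dX dA dY} :
    (fun q : Finset (Fin m) × (∀ i, Fin b → Ξ i) => P.gradEstimator q.1 q.2 S)
      =ᵐ[(subsetLaw m s).prod ρ] fun q => (s : ℝ)⁻¹ • ∑ i, memInd i q.1 •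
        (P.gradXfo i S.x (S.α i) (S.y i) (q.2 i) - P.hessXYgo i S.x (S.y i) (q.2 i) (S.v i)) := by
  have hc : ∀ᵐ q ∂((subsetLaw m s).prod ρ), q.1.card = s :=
    Measure.quasiMeasurePreserving_fst.ae ae_card_eq_subsetLaw
  filter_upwards [hc] with q hq
  rw [gradEstimator, hq, sum_memInd_smul]

include O hρ hs hS in
theorem memLp_gradEstimator :
    MemLp (fun q : Finset (Fin m) × (∀ i, Fin b → Ξ i) => P.gradEstimator q.1 q.2 S) 2
      ((subsetLaw m s).prod ρ) := by
  have := isProbabilityMeasure_subsetLaw hs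
  have hp := isProbabilityMeasure_batchLaw hρ
  suffices h0 : MemLp (fun q : Finset (Fin m) × (∀ i, Fin b → Ξ i) => ∑ i, memInd i q.1 •
      (P.gradXfo i S.x (S.α i) (S.y i) (q.2 i) - P.hessXYgo i S.x (S.y i) (q.2 i) (S.v i))) 2
      ((subsetLaw m s).prod ρ) from
    (memLp_congr_ae gradEstimator_ae_eq).2 (h0.const_smul (s : ℝ)⁻¹)
  refine memLp_finsetSum _ fun i _ => ?_
  have hi := dir_oracle O hS i
  have h1 := (hi.1.comp_measurePreserving (measurePreserving_batch hρ i)).comp_measurePreserving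
    (measurePreserving_snd (μ := subsetLaw m s) (ν := ρ))
  refine h1.mono (integrable_memInd_smul hs hρ i (hi.1.integrable one_le_two)).1
    (Filter.Eventually.of_forall fun q => ?_)
  rw [norm_smul]
  have h2 : ‖memInd i q.1‖ ≤ 1 := by unfold memInd; split_ifs <;> simp
  exact mul_le_of_le_one_left (norm_nonneg _) h2

include O hρ hs hs1 hS in
theorem integral_gradEstimator :
    ∫ q : Finset (Fin m) × (∀ i, Fin b → Ξ i), P.gradEstimator q.1 q.2 S ∂((subsetLaw m s).prod ρ)
      = P.meanDir S := by
  have hp := isProbabilityMeasure_batchLaw hρ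
  have hI := fun i => (dir_oracle O hS i).1.integrable one_le_two
  have hs' : (0 : ℝ) < s := by exact_mod_cast hs1
  rw [integral_congr_ae gradEstimator_ae_eq, integral_smul,
    integral_finsetSum _ fun i _ => integrable_memInd_smul hs hρ i (hI i), meanDir]
  have e : ∀ i, ∫ q : Finset (Fin m) × (∀ i, Fin b → Ξ i), memInd i q.1 •
      (P.gradXfo i S.x (S.α i) (S.y i) (q.2 i) - P.hessXYgo i S.x (S.y i) (q.2 i) (S.v i))
        ∂((subsetLaw m s).prod ρ) = ((s : ℝ) / m) • P.dir i S.x (S.α i) (S.y i) (S.v i) :=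
    fun i => by
      rw [integral_memInd_smul hs (hs1.trans hs) hρ i (hI i), (dir_oracle O hS i).2.1]
  simp_rw [e]
  rw [← Finset.smul_sum, smul_smul]
  congr 1
  field_simp

include H O hρ hs hs1 hS in
-- The deviation from the mean splits into batch noise inside the sampled blocks and the noise of
-- choosing the blocks. The first is of order `1/b`, the second of order `1/s`.
theorem variance_gradEstimator_le :
    ∫ q : Finset (Fin m) × (∀ i, Fin b → Ξ i), ‖P.gradEstimator q.1 q.2 S - P.meanDir S‖ ^ 2
      ∂((subsetLaw m s).prod ρ)
      ≤ 4 * (1 + p.Γ ^ 2) * (σ ^ 2 / b) + 8 * p.boundDir ^ 2 / s := by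
  have hpU := isProbabilityMeasure_subsetLaw hs
  have hp := isProbabilityMeasure_batchLaw hρ
  have hm := hs1.trans hs
  have hs' : (0 : ℝ) < s := by exact_mod_cast hs1
  have hm' : (0 : ℝ) < m := by exact_mod_cast hm
  set G : ∀ i, (Fin b → Ξ i) → Vec dX := fun i B =>
    P.gradXfo i S.x (S.α i) (S.y i) B - P.hessXYgo i S.x (S.y i) B (S.v i) with hG
  set c : Fin m → Vec dX := fun i => P.dir i S.x (S.α i) (S.y i) (S.v i) with hc
  have hGo : ∀ i, IsUnbiasedOracle (P.batchLaw i) (G i) (c i) (2 * (1 + p.Γ ^ 2) * (σ ^ 2 / b)) :=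
    fun i => dir_oracle O hS i
  have hsq : ∀ i, Integrable (fun B => ‖G i B - c i‖ ^ 2) (P.batchLaw i) := fun i =>
    (hGo i).integrable_norm_sub_sq
  have hcsum : ∑ i, (c i - P.meanDir S) = 0 := by
    rw [Finset.sum_sub_distrib, Finset.sum_const, Finset.card_univ, Fintype.card_fin, meanDir,
      ← Nat.cast_smul_eq_nsmul ℝ, smul_smul, mul_inv_cancel₀ hm'.ne', one_smul, sub_self]
  have hcb : ∀ i, ‖c i - P.meanDir S‖ ^ 2 ≤ 4 * p.boundDir ^ 2 := fun i => by
    have h1 : ∀ i, ‖c i‖ ≤ p.boundDir := fun i => H.norm_dir_le i (hS i).1 (hS i).2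
    have h2 : ‖P.meanDir S‖ ≤ p.boundDir := norm_average_le hm h1
    have h3 := norm_sub_sq_le_two (c i) (P.meanDir S)
    nlinarith [h1 i, norm_nonneg (c i), norm_nonneg (P.meanDir S)]
  have hbound : ∀ᵐ q ∂((subsetLaw m s).prod ρ), ‖P.gradEstimator q.1 q.2 S - P.meanDir S‖ ^ 2
      ≤ 2 * ((s : ℝ)⁻¹ * ∑ i, memInd i q.1 • ‖G i (q.2 i) - c i‖ ^ 2)
        + 2 * (((s : ℝ)⁻¹) ^ 2 * ‖∑ i, memInd i q.1 • (c i - P.meanDir S)‖ ^ 2) := by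
    have hcard : ∀ᵐ q ∂((subsetLaw m s).prod ρ), q.1.card = s :=
      Measure.quasiMeasurePreserving_fst.ae ae_card_eq_subsetLaw
    filter_upwards [hcard] with q hq
    have e : P.gradEstimator q.1 q.2 S - P.meanDir S
        = (s : ℝ)⁻¹ • ∑ i ∈ q.1, (G i (q.2 i) - c i)
          + (s : ℝ)⁻¹ • ∑ i ∈ q.1, (c i - P.meanDir S) := by
      have e0 : ∑ i ∈ q.1, (G i (q.2 i) - P.meanDir S)
          = ∑ i ∈ q.1, G i (q.2 i) - (s : ℝ) • P.meanDir S := by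
        rw [Finset.sum_sub_distrib, Finset.sum_const, hq, Nat.cast_smul_eq_nsmul ℝ]
      rw [gradEstimator, hq, ← smul_add, ← Finset.sum_add_distrib]
      simp only [sub_add_sub_cancel]
      rw [e0, smul_sub, smul_smul, inv_mul_cancel₀ hs'.ne', one_smul]
    rw [e, sum_memInd_smul, sum_memInd_smul]
    refine (norm_add_sq_le_two _ _).trans ?_
    rw [norm_smul, norm_smul, mul_pow, mul_pow, norm_inv, Real.norm_of_nonneg hs'.le]
    -- Batches of different blocks may be dependent, so Cauchy–Schwarz is used and averaging over
    -- the blocks gains no extra factor `1/s`.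
    have h1 := norm_sum_sq_le_card_mul q.1 (fun i => G i (q.2 i) - c i)
    rw [hq] at h1
    have h2 : ((s : ℝ)⁻¹) ^ 2 * ‖∑ i ∈ q.1, (G i (q.2 i) - c i)‖ ^ 2
        ≤ (s : ℝ)⁻¹ * ∑ i ∈ q.1, ‖G i (q.2 i) - c i‖ ^ 2 := by
      calc _ ≤ ((s : ℝ)⁻¹) ^ 2 * (s * ∑ i ∈ q.1, ‖G i (q.2 i) - c i‖ ^ 2) :=
            mul_le_mul_of_nonneg_left h1 (by positivity)
        _ = _ := by field_simp
    linarith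
  have hI1 : ∀ i, Integrable (fun q : Finset (Fin m) × (∀ i, Fin b → Ξ i) =>
      memInd i q.1 • ‖G i (q.2 i) - c i‖ ^ 2) ((subsetLaw m s).prod ρ) := fun i =>
    integrable_memInd_smul hs hρ i (hsq i)
  have hI2 : Integrable (fun q : Finset (Fin m) × (∀ i, Fin b → Ξ i) =>
      2 * ((s : ℝ)⁻¹ * ∑ i, memInd i q.1 • ‖G i (q.2 i) - c i‖ ^ 2))
      ((subsetLaw m s).prod ρ) :=
    ((integrable_finsetSum _ fun i _ => hI1 i).const_mul _).const_mul _
  have hI3 : Integrable (fun q : Finset (Fin m) × (∀ i, Fin b → Ξ i) =>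
      2 * (((s : ℝ)⁻¹) ^ 2 * ‖∑ i, memInd i q.1 • (c i - P.meanDir S)‖ ^ 2))
      ((subsetLaw m s).prod ρ) :=
    (((Integrable.of_finite (f := fun J => ‖∑ i, memInd i J • (c i - P.meanDir S)‖ ^ 2)
      (μ := subsetLaw m s)).comp_fst ρ).const_mul _).const_mul _
  refine (integral_mono_ae (((memLp_gradEstimator O hρ hs hS).sub
    (memLp_const _)).integrable_norm_pow (p := 2) two_ne_zero) (hI2.add hI3) hbound).trans ?_
  simp only [Pi.add_apply]
  rw [integral_add hI2 hI3, integral_const_mul, integral_const_mul, integral_const_mul,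
    integral_const_mul, integral_finsetSum _ fun i _ => hI1 i]
  have h4 : ∑ i, ∫ q : Finset (Fin m) × (∀ i, Fin b → Ξ i), memInd i q.1 • ‖G i (q.2 i) - c i‖ ^ 2
      ∂((subsetLaw m s).prod ρ) ≤ s * (2 * (1 + p.Γ ^ 2) * (σ ^ 2 / b)) := by
    calc _ ≤ ∑ _i : Fin m, (s : ℝ) / m * (2 * (1 + p.Γ ^ 2) * (σ ^ 2 / b)) := by
          refine Finset.sum_le_sum fun i _ => ?_
          rw [integral_memInd_smul hs hm hρ i (hsq i), smul_eq_mul]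
          exact mul_le_mul_of_nonneg_left (hGo i).2.2 (by positivity)
      _ = _ := by
          rw [Finset.sum_const, Finset.card_univ, Fintype.card_fin, nsmul_eq_mul]; field_simp
  have h5 : ∫ q : Finset (Fin m) × (∀ i, Fin b → Ξ i),
      ‖∑ i, memInd i q.1 • (c i - P.meanDir S)‖ ^ 2 ∂((subsetLaw m s).prod ρ)
      ≤ s * (4 * p.boundDir ^ 2) := by
    rw [integral_fun_fst (f := fun J => ‖∑ i, memInd i J • (c i - P.meanDir S)‖ ^ 2)]
    simp only [probReal_univ, one_smul]
    refine (integral_norm_sq_sum_memInd_le hs hm _ hcsum).trans ?_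
    calc (s : ℝ) / m * ∑ i, ‖c i - P.meanDir S‖ ^ 2
        ≤ (s : ℝ) / m * ∑ _i : Fin m, 4 * p.boundDir ^ 2 :=
          mul_le_mul_of_nonneg_left (Finset.sum_le_sum fun i _ => hcb i) (by positivity)
      _ = _ := by
          rw [Finset.sum_const, Finset.card_univ, Fintype.card_fin, nsmul_eq_mul]; field_simp
  have h6 := mul_le_mul_of_nonneg_left h4 (inv_nonneg.2 hs'.le)
  have h7 := mul_le_mul_of_nonneg_left h5 (sq_nonneg (s : ℝ)⁻¹)
  have e6 : (s : ℝ)⁻¹ * (s * (2 * (1 + p.Γ ^ 2) * (σ ^ 2 / b))) = 2 * (1 + p.Γ ^ 2) * (σ ^ 2 / b) := by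
    field_simp
  have e7 : ((s : ℝ)⁻¹) ^ 2 * (s * (4 * p.boundDir ^ 2)) = 4 * p.boundDir ^ 2 / s := by
    field_simp
  rw [e6] at h6
  rw [e7] at h7
  have e8 : 8 * p.boundDir ^ 2 / s = 2 * (4 * p.boundDir ^ 2 / s) := by ring
  linarith

include H O hρ hs hs1 hS in
theorem variance_gradEstimator_le' (hb : 1 ≤ b) :
    ∫ q : Finset (Fin m) × (∀ i, Fin b → Ξ i), ‖P.gradEstimator q.1 q.2 S - P.meanDir S‖ ^ 2
      ∂((subsetLaw m s).prod ρ) ≤ p.varDir σ / (min s b : ℕ) := by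
  refine (variance_gradEstimator_le H O hρ hs hs1 hS).trans ?_
  have hmin : (0 : ℝ) < (min s b : ℕ) := by exact_mod_cast lt_min hs1 hb
  have h1 : ((min s b : ℕ) : ℝ) ≤ s := by exact_mod_cast min_le_left s b
  have h2 : ((min s b : ℕ) : ℝ) ≤ b := by exact_mod_cast min_le_right s b
  have := p.boundDir_nonneg
  rw [Params.varDir, add_div, mul_div_assoc (4 * (1 + p.Γ ^ 2))]
  exact add_le_add (mul_le_mul_of_nonneg_left
    (div_le_div_of_nonneg_left (sq_nonneg σ) hmin h2) (by positivity))
    (div_le_div_of_nonneg_left (by positivity) hmin h1)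

include H hs hs1 hS in
theorem norm_meanDir_sub_gradient_sq_le :
    ‖P.meanDir S - gradient P.F S.x‖ ^ 2
      ≤ (m : ℝ)⁻¹ * (3 * p.lipDir ^ 2 * (P.δα S + P.δy S + P.δv S)) := by
  have hm := hs1.trans hs
  rw [H.gradient_F, meanDir, ← smul_sub, ← Finset.sum_sub_distrib]
  refine (norm_inv_smul_sum_sq_le hm _).trans
    (mul_le_mul_of_nonneg_left ?_ (by positivity))
  rw [δα, δy, δv, ← Finset.sum_add_distrib, ← Finset.sum_add_distrib, Finset.mul_sum]
  refine Finset.sum_le_sum fun i _ => ?_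
  have h1 := H.dir_lipschitz i (x := S.x) (x' := S.x) (y := S.y i) (y' := P.yStar i S.x)
    (v := S.v i) (v' := P.vStar i S.x) (hS i).1 (H.αStar_mem i S.x) (H.norm_vStar_le i S.x)
  rw [sub_self, norm_zero, zero_add] at h1
  refine (pow_le_pow_left₀ (norm_nonneg _) h1 2).trans ?_
  rw [mul_pow, mul_comm 3, mul_assoc]
  refine mul_le_mul_of_nonneg_left ?_ (sq_nonneg _)
  nlinarith [sq_nonneg (‖S.α i - P.αStar i S.x‖ - ‖S.y i - P.yStar i S.x‖),
    sq_nonneg (‖S.α i - P.αStar i S.x‖ - ‖S.v i - P.vStar i S.x‖),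
    sq_nonneg (‖S.y i - P.yStar i S.x‖ - ‖S.v i - P.vStar i S.x‖)]

include H O hρ hs hs1 hS in
-- The centred estimator separates the noise exactly. The deterministic remainder is a convex
-- combination of the old error with drift plus bias, the drift being divided by `β₀`; this is the
-- source of the factor `2 / β₀`.
theorem err_step_le (hb : 1 ≤ b) (hβ : 0 < h.β0) (hβ1 : h.β0 ≤ 1) :
    Integrable (fun q : Finset (Fin m) × (∀ i, Fin b → Ξ i) =>
      P.err h.η0 (P.step p.Γ h q.1 q.2 S)) ((subsetLaw m s).prod ρ) ∧
    ∫ q : Finset (Fin m) × (∀ i, Fin b → Ξ i), P.err h.η0 (P.step p.Γ h q.1 q.2 S)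
      ∂((subsetLaw m s).prod ρ)
      ≤ (1 - h.β0) * P.err h.η0 S + 2 / h.β0 * (p.lipGrad * h.η0) ^ 2 * ‖S.z‖ ^ 2
        + 2 * h.β0 * ((m : ℝ)⁻¹ * (3 * p.lipDir ^ 2 * (P.δα S + P.δy S + P.δv S)))
        + h.β0 ^ 2 * (p.varDir σ / (min s b : ℕ)) := by
  have hpU := isProbabilityMeasure_subsetLaw hs
  have hm := hs1.trans hs
  have hX : MemLp (fun q : Finset (Fin m) × (∀ i, Fin b → Ξ i) =>
      P.gradEstimator q.1 q.2 S - P.meanDir S) 2 ((subsetLaw m s).prod ρ) :=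
    (memLp_gradEstimator O hρ hs hS).sub (memLp_const _)
  have hX0 : ∫ q : Finset (Fin m) × (∀ i, Fin b → Ξ i), (P.gradEstimator q.1 q.2 S - P.meanDir S)
      ∂((subsetLaw m s).prod ρ) = 0 := by
    rw [integral_sub ((memLp_gradEstimator O hρ hs hS).integrable one_le_two)
      (integrable_const _), integral_gradEstimator O hρ hs hs1 hS]
    simp
  set w := (1 - h.β0) • S.z + h.β0 • P.meanDir S - gradient P.F S.x with hw
  have e : ∀ q : Finset (Fin m) × (∀ i, Fin b → Ξ i), P.err h.η0 (P.step p.Γ h q.1 q.2 S)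
      = ‖w + h.β0 • (P.gradEstimator q.1 q.2 S - P.meanDir S)‖ ^ 2 := fun q => by
    rw [err, step_x_add, hw, smul_sub]
    simp only [step]
    congr 2; abel
  simp_rw [e]
  refine ⟨integrable_norm_add_smul_sq hX w _, ?_⟩
  rw [integral_norm_add_smul_sq hX hX0]
  refine add_le_add ?_ (mul_le_mul_of_nonneg_left
    (variance_gradEstimator_le' H O hρ hs hs1 hS hb) (sq_nonneg _))
  set a := S.z - gradient P.F (S.x + h.η0 • S.z) with ha
  set d := gradient P.F (S.x + h.η0 • S.z) - gradient P.F S.x with hd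
  set e' := P.meanDir S - gradient P.F S.x with he'
  -- The sign of `η₀` is not assumed here and disappears on squaring.
  have hdn : ‖d‖ ≤ p.lipGrad * h.η0 * ‖S.z‖ ∨ ‖d‖ ≤ p.lipGrad * (-h.η0) * ‖S.z‖ := by
    have h1 := H.gradient_F_lipschitz hm (S.x + h.η0 • S.z) S.x
    rw [add_sub_cancel_left, norm_smul, ← mul_assoc, Real.norm_eq_abs] at h1
    rcases abs_choice h.η0 with h2 | h2 <;> rw [h2] at h1
    · exact Or.inl h1
    · exact Or.inr h1
  have hdn2 : ‖d‖ ^ 2 ≤ (p.lipGrad * h.η0) ^ 2 * ‖S.z‖ ^ 2 := by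
    rw [← mul_pow]
    rcases hdn with h1 | h1
    · exact pow_le_pow_left₀ (norm_nonneg _) h1 2
    · refine (pow_le_pow_left₀ (norm_nonneg _) h1 2).trans_eq (by ring)
  have hbias := norm_meanDir_sub_gradient_sq_le H hs hs1 hS
  -- Writing the drift inside the part of weight `β₀` lets convexity of the squared norm keep the
  -- coefficient `1 - β₀` on the old error.
  have ew : w = (1 - h.β0) • a + h.β0 • (((1 - h.β0) / h.β0) • d + e') := by
    rw [smul_add, smul_smul, mul_div_cancel₀ _ hβ.ne', hw, ha, hd, he']
    simp only [smul_sub, sub_smul, one_smul]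
    abel
  rw [ew]
  refine (norm_convexComb_sq_le hβ.le hβ1 _ _).trans ?_
  have h1 := norm_add_sq_le_two (((1 - h.β0) / h.β0) • d) e'
  have h2 : ‖((1 - h.β0) / h.β0) • d‖ ^ 2 ≤ (1 / h.β0) ^ 2 * ‖d‖ ^ 2 := by
    rw [norm_smul, mul_pow, Real.norm_of_nonneg (div_nonneg (sub_nonneg.2 hβ1) hβ.le)]
    gcongr
    linarith
  have h3 : h.β0 * ‖((1 - h.β0) / h.β0) • d + e'‖ ^ 2
      ≤ h.β0 * (2 * ((1 / h.β0) ^ 2 * ((p.lipGrad * h.η0) ^ 2 * ‖S.z‖ ^ 2))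
        + 2 * ((m : ℝ)⁻¹ * (3 * p.lipDir ^ 2 * (P.δα S + P.δy S + P.δv S)))) := by
    refine mul_le_mul_of_nonneg_left (h1.trans ?_) hβ.le
    have h4 := mul_le_mul_of_nonneg_left hdn2 (sq_nonneg (1 / h.β0))
    linarith
  have h5 : h.β0 * (2 * ((1 / h.β0) ^ 2 * ((p.lipGrad * h.η0) ^ 2 * ‖S.z‖ ^ 2))
        + 2 * ((m : ℝ)⁻¹ * (3 * p.lipDir ^ 2 * (P.δα S + P.δy S + P.δv S))))
      = 2 / h.β0 * (p.lipGrad * h.η0) ^ 2 * ‖S.z‖ ^ 2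
        + 2 * h.β0 * ((m : ℝ)⁻¹ * (3 * p.lipDir ^ 2 * (P.δα S + P.δy S + P.δv S))) := by
    field_simp
  rw [h5] at h3
  rw [err]
  linarith

end OneStep

end Problem

/-! ### Measurable structure on the state space. -/

section MeasurableState

variable {m dX dA dY : ℕ}

/-- The structure is pulled back from the product, so measurability into states can be checked
componentwise. -/
instance State.instMeasurableSpace : MeasurableSpace (State m dX dA dY) :=
  MeasurableSpace.comap (fun S => (S.x, S.α, S.y, S.v, S.z)) inferInstance

theorem State.measurable_tuple :
    Measurable fun S : State m dX dA dY => (S.x, S.α, S.y, S.v, S.z) :=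
  comap_measurable _

theorem State.measurable_x : Measurable (State.x : State m dX dA dY → _) :=
  State.measurable_tuple.fst

theorem State.measurable_α : Measurable (State.α : State m dX dA dY → _) :=
  State.measurable_tuple.snd.fst

theorem State.measurable_y : Measurable (State.y : State m dX dA dY → _) :=
  State.measurable_tuple.snd.snd.fst

theorem State.measurable_v : Measurable (State.v : State m dX dA dY → _) :=
  State.measurable_tuple.snd.snd.snd.fst

theorem State.measurable_z : Measurable (State.z : State m dX dA dY → _) :=
  State.measurable_tuple.snd.snd.snd.snd

theorem State.measurable_of {R : Type*} [MeasurableSpace R] {Φ : R → State m dX dA dY}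
    (hx : Measurable fun r => (Φ r).x) (hα : Measurable fun r => (Φ r).α)
    (hy : Measurable fun r => (Φ r).y) (hv : Measurable fun r => (Φ r).v)
    (hz : Measurable fun r => (Φ r).z) : Measurable Φ :=
  measurable_comap_iff.2 (hx.prodMk (hα.prodMk (hy.prodMk (hv.prodMk hz))))

end MeasurableState

/-! ### Measurability of the iteration and of the error functions. -/

namespace Problem

variable {m dX dA dY b s : ℕ} {Ξ : Fin m → Type u} [∀ i, MeasurableSpace (Ξ i)]
  {P : Problem m dX dA dY b Ξ} {p : Params} {σ : ℝ}

section StepMeasurable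

theorem measurable_clm_apply {R : Type*} [MeasurableSpace R] {n k : ℕ}
    {L : R → Vec n →L[ℝ] Vec k} {v : R → Vec n} (hL : Measurable L) (hv : Measurable v) :
    Measurable fun r => L r (v r) :=
  (isBoundedBilinearMap_apply (𝕜 := ℝ) (E := Vec n) (F := Vec k)).continuous.measurable.comp
    (hL.prodMk hv)

variable (H : P.StructuralAssumptions p) (O : P.OracleAssumptions σ)

include O in
theorem measurable_gradEstimator :
    Measurable fun r : State m dX dA dY × (Finset (Fin m) × (∀ i, Fin b → Ξ i)) =>
      P.gradEstimator r.2.1 r.2.2 r.1 := by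
  have e : (fun r : State m dX dA dY × (Finset (Fin m) × (∀ i, Fin b → Ξ i)) =>
      P.gradEstimator r.2.1 r.2.2 r.1) = fun r => (r.2.1.card : ℝ)⁻¹ • ∑ i, memInd i r.2.1 •
        (P.gradXfo i r.1.x (r.1.α i) (r.1.y i) (r.2.2 i)
          - P.hessXYgo i r.1.x (r.1.y i) (r.2.2 i) (r.1.v i)) := by
    funext r
    rw [gradEstimator, sum_memInd_smul]
  rw [e]
  have hJ : ∀ k : Finset (Fin m) → ℝ, Measurable
      fun r : State m dX dA dY × (Finset (Fin m) × (∀ i, Fin b → Ξ i)) => k r.2.1 := fun k =>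
    (Measurable.of_discrete (f := k)).comp measurable_snd.fst
  have hB : ∀ i, Measurable
      fun r : State m dX dA dY × (Finset (Fin m) × (∀ i, Fin b → Ξ i)) => r.2.2 i := fun i =>
    (measurable_pi_apply i).comp measurable_snd.snd
  have hx := State.measurable_x (m := m) (dX := dX) (dA := dA) (dY := dY)
  have hα := fun i : Fin m => (measurable_pi_apply i).comp
    (State.measurable_α (m := m) (dX := dX) (dA := dA) (dY := dY))
  have hy := fun i : Fin m => (measurable_pi_apply i).comp
    (State.measurable_y (m := m) (dX := dX) (dA := dA) (dY := dY))
  have hv := fun i : Fin m => (measurable_pi_apply i).comp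
    (State.measurable_v (m := m) (dX := dX) (dA := dA) (dY := dY))
  refine (hJ fun J => (J.card : ℝ)⁻¹).smul (Finset.measurable_fun_sum _ fun i _ =>
    (hJ (memInd i)).smul (Measurable.sub ?_ ?_))
  · exact (O.gradXf_meas i).comp ((hx.comp measurable_fst).prodMk
      (((hα i).comp measurable_fst).prodMk (((hy i).comp measurable_fst).prodMk (hB i))))
  · exact measurable_clm_apply ((O.hessXYg_meas i).comp ((hx.comp measurable_fst).prodMk
      (((hy i).comp measurable_fst).prodMk (hB i)))) ((hv i).comp measurable_fst)

include H O in
theorem measurable_step (h : StepSizes) :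
    Measurable fun r : State m dX dA dY × (Finset (Fin m) × (∀ i, Fin b → Ξ i)) =>
      P.step p.Γ h r.2.1 r.2.2 r.1 := by
  have hB : ∀ i, Measurable
      fun r : State m dX dA dY × (Finset (Fin m) × (∀ i, Fin b → Ξ i)) => r.2.2 i := fun i =>
    (measurable_pi_apply i).comp measurable_snd.snd
  have hset : ∀ i, MeasurableSet
      {r : State m dX dA dY × (Finset (Fin m) × (∀ i, Fin b → Ξ i)) | i ∈ r.2.1} := fun i =>
    measurable_snd.fst (MeasurableSet.of_discrete (s := {J : Finset (Fin m) | i ∈ J}))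
  have hx : Measurable fun r : State m dX dA dY × (Finset (Fin m) × (∀ i, Fin b → Ξ i)) => r.1.x :=
    State.measurable_x.comp measurable_fst
  have hz : Measurable fun r : State m dX dA dY × (Finset (Fin m) × (∀ i, Fin b → Ξ i)) => r.1.z :=
    State.measurable_z.comp measurable_fst
  have hα : ∀ i, Measurable
      fun r : State m dX dA dY × (Finset (Fin m) × (∀ i, Fin b → Ξ i)) => r.1.α i := fun i =>
    (measurable_pi_apply i).comp (State.measurable_α.comp measurable_fst)
  have hy : ∀ i, Measurable
      fun r : State m dX dA dY × (Finset (Fin m) × (∀ i, Fin b → Ξ i)) => r.1.y i := fun i =>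
    (measurable_pi_apply i).comp (State.measurable_y.comp measurable_fst)
  have hv : ∀ i, Measurable
      fun r : State m dX dA dY × (Finset (Fin m) × (∀ i, Fin b → Ξ i)) => r.1.v i := fun i =>
    (measurable_pi_apply i).comp (State.measurable_v.comp measurable_fst)
  have hz' : Measurable fun r : State m dX dA dY × (Finset (Fin m) × (∀ i, Fin b → Ξ i)) =>
      (1 - h.β0) • r.1.z + h.β0 • P.gradEstimator r.2.1 r.2.2 r.1 :=
    (hz.const_smul (1 - h.β0)).add ((measurable_gradEstimator (P := P) O).const_smul h.β0)
  have hxαyB := fun i => (hx.prodMk ((hα i).prodMk ((hy i).prodMk (hB i))))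
  have hxyB := fun i => (hx.prodMk ((hy i).prodMk (hB i)))
  have hα' : ∀ i, Measurable fun r : State m dX dA dY × (Finset (Fin m) × (∀ i, Fin b → Ξ i)) =>
      if i ∈ r.2.1 then
        proj P.A (r.1.α i + h.η1 • P.gradAfo i r.1.x (r.1.α i) (r.1.y i) (r.2.2 i))
      else r.1.α i := fun i => by
    refine Measurable.ite (hset i) ?_ (hα i)
    exact (continuous_proj H.A_nonempty H.A_closed H.A_convex).measurable.comp
      ((hα i).add (((O.gradAf_meas i).comp (hxαyB i)).const_smul h.η1))
  have hy' : ∀ i, Measurable fun r : State m dX dA dY × (Finset (Fin m) × (∀ i, Fin b → Ξ i)) =>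
      if i ∈ r.2.1 then r.1.y i - h.η2 • P.gradYgo i r.1.x (r.1.y i) (r.2.2 i) else r.1.y i :=
    fun i => by
      refine Measurable.ite (hset i) ?_ (hy i)
      exact (hy i).sub (((O.gradYg_meas i).comp (hxyB i)).const_smul h.η2)
  have hv' : ∀ i, Measurable fun r : State m dX dA dY × (Finset (Fin m) × (∀ i, Fin b → Ξ i)) =>
      if i ∈ r.2.1 then
        proj (Metric.closedBall 0 p.Γ) (r.1.v i - h.η3 •
          (P.hessYYgo i r.1.x (r.1.y i) (r.2.2 i) (r.1.v i)
            - P.gradYfo i r.1.x (r.1.α i) (r.1.y i) (r.2.2 i)))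
      else r.1.v i := fun i => by
    have hd : Measurable fun r : State m dX dA dY × (Finset (Fin m) × (∀ i, Fin b → Ξ i)) =>
        P.hessYYgo i r.1.x (r.1.y i) (r.2.2 i) (r.1.v i)
          - P.gradYfo i r.1.x (r.1.α i) (r.1.y i) (r.2.2 i) :=
      (measurable_clm_apply ((O.hessYYg_meas i).comp (hxyB i)) (hv i)).sub
        ((O.gradYf_meas i).comp (hxαyB i))
    refine Measurable.ite (hset i) ?_ (hv i)
    exact (continuous_proj (K := Metric.closedBall (0 : Vec dY) p.Γ)
      ⟨0, Metric.mem_closedBall_self p.Γ_nonneg⟩ Metric.isClosed_closedBall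
      (convex_closedBall _ _)).measurable.comp ((hv i).sub (hd.const_smul h.η3))
  have hx' : Measurable fun r : State m dX dA dY × (Finset (Fin m) × (∀ i, Fin b → Ξ i)) =>
      r.1.x - h.η0 • ((1 - h.β0) • r.1.z + h.β0 • P.gradEstimator r.2.1 r.2.2 r.1) :=
    hx.sub (hz'.const_smul h.η0)
  exact State.measurable_of hx' (measurable_pi_lambda _ hα') (measurable_pi_lambda _ hy')
    (measurable_pi_lambda _ hv') hz'

end StepMeasurable

section StateFunctionsMeasurable

variable (H : P.StructuralAssumptions p)
include H

theorem continuous_gradient_F (hm : 1 ≤ m) : Continuous (gradient P.F) :=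
  (LipschitzWith.of_dist_le_mul (K := ⟨p.lipGrad, p.lipGrad_pos.le⟩) fun x x' => by
    rw [dist_eq_norm, dist_eq_norm]; exact H.gradient_F_lipschitz hm x x').continuous

theorem measurable_devα (η : ℝ) : Measurable (P.devα η) := by
  unfold devα
  exact Finset.measurable_fun_sum _ fun i _ => (((measurable_pi_apply i).comp
    State.measurable_α).sub ((H.continuous_αStar i).measurable.comp
      (State.measurable_x.add (State.measurable_z.const_smul η)))).norm.pow_const 2

theorem measurable_devy (η : ℝ) : Measurable (P.devy η) := by
  unfold devy
  exact Finset.measurable_fun_sum _ fun i _ => (((measurable_pi_apply i).comp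
    State.measurable_y).sub ((H.continuous_yStar i).measurable.comp
      (State.measurable_x.add (State.measurable_z.const_smul η)))).norm.pow_const 2

theorem measurable_devv (η : ℝ) : Measurable (P.devv η) := by
  unfold devv
  exact Finset.measurable_fun_sum _ fun i _ => (((measurable_pi_apply i).comp
    State.measurable_v).sub ((H.continuous_vStar i).measurable.comp
      (State.measurable_x.add (State.measurable_z.const_smul η)))).norm.pow_const 2

theorem measurable_δα : Measurable P.δα := by
  have h := measurable_devα H 0
  unfold devα at h
  unfold δα
  simpa using h

theorem measurable_δy : Measurable P.δy := by
  have h := measurable_devy H 0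
  unfold devy at h
  unfold δy
  simpa using h

theorem measurable_δv : Measurable P.δv := by
  have h := measurable_devv H 0
  unfold devv at h
  unfold δv
  simpa using h

theorem measurable_err (hm : 1 ≤ m) (η : ℝ) : Measurable (P.err η) :=
  (State.measurable_z.sub ((continuous_gradient_F H hm).measurable.comp
      (State.measurable_x.add (State.measurable_z.const_smul η)))).norm.pow_const 2

theorem measurableSet_admissible : MeasurableSet {S : State m dX dA dY | P.AdmissibleInit p.Γ S} := by
  have e : {S : State m dX dA dY | P.AdmissibleInit p.Γ S}
      = ⋂ i, {S | S.α i ∈ P.A} ∩ {S | ‖S.v i‖ ≤ p.Γ} := by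
    ext S; simp [AdmissibleInit]
  rw [e]
  refine MeasurableSet.iInter fun i => MeasurableSet.inter ?_ ?_
  · exact ((measurable_pi_apply i).comp State.measurable_α) H.A_closed.measurableSet
  · exact measurableSet_le ((measurable_pi_apply i).comp State.measurable_v).norm measurable_const

end StateFunctionsMeasurable

/-! ### Independence along the trajectory and passage to expectations. -/

section Trajectory

variable {Ω : Type w} {I : ℕ → Ω → Finset (Fin m)} {B : ℕ → Ω → ∀ i, Fin b → Ξ i}

/-- The `σ`-algebra generated by the draws before time `t`. -/
@[reducible] def past (I : ℕ → Ω → Finset (Fin m)) (B : ℕ → Ω → ∀ i, Fin b → Ξ i) (t : ℕ) :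
    MeasurableSpace Ω :=
  ⨆ k ∈ Set.Iio t, MeasurableSpace.comap (fun ω => (I k ω, B k ω)) inferInstance

variable (H : P.StructuralAssumptions p) (O : P.OracleAssumptions σ) (h : StepSizes)
  {S₀ : State m dX dA dY}

include H O in
theorem measurable_iter_past (t : ℕ) : Measurable[past I B t] (P.iter p.Γ h I B S₀ t) := by
  induction t with
  | zero => exact measurable_const
  | succ t ih =>
    have h1 : Measurable[past I B (t + 1)] (P.iter p.Γ h I B S₀ t) :=
      ih.mono (biSup_mono fun k hk => Set.mem_Iio.2 ((Set.mem_Iio.1 hk).trans t.lt_succ_self)) le_rfl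
    have h2 : Measurable[past I B (t + 1)] (fun ω => (I t ω, B t ω)) := by
      refine Measurable.mono (comap_measurable _) ?_ le_rfl
      exact le_biSup (fun k => MeasurableSpace.comap (fun ω => (I k ω, B k ω)) inferInstance)
        (Set.mem_Iio.2 t.lt_succ_self)
    exact (measurable_step H O h).comp (h1.prodMk h2)

include H in
theorem admissible_iter (hS₀ : P.AdmissibleInit p.Γ S₀) (t : ℕ) (ω : Ω) :
    P.AdmissibleInit p.Γ (P.iter p.Γ h I B S₀ t ω) := by
  induction t with
  | zero => exact hS₀
  | succ t ih => exact admissible_step H h _ _ ih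

end Trajectory

section Trajectory

variable {Ω : Type w} [mΩ : MeasurableSpace Ω] {μ : Measure Ω}
  {I : ℕ → Ω → Finset (Fin m)} {B : ℕ → Ω → ∀ i, Fin b → Ξ i}
  (H : P.StructuralAssumptions p) (O : P.OracleAssumptions σ) (h : StepSizes)
  {S₀ : State m dX dA dY} (hI : P.IsSampling μ s I B)

include hI in
theorem IsSampling.measurable_pair (t : ℕ) : Measurable fun ω => (I t ω, B t ω) :=
  (hI.meas_I t).prodMk (hI.meas_B t)

include hI in
theorem past_le (t : ℕ) : past I B t ≤ mΩ :=
  iSup₂_le fun k _ => (IsSampling.measurable_pair hI k).comap_le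

include H O hI in
theorem measurable_iter (t : ℕ) : Measurable (P.iter p.Γ h I B S₀ t) :=
  (measurable_iter_past H O h t).mono (past_le hI t) le_rfl

include H O hI in
-- The state at time `t` is measurable with respect to the draws with index below `t`, and the index
-- sets `Set.Iio t` and `{t}` are disjoint.
theorem indepFun_iter (t : ℕ) :
    IndepFun (P.iter p.Γ h I B S₀ t) (fun ω => (I t ω, B t ω)) μ := by
  have h1 := indep_iSup_of_disjoint (fun k => (IsSampling.measurable_pair hI k).comap_le)
    ((iIndepFun_iff_iIndep _ _ _).1 hI.indep_steps) (S := Set.Iio t) (T := {t}) (by simp)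
  rw [IndepFun_iff_Indep]
  refine indep_of_indep_of_le_left (indep_of_indep_of_le_right h1 ?_)
    (measurable_iter_past H O h t).comap_le
  simp

include hI in
theorem map_pair [IsProbabilityMeasure μ] (t : ℕ) :
    μ.map (fun ω => (I t ω, B t ω)) = (subsetLaw m s).prod (μ.map (B t)) := by
  rw [(indepFun_iff_map_prod_eq_prod_map_map (hI.meas_I t).aemeasurable
    (hI.meas_B t).aemeasurable).1 (hI.indep_I_B t), hI.law_I t, subsetLaw]

include hI in
theorem map_batch (t : ℕ) (i : Fin m) :
    (μ.map (B t)).map (fun B => B i) = P.batchLaw i := by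
  rw [Measure.map_map (measurable_pi_apply i) (hI.meas_B t), ← hI.law_B t i]
  rfl

include H O hI in
-- By independence the joint law of state and draw is a product, so a bound for each fixed
-- admissible state integrates by Fubini. This stands in for conditional expectations.
theorem integral_iter_succ_le [IsProbabilityMeasure μ] (hs : s ≤ m) (hS₀ : P.AdmissibleInit p.Γ S₀) (t : ℕ)
    {Φ Ψ : State m dX dA dY → ℝ} (hΦ : Measurable Φ) (hΨ : Measurable Ψ) (hΦ0 : ∀ S, 0 ≤ Φ S)
    (hΨi : Integrable (fun ω => Ψ (P.iter p.Γ h I B S₀ t ω)) μ)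
    (hstep : ∀ S, P.AdmissibleInit p.Γ S →
      Integrable (fun q : Finset (Fin m) × (∀ i, Fin b → Ξ i) => Φ (P.step p.Γ h q.1 q.2 S))
        ((subsetLaw m s).prod (μ.map (B t))) ∧
      ∫ q : Finset (Fin m) × (∀ i, Fin b → Ξ i), Φ (P.step p.Γ h q.1 q.2 S)
        ∂((subsetLaw m s).prod (μ.map (B t))) ≤ Ψ S) :
    Integrable (fun ω => Φ (P.iter p.Γ h I B S₀ (t + 1) ω)) μ ∧
    ∫ ω, Φ (P.iter p.Γ h I B S₀ (t + 1) ω) ∂μ ≤ ∫ ω, Ψ (P.iter p.Γ h I B S₀ t ω) ∂μ := by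
  have hU := isProbabilityMeasure_subsetLaw hs
  have hBt : IsProbabilityMeasure (μ.map (B t)) :=
    Measure.isProbabilityMeasure_map (hI.meas_B t).aemeasurable
  have hit := measurable_iter H O h hI (S₀ := S₀) t
  have hpair := IsSampling.measurable_pair hI t
  have hlaw : IsProbabilityMeasure (μ.map (P.iter p.Γ h I B S₀ t)) :=
    Measure.isProbabilityMeasure_map hit.aemeasurable
  have hmap := (indepFun_iff_map_prod_eq_prod_map_map hit.aemeasurable hpair.aemeasurable).1
    (indepFun_iter H O h hI (S₀ := S₀) t)
  rw [map_pair hI t] at hmap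
  set Λ := μ.map (P.iter p.Γ h I B S₀ t) with hΛ
  set ν := (subsetLaw m s).prod (μ.map (B t)) with hν
  have hmeas : Measurable fun r : State m dX dA dY × (Finset (Fin m) × (∀ i, Fin b → Ξ i)) =>
      Φ (P.step p.Γ h r.2.1 r.2.2 r.1) := hΦ.comp (measurable_step H O h)
  have hadm : ∀ᵐ S ∂Λ, P.AdmissibleInit p.Γ S :=
    (ae_map_iff hit.aemeasurable (measurableSet_admissible H)).2
      (Filter.Eventually.of_forall fun ω => admissible_iter H h hS₀ t ω)
  have hΨΛ : Integrable Ψ Λ := (integrable_map_measure hΨ.aestronglyMeasurable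
    hit.aemeasurable).2 hΨi
  have hint : Integrable (fun r : State m dX dA dY × (Finset (Fin m) × (∀ i, Fin b → Ξ i)) =>
      Φ (P.step p.Γ h r.2.1 r.2.2 r.1)) (Λ.prod ν) := by
    rw [integrable_prod_iff hmeas.aestronglyMeasurable]
    -- Since `Φ` is nonnegative, the inner integral of its norm is the inner integral itself, and
    -- `Ψ` dominates it.
    refine ⟨hadm.mono fun S hS => (hstep S hS).1, hΨΛ.mono' ?_ (hadm.mono fun S hS => ?_)⟩
    · exact hmeas.norm.stronglyMeasurable.integral_prod_right'.aestronglyMeasurable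
    · simp_rw [Real.norm_of_nonneg (hΦ0 _)]
      rw [Real.norm_of_nonneg (integral_nonneg fun _ => hΦ0 _)]
      exact (hstep S hS).2
  have hcomp : Integrable (fun r : State m dX dA dY × (Finset (Fin m) × (∀ i, Fin b → Ξ i)) =>
      Φ (P.step p.Γ h r.2.1 r.2.2 r.1))
      (μ.map fun ω => (P.iter p.Γ h I B S₀ t ω, (I t ω, B t ω))) := by rwa [hmap]
  refine ⟨(integrable_map_measure hmeas.aestronglyMeasurable
    (hit.prodMk hpair).aemeasurable).1 hcomp, ?_⟩
  calc ∫ ω, Φ (P.iter p.Γ h I B S₀ (t + 1) ω) ∂μ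
      = ∫ r, Φ (P.step p.Γ h r.2.1 r.2.2 r.1)
        ∂(μ.map fun ω => (P.iter p.Γ h I B S₀ t ω, (I t ω, B t ω))) :=
        (integral_map (hit.prodMk hpair).aemeasurable hmeas.aestronglyMeasurable).symm
    _ = ∫ S, ∫ q : Finset (Fin m) × (∀ i, Fin b → Ξ i), Φ (P.step p.Γ h q.1 q.2 S) ∂ν ∂Λ := by
        rw [hmap, integral_prod _ hint]
    _ ≤ ∫ S, Ψ S ∂Λ :=
        integral_mono_ae hint.integral_prod_left hΨΛ (hadm.mono fun S hS => (hstep S hS).2)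
    _ = _ := integral_map hit.aemeasurable hΨ.aestronglyMeasurable

include H O in
-- The random index is resolved by the indicators of `τ = t`, each independent of the corresponding
-- iterate. The shift `k` covers both `x_τ` and `z_{τ+1}`.
theorem integral_randomIndex {T : ℕ} {τ : Ω → ℕ} (hτ : IsRandomIndex μ T τ I B) (k : ℕ)
    {Φ : State m dX dA dY → ℝ} (hΦ : Measurable Φ)
    (hi : ∀ t, Integrable (fun ω => Φ (P.iter p.Γ h I B S₀ t ω)) μ) :
    Integrable (fun ω => Φ (P.iter p.Γ h I B S₀ (τ ω + k) ω)) μ ∧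
    ∫ ω, Φ (P.iter p.Γ h I B S₀ (τ ω + k) ω) ∂μ
      = ((T : ℝ) + 1)⁻¹ * ∑ t ∈ Finset.range (T + 1), ∫ ω, Φ (P.iter p.Γ h I B S₀ (t + k) ω) ∂μ := by
  set ind : ℕ → ℕ → ℝ := fun t n => if n = t then 1 else 0 with hind
  have hτle : ∀ᵐ ω ∂μ, τ ω ∈ Set.Iic T := by
    have h1 : ∀ᵐ n ∂(μ.map τ), n ∈ Set.Iic T := by
      rw [hτ.law]
      exact ae_cond_mem measurableSet_Iic
    exact ae_of_ae_map hτ.meas.aemeasurable h1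
  have hprob : ∀ t ∈ Finset.range (T + 1), ∫ ω, ind t (τ ω) ∂μ = ((T : ℝ) + 1)⁻¹ := by
    intro t ht
    rw [← integral_map (φ := τ) (f := ind t) hτ.meas.aemeasurable
      (Measurable.of_discrete).aestronglyMeasurable, hτ.law]
    have e : Set.Iic T = ((Finset.range (T + 1) : Finset ℕ) : Set ℕ) := by
      ext n; simp
    unfold uniformOn ProbabilityTheory.cond
    rw [integral_smul_measure, e, setIntegral_finset _ (by
        have : IsFiniteMeasure (Measure.count.restrict ((Finset.range (T + 1) : Finset ℕ) : Set ℕ)) :=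
          ⟨by rw [Measure.restrict_apply_univ, Measure.count_apply_finset]; simp⟩
        refine Integrable.of_bound (Measurable.of_discrete).aestronglyMeasurable 1
          (Filter.Eventually.of_forall fun n => ?_)
        simp only [hind]; split_ifs <;> simp),
      Measure.count_apply_finset]
    have e2 : ((T : ENNReal) + 1).toReal = T + 1 := by
      rw [ENNReal.toReal_add (by simp) (by simp)]; simp
    simp [Measure.real, hind, Finset.mem_range.1 ht, e2]
  have hindep : ∀ t, IndepFun (fun ω => ind t (τ ω)) (fun ω => Φ (P.iter p.Γ h I B S₀ (t + k) ω)) μ := by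
    intro t
    have hle : past I B (t + k) ≤ MeasurableSpace.comap (fun ω t => (I t ω, B t ω)) inferInstance := by
      refine iSup₂_le fun j _ => ?_
      have : Measurable[MeasurableSpace.comap (fun ω t => (I t ω, B t ω)) inferInstance]
          fun ω => (I j ω, B j ω) :=
        (measurable_pi_apply j).comp (comap_measurable (fun ω t => (I t ω, B t ω)))
      exact this.comap_le
    have h1 : IndepFun τ (P.iter p.Γ h I B S₀ (t + k)) μ := by
      rw [IndepFun_iff_Indep]
      exact indep_of_indep_of_le_right ((IndepFun_iff_Indep _ _ _).1 hτ.indep)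
        ((measurable_iter_past H O h (t + k)).comap_le.trans hle)
    exact h1.comp (φ := ind t) (ψ := Φ) Measurable.of_discrete hΦ
  have hindm : ∀ t, Measurable fun ω => ind t (τ ω) := fun t =>
    (Measurable.of_discrete (f := ind t)).comp hτ.meas
  have hterm : ∀ t, Integrable (fun ω => ind t (τ ω) * Φ (P.iter p.Γ h I B S₀ (t + k) ω)) μ :=
    fun t => (hi (t + k)).bdd_mul (c := 1) (hindm t).aestronglyMeasurable
      (Filter.Eventually.of_forall fun ω => by simp only [hind]; split_ifs <;> simp)
  have hsum : (fun ω => Φ (P.iter p.Γ h I B S₀ (τ ω + k) ω)) =ᵐ[μ]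
      fun ω => ∑ t ∈ Finset.range (T + 1), ind t (τ ω) * Φ (P.iter p.Γ h I B S₀ (t + k) ω) := by
    filter_upwards [hτle] with ω hω
    rw [Finset.sum_eq_single (τ ω)]
    · simp [hind]
    · intro t _ ht
      simp [hind, ht.symm]
    · intro hn
      exact absurd (Finset.mem_range.2 (Nat.lt_succ_of_le hω)) hn
  refine ⟨(integrable_congr hsum).2 (integrable_finsetSum _ fun t _ => hterm t), ?_⟩
  rw [integral_congr_ae hsum, integral_finsetSum _ fun t _ => hterm t, Finset.mul_sum]
  refine Finset.sum_congr rfl fun t ht => ?_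
  rw [← hprob t ht]
  exact (hindep t).integral_mul_eq_mul_integral (hindm t).aestronglyMeasurable (hi (t + k)).1

end Trajectory

end Problem

/-! ### Scalar recursions and the expected error recursions. -/

/-- Telescoping leaves `u T` unspent on the left; since `θ ≤ 1` it pays for the extra summand `θ * u
T`. That is why the left sum has one more term than the right one. -/
theorem mul_sum_le_of_contraction {u r : ℕ → ℝ} {θ : ℝ} (hθ1 : θ ≤ 1) (hu : ∀ t, 0 ≤ u t)
    (h : ∀ t, u (t + 1) ≤ (1 - θ) * u t + r t) (T : ℕ) :
    θ * ∑ t ∈ Finset.range (T + 1), u t ≤ u 0 + ∑ t ∈ Finset.range T, r t := by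
  have key : θ * ∑ t ∈ Finset.range T, u t + u T ≤ u 0 + ∑ t ∈ Finset.range T, r t := by
    induction T with
    | zero => simp
    | succ T ih =>
      rw [Finset.sum_range_succ, Finset.sum_range_succ]
      linarith [h T]
  rw [Finset.sum_range_succ]
  nlinarith [hu T]

/-- The recursion contracts at rate `2θ` and Young's inequality for the drift uses up `θ`: `(1 +
θ)(1 - 2θ) ≤ 1 - θ`. The remaining factors are rounded by `1 + θ ≤ 2` and `1 + 1/θ ≤ 2/θ`. -/
theorem contraction_combine {θ a r q : ℝ} (hθ : 0 < θ) (hθ1 : θ ≤ 1) (ha : 0 ≤ a) (hr : 0 ≤ r)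
    (hq : 0 ≤ q) :
    (1 + θ) * ((1 - 2 * θ) * a + r) + (1 + 1 / θ) * q ≤ (1 - θ) * a + (2 * r + 2 / θ * q) := by
  have h1 : 1 ≤ 1 / θ := by rw [le_div_iff₀ hθ]; linarith
  have h2 : 2 / θ = 1 / θ + 1 / θ := by ring
  rw [h2]
  nlinarith [mul_nonneg (sub_nonneg.2 hθ1) hr, mul_nonneg (sub_nonneg.2 h1) hq,
    mul_nonneg (sq_nonneg θ) ha]

/-- Young's inequality together with the Lipschitz solution map moves the target from the previous
point to the current one; the displacement is `η • z`. -/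
theorem sum_norm_sub_sq_le {m n k : ℕ} {star : Fin m → Vec n → Vec k} {L : ℝ}
    (hL : ∀ i x x', ‖star i x - star i x'‖ ≤ L * ‖x - x'‖) {θ : ℝ} (hθ : 0 < θ) (η : ℝ)
    (a : Fin m → Vec k) (x z : Vec n) :
    ∑ i, ‖a i - star i x‖ ^ 2 ≤ (1 + θ) * ∑ i, ‖a i - star i (x + η • z)‖ ^ 2
      + (1 + 1 / θ) * (m * (L * η) ^ 2 * ‖z‖ ^ 2) := by
  have e : (m : ℝ) * (L * η) ^ 2 * ‖z‖ ^ 2 = ∑ _i : Fin m, (L * η) ^ 2 * ‖z‖ ^ 2 := by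
    rw [Finset.sum_const, Finset.card_univ, Fintype.card_fin, nsmul_eq_mul]; ring
  rw [e, Finset.mul_sum, Finset.mul_sum, ← Finset.sum_add_distrib]
  refine Finset.sum_le_sum fun i _ => ?_
  have h1 := norm_add_sq_le_mul hθ (a i - star i (x + η • z)) (star i (x + η • z) - star i x)
  rw [sub_add_sub_cancel] at h1
  refine h1.trans (add_le_add le_rfl (mul_le_mul_of_nonneg_left ?_ (by positivity)))
  have h2 := hL i (x + η • z) x
  rw [add_sub_cancel_left, norm_smul, ← mul_assoc] at h2
  refine (pow_le_pow_left₀ (norm_nonneg _) h2 2).trans_eq ?_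
  rw [mul_pow, mul_pow, mul_pow, Real.norm_eq_abs, sq_abs]

namespace Problem

variable {m dX dA dY b s : ℕ} {Ξ : Fin m → Type u} [∀ i, MeasurableSpace (Ξ i)]
  {P : Problem m dX dA dY b Ξ} {p : Params} {σ : ℝ}

theorem δα_nonneg (S : State m dX dA dY) : 0 ≤ P.δα S := Finset.sum_nonneg fun _ _ => sq_nonneg _
theorem δy_nonneg (S : State m dX dA dY) : 0 ≤ P.δy S := Finset.sum_nonneg fun _ _ => sq_nonneg _
theorem δv_nonneg (S : State m dX dA dY) : 0 ≤ P.δv S := Finset.sum_nonneg fun _ _ => sq_nonneg _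
theorem devα_nonneg (η : ℝ) (S : State m dX dA dY) : 0 ≤ P.devα η S :=
  Finset.sum_nonneg fun _ _ => sq_nonneg _
theorem devy_nonneg (η : ℝ) (S : State m dX dA dY) : 0 ≤ P.devy η S :=
  Finset.sum_nonneg fun _ _ => sq_nonneg _
theorem devv_nonneg (η : ℝ) (S : State m dX dA dY) : 0 ≤ P.devv η S :=
  Finset.sum_nonneg fun _ _ => sq_nonneg _
theorem err_nonneg (η : ℝ) (S : State m dX dA dY) : 0 ≤ P.err η S := sq_nonneg _

/-- As `∇F` is bounded, the second moment of the momentum is controlled by that of its error; the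
induction for integrability rests on this. -/
theorem norm_z_sq_le (H : P.StructuralAssumptions p) (hm : 1 ≤ m) (η : ℝ) (S : State m dX dA dY) :
    ‖S.z‖ ^ 2 ≤ 2 * P.err η S + 2 * p.boundDir ^ 2 := by
  have h1 := norm_add_sq_le_two (S.z - gradient P.F (S.x + η • S.z)) (gradient P.F (S.x + η • S.z))
  rw [sub_add_cancel] at h1
  have h2 := pow_le_pow_left₀ (norm_nonneg _) (H.norm_gradient_F_le hm (S.x + η • S.z)) 2
  rw [err]
  exact h1.trans (by unfold Params.boundDir; linarith)

/-- The assumptions under which the algorithm is analysed. -/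
structure Run {Ω : Type w} [MeasurableSpace Ω] (P : Problem m dX dA dY b Ξ) (p : Params) (σ : ℝ)
    (s : ℕ) (μ : Measure Ω) (I : ℕ → Ω → Finset (Fin m)) (B : ℕ → Ω → ∀ i, Fin b → Ξ i)
    (S₀ : State m dX dA dY) (h : StepSizes) : Prop where
  structural : P.StructuralAssumptions p
  oracle : P.OracleAssumptions σ
  sampling : P.IsSampling μ s I B
  init : P.AdmissibleInit p.Γ S₀
  s_pos : 1 ≤ s
  s_le : s ≤ m
  b_pos : 1 ≤ b
  η0_pos : 0 < h.η0
  η1_pos : 0 < h.η1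
  η2_pos : 0 < h.η2
  η3_pos : 0 < h.η3
  β0_pos : 0 < h.β0
  β0_le_one : h.β0 ≤ 1
  η1_le : h.η1 ≤ p.μf / p.Lf ^ 2
  η1_le' : h.η1 ≤ 1 / p.μf
  η2_le : h.η2 ≤ p.μg / p.Lg ^ 2
  η3_le : h.η3 ≤ p.μg / p.Lg ^ 2
  η3_le' : h.η3 ≤ 1 / p.μg

namespace Run

variable {Ω : Type w} [mΩ : MeasurableSpace Ω] {μ : Measure Ω}
  {I : ℕ → Ω → Finset (Fin m)} {B : ℕ → Ω → ∀ i, Fin b → Ξ i} {S₀ : State m dX dA dY}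
  {h : StepSizes} (R : Run P p σ s μ I B S₀ h)
include R

theorem m_pos : 1 ≤ m := R.s_pos.trans R.s_le

/-- Summed descent along a trajectory. -/
theorem sum_gradient_sq_le (hη : h.η0 * p.lipGrad ≤ 1 / 8) (T : ℕ) (ω : Ω) :
    ∑ t ∈ Finset.range T, ‖gradient P.F (P.iter p.Γ h I B S₀ t ω).x‖ ^ 2
      ≤ 2 / h.η0 * (P.F S₀.x - P.F (P.iter p.Γ h I B S₀ T ω).x)
        + ∑ t ∈ Finset.range T, P.err h.η0 (P.iter p.Γ h I B S₀ (t + 1) ω)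
        - 3 / 4 * ∑ t ∈ Finset.range T, ‖(P.iter p.Γ h I B S₀ (t + 1) ω).z‖ ^ 2 := by
  induction T with
  | zero => simp [iter]
  | succ T ih =>
    rw [Finset.sum_range_succ, Finset.sum_range_succ, Finset.sum_range_succ]
    set S := P.iter p.Γ h I B S₀ T ω
    set S' := P.iter p.Γ h I B S₀ (T + 1) ω with hS'
    -- Hence `err` of the new state compares the new momentum with the gradient at the old point, as
    -- the descent step requires.
    have hx : S'.x + h.η0 • S'.z = S.x := step_x_add _ _ _ _ _
    have hx' : S.x + (-h.η0) • S'.z = S'.x := by rw [← hx, neg_smul]; abel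
    have h1 := R.structural.F_add_le R.m_pos S.x ((-h.η0) • S'.z)
    have hη0 := R.η0_pos
    rw [hx', real_inner_smul_right, norm_smul, mul_pow, norm_neg, Real.norm_of_nonneg hη0.le] at h1
    -- Polarisation trades the inner product for the momentum error and leaves `-‖z‖²`; the
    -- second-order term uses a quarter of it, hence `3 / 4`.
    have h2 : P.err h.η0 S' = ‖S'.z‖ ^ 2 - 2 * inner ℝ (gradient P.F S.x) S'.z
        + ‖gradient P.F S.x‖ ^ 2 := by
      rw [err, hx, norm_sub_sq_real, real_inner_comm]
    have h3 : p.lipGrad * (h.η0 ^ 2 * ‖S'.z‖ ^ 2) ≤ h.η0 / 8 * ‖S'.z‖ ^ 2 := by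
      nlinarith [mul_le_mul_of_nonneg_right hη (mul_nonneg hη0.le (sq_nonneg ‖S'.z‖))]
    have h4 : h.η0 / 2 * (‖gradient P.F S.x‖ ^ 2 - P.err h.η0 S' + 3 / 4 * ‖S'.z‖ ^ 2)
        ≤ P.F S.x - P.F S'.x := by
      rw [h2]; linarith
    have h5 : ‖gradient P.F S.x‖ ^ 2 - P.err h.η0 S' + 3 / 4 * ‖S'.z‖ ^ 2
        ≤ 2 / h.η0 * (P.F S.x - P.F S'.x) := by
      rw [div_mul_eq_mul_div (2 : ℝ), le_div_iff₀ hη0]; linarith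
    have h6 : 2 / h.η0 * (P.F S₀.x - P.F S'.x)
        = 2 / h.η0 * (P.F S₀.x - P.F S.x) + 2 / h.η0 * (P.F S.x - P.F S'.x) := by ring
    rw [h6]
    linarith

variable [IsProbabilityMeasure μ]

theorem expect_succ (t : ℕ)
    {Φ Ψ : State m dX dA dY → ℝ} (hΦ : Measurable Φ) (hΨ : Measurable Ψ) (hΦ0 : ∀ S, 0 ≤ Φ S)
    (hΨi : Integrable (fun ω => Ψ (P.iter p.Γ h I B S₀ t ω)) μ)
    (hstep : ∀ ρ : Measure (∀ i, Fin b → Ξ i), IsProbabilityMeasure ρ →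
      (∀ i, ρ.map (fun B => B i) = P.batchLaw i) → ∀ S, P.AdmissibleInit p.Γ S →
      Integrable (fun q : Finset (Fin m) × (∀ i, Fin b → Ξ i) => Φ (P.step p.Γ h q.1 q.2 S))
        ((subsetLaw m s).prod ρ) ∧
      ∫ q : Finset (Fin m) × (∀ i, Fin b → Ξ i), Φ (P.step p.Γ h q.1 q.2 S)
        ∂((subsetLaw m s).prod ρ) ≤ Ψ S) :
    Integrable (fun ω => Φ (P.iter p.Γ h I B S₀ (t + 1) ω)) μ ∧
    ∫ ω, Φ (P.iter p.Γ h I B S₀ (t + 1) ω) ∂μ ≤ ∫ ω, Ψ (P.iter p.Γ h I B S₀ t ω) ∂μ :=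
  integral_iter_succ_le R.structural R.oracle h R.sampling R.s_le R.init t hΦ hΨ hΦ0 hΨi
    (hstep _ (Measure.isProbabilityMeasure_map (R.sampling.meas_B t).aemeasurable)
      (map_batch R.sampling t))

theorem devα_succ (t : ℕ) (ha : Integrable (fun ω => P.δα (P.iter p.Γ h I B S₀ t ω)) μ)
    (hy : Integrable (fun ω => P.δy (P.iter p.Γ h I B S₀ t ω)) μ) :
    Integrable (fun ω => P.devα h.η0 (P.iter p.Γ h I B S₀ (t + 1) ω)) μ ∧
    ∫ ω, P.devα h.η0 (P.iter p.Γ h I B S₀ (t + 1) ω) ∂μ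
      ≤ (1 - s * h.η1 * p.μf / (2 * m)) * ∫ ω, P.δα (P.iter p.Γ h I B S₀ t ω) ∂μ
        + s / m * (3 * h.η1 / p.μf * p.Lf ^ 2) * ∫ ω, P.δy (P.iter p.Γ h I B S₀ t ω) ∂μ
        + s * (h.η1 ^ 2 * (σ ^ 2 / b)) := by
  have hi1 := (ha.const_mul (1 - s * h.η1 * p.μf / (2 * m))).add
    (hy.const_mul (s / m * (3 * h.η1 / p.μf * p.Lf ^ 2)))
  have h1 := R.expect_succ t (Φ := P.devα h.η0) (Ψ := fun S =>
      (1 - s * h.η1 * p.μf / (2 * m)) * P.δα S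
        + s / m * (3 * h.η1 / p.μf * p.Lf ^ 2) * P.δy S + s * (h.η1 ^ 2 * (σ ^ 2 / b)))
    (measurable_devα R.structural _)
    ((((measurable_δα R.structural).const_mul _).add
      ((measurable_δy R.structural).const_mul _)).add measurable_const)
    (devα_nonneg _) (hi1.add (integrable_const _))
    (fun ρ _ hρ S hS => devα_step_le R.structural R.oracle hρ R.s_le R.m_pos hS h R.η1_pos R.η1_le
      R.η1_le')
  refine ⟨h1.1, h1.2.trans_eq ?_⟩
  have e := integral_add hi1 (integrable_const (μ := μ) (s * (h.η1 ^ 2 * (σ ^ 2 / b))))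
  simp only [Pi.add_apply] at e
  rw [e, integral_add (ha.const_mul _) (hy.const_mul _), integral_const_mul, integral_const_mul]
  simp

theorem devy_succ (t : ℕ) (hy : Integrable (fun ω => P.δy (P.iter p.Γ h I B S₀ t ω)) μ) :
    Integrable (fun ω => P.devy h.η0 (P.iter p.Γ h I B S₀ (t + 1) ω)) μ ∧
    ∫ ω, P.devy h.η0 (P.iter p.Γ h I B S₀ (t + 1) ω) ∂μ
      ≤ (1 - s * h.η2 * p.μg / m) * ∫ ω, P.δy (P.iter p.Γ h I B S₀ t ω) ∂μ
        + s * (h.η2 ^ 2 * (σ ^ 2 / b)) := by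
  have hi1 := hy.const_mul (1 - s * h.η2 * p.μg / m)
  have h1 := R.expect_succ t (Φ := P.devy h.η0) (Ψ := fun S =>
      (1 - s * h.η2 * p.μg / m) * P.δy S + s * (h.η2 ^ 2 * (σ ^ 2 / b)))
    (measurable_devy R.structural _)
    (((measurable_δy R.structural).const_mul _).add measurable_const)
    (devy_nonneg _) (hi1.add (integrable_const _))
    (fun ρ _ hρ S _ => devy_step_le R.structural R.oracle hρ R.s_le R.m_pos h R.η2_pos R.η2_le)
  refine ⟨h1.1, h1.2.trans_eq ?_⟩
  rw [integral_add hi1 (integrable_const _), integral_const_mul]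
  simp

theorem devv_succ (t : ℕ) (ha : Integrable (fun ω => P.δα (P.iter p.Γ h I B S₀ t ω)) μ)
    (hy : Integrable (fun ω => P.δy (P.iter p.Γ h I B S₀ t ω)) μ)
    (hv : Integrable (fun ω => P.δv (P.iter p.Γ h I B S₀ t ω)) μ) :
    Integrable (fun ω => P.devv h.η0 (P.iter p.Γ h I B S₀ (t + 1) ω)) μ ∧
    ∫ ω, P.devv h.η0 (P.iter p.Γ h I B S₀ (t + 1) ω) ∂μ
      ≤ (1 - s * h.η3 * p.μg / (2 * m)) * ∫ ω, P.δv (P.iter p.Γ h I B S₀ t ω) ∂μ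
        + s / m * (6 * h.η3 / p.μg * (p.Lf + p.Lgyy * p.Γ) ^ 2)
          * (∫ ω, P.δα (P.iter p.Γ h I B S₀ t ω) ∂μ + ∫ ω, P.δy (P.iter p.Γ h I B S₀ t ω) ∂μ)
        + s * (h.η3 ^ 2 * (2 * (1 + p.Γ ^ 2) * (σ ^ 2 / b))) := by
  have hi0 := (ha.add hy).const_mul (s / m * (6 * h.η3 / p.μg * (p.Lf + p.Lgyy * p.Γ) ^ 2))
  have hi1 := (hv.const_mul (1 - s * h.η3 * p.μg / (2 * m))).add hi0
  have h1 := R.expect_succ t (Φ := P.devv h.η0) (Ψ := fun S =>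
      (1 - s * h.η3 * p.μg / (2 * m)) * P.δv S
        + s / m * (6 * h.η3 / p.μg * (p.Lf + p.Lgyy * p.Γ) ^ 2) * (P.δα S + P.δy S)
        + s * (h.η3 ^ 2 * (2 * (1 + p.Γ ^ 2) * (σ ^ 2 / b))))
    (measurable_devv R.structural _)
    ((((measurable_δv R.structural).const_mul _).add
      (((measurable_δα R.structural).add (measurable_δy R.structural)).const_mul _)).add
        measurable_const)
    (devv_nonneg _) (hi1.add (integrable_const _))
    (fun ρ _ hρ S hS => devv_step_le R.structural R.oracle hρ R.s_le R.m_pos hS h R.η3_pos R.η3_le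
      R.η3_le')
  refine ⟨h1.1, h1.2.trans_eq ?_⟩
  have e := integral_add hi1
    (integrable_const (μ := μ) (s * (h.η3 ^ 2 * (2 * (1 + p.Γ ^ 2) * (σ ^ 2 / b)))))
  have e2 := integral_add (hv.const_mul (1 - s * h.η3 * p.μg / (2 * m))) hi0
  simp only [Pi.add_apply] at e e2
  rw [e, e2, integral_const_mul, integral_const_mul, integral_add ha hy]
  simp

theorem err_succ (t : ℕ) (ha : Integrable (fun ω => P.δα (P.iter p.Γ h I B S₀ t ω)) μ)
    (hy : Integrable (fun ω => P.δy (P.iter p.Γ h I B S₀ t ω)) μ)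
    (hv : Integrable (fun ω => P.δv (P.iter p.Γ h I B S₀ t ω)) μ)
    (hz : Integrable (fun ω => ‖(P.iter p.Γ h I B S₀ t ω).z‖ ^ 2) μ)
    (he : Integrable (fun ω => P.err h.η0 (P.iter p.Γ h I B S₀ t ω)) μ) :
    Integrable (fun ω => P.err h.η0 (P.iter p.Γ h I B S₀ (t + 1) ω)) μ ∧
    ∫ ω, P.err h.η0 (P.iter p.Γ h I B S₀ (t + 1) ω) ∂μ
      ≤ (1 - h.β0) * ∫ ω, P.err h.η0 (P.iter p.Γ h I B S₀ t ω) ∂μ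
        + 2 / h.β0 * (p.lipGrad * h.η0) ^ 2 * ∫ ω, ‖(P.iter p.Γ h I B S₀ t ω).z‖ ^ 2 ∂μ
        + 2 * h.β0 * ((m : ℝ)⁻¹ * (3 * p.lipDir ^ 2
          * (∫ ω, P.δα (P.iter p.Γ h I B S₀ t ω) ∂μ + ∫ ω, P.δy (P.iter p.Γ h I B S₀ t ω) ∂μ
            + ∫ ω, P.δv (P.iter p.Γ h I B S₀ t ω) ∂μ)))
        + h.β0 ^ 2 * (p.varDir σ / (min s b : ℕ)) := by
  have hi0 := ((((ha.add hy).add hv).const_mul (3 * p.lipDir ^ 2)).const_mul (m : ℝ)⁻¹).const_mul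
    (2 * h.β0)
  have hi2 := (he.const_mul (1 - h.β0)).add
    (hz.const_mul (2 / h.β0 * (p.lipGrad * h.η0) ^ 2))
  have hi1 := hi2.add hi0
  have h1 := R.expect_succ t (Φ := P.err h.η0) (Ψ := fun S =>
      (1 - h.β0) * P.err h.η0 S + 2 / h.β0 * (p.lipGrad * h.η0) ^ 2 * ‖S.z‖ ^ 2
        + 2 * h.β0 * ((m : ℝ)⁻¹ * (3 * p.lipDir ^ 2 * (P.δα S + P.δy S + P.δv S)))
        + h.β0 ^ 2 * (p.varDir σ / (min s b : ℕ)))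
    (measurable_err R.structural R.m_pos _)
    (((((measurable_err R.structural R.m_pos _).const_mul _).add
      ((State.measurable_z.norm.pow_const 2).const_mul _)).add
      (((((measurable_δα R.structural).add (measurable_δy R.structural)).add
        (measurable_δv R.structural)).const_mul _).const_mul _ |>.const_mul _)).add
        measurable_const)
    (err_nonneg _) (hi1.add (integrable_const _))
    (fun ρ _ hρ S hS => err_step_le R.structural R.oracle hρ R.s_le R.s_pos hS h R.b_pos R.β0_pos
      R.β0_le_one)
  refine ⟨h1.1, h1.2.trans_eq ?_⟩
  have e := integral_add hi1
    (integrable_const (μ := μ) (h.β0 ^ 2 * (p.varDir σ / (min s b : ℕ))))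
  have e2 := integral_add hi2 hi0
  have e3 := integral_add (he.const_mul (1 - h.β0))
    (hz.const_mul (2 / h.β0 * (p.lipGrad * h.η0) ^ 2))
  have e4 := integral_add (ha.add hy) hv
  simp only [Pi.add_apply] at e e2 e3 e4
  rw [e, e2, e3, integral_const_mul, integral_const_mul, integral_const_mul, integral_const_mul,
    integral_const_mul, e4, integral_add ha hy]
  simp

/-- The five integrability statements need one joint induction: the momentum error comes first, it
gives `z`, and `z` controls the drift in the three block errors. -/
theorem integrable_all (t : ℕ) :
    Integrable (fun ω => P.δα (P.iter p.Γ h I B S₀ t ω)) μ ∧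
    Integrable (fun ω => P.δy (P.iter p.Γ h I B S₀ t ω)) μ ∧
    Integrable (fun ω => P.δv (P.iter p.Γ h I B S₀ t ω)) μ ∧
    Integrable (fun ω => ‖(P.iter p.Γ h I B S₀ t ω).z‖ ^ 2) μ ∧
    Integrable (fun ω => P.err h.η0 (P.iter p.Γ h I B S₀ t ω)) μ := by
  induction t with
  | zero => exact ⟨integrable_const (P.δα S₀), integrable_const (P.δy S₀),
      integrable_const (P.δv S₀), integrable_const (‖S₀.z‖ ^ 2), integrable_const (P.err h.η0 S₀)⟩
  | succ t ih =>
    obtain ⟨ha, hy, hv, hz, he⟩ := ih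
    have hit := measurable_iter R.structural R.oracle h R.sampling (S₀ := S₀) (t + 1)
    have he' := (R.err_succ t ha hy hv hz he).1
    have hz' : Integrable (fun ω => ‖(P.iter p.Γ h I B S₀ (t + 1) ω).z‖ ^ 2) μ := by
      refine ((he'.const_mul 2).add (integrable_const (2 * p.boundDir ^ 2))).mono'
        ((State.measurable_z.comp hit).norm.pow_const 2).aestronglyMeasurable
        (Filter.Eventually.of_forall fun ω => ?_)
      rw [Real.norm_of_nonneg (sq_nonneg _)]
      exact norm_z_sq_le R.structural R.m_pos h.η0 _
    -- Only finiteness matters here, so Young's inequality is used with parameter 1.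
    have hq : ∀ L : ℝ, Integrable (fun ω => (1 + 1 / (1 : ℝ)) * (m * (L * h.η0) ^ 2 *
        ‖(P.iter p.Γ h I B S₀ (t + 1) ω).z‖ ^ 2)) μ := fun L => (hz'.const_mul _).const_mul _
    refine ⟨?_, ?_, ?_, hz', he'⟩
    · refine (((R.devα_succ t ha hy).1.const_mul (1 + 1)).add (hq p.lipα)).mono'
        ((measurable_δα R.structural).comp hit).aestronglyMeasurable
        (Filter.Eventually.of_forall fun ω => ?_)
      rw [Real.norm_of_nonneg (δα_nonneg _)]
      exact sum_norm_sub_sq_le R.structural.αStar_lipschitz one_pos h.η0 _ _ _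
    · refine (((R.devy_succ t hy).1.const_mul (1 + 1)).add (hq p.Cy)).mono'
        ((measurable_δy R.structural).comp hit).aestronglyMeasurable
        (Filter.Eventually.of_forall fun ω => ?_)
      rw [Real.norm_of_nonneg (δy_nonneg _)]
      exact sum_norm_sub_sq_le R.structural.yStar_lipschitz one_pos h.η0 _ _ _
    · refine (((R.devv_succ t ha hy hv).1.const_mul (1 + 1)).add (hq p.lipv)).mono'
        ((measurable_δv R.structural).comp hit).aestronglyMeasurable
        (Filter.Eventually.of_forall fun ω => ?_)
      rw [Real.norm_of_nonneg (δv_nonneg _)]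
      exact sum_norm_sub_sq_le R.structural.vStar_lipschitz one_pos h.η0 _ _ _

theorem δα_succ {θ : ℝ} (hθ : 0 < θ) (hθ1 : θ ≤ 1) (hθe : θ = s * h.η1 * p.μf / (4 * m)) (t : ℕ) :
    ∫ ω, P.δα (P.iter p.Γ h I B S₀ (t + 1) ω) ∂μ
      ≤ (1 - θ) * ∫ ω, P.δα (P.iter p.Γ h I B S₀ t ω) ∂μ
        + (2 * (s / m * (3 * h.η1 / p.μf * p.Lf ^ 2) * ∫ ω, P.δy (P.iter p.Γ h I B S₀ t ω) ∂μ
          + s * (h.η1 ^ 2 * (σ ^ 2 / b))) + 2 / θ * (m * (p.lipα * h.η0) ^ 2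
            * ∫ ω, ‖(P.iter p.Γ h I B S₀ (t + 1) ω).z‖ ^ 2 ∂μ)) := by
  obtain ⟨ha, hy, -, -, -⟩ := R.integrable_all t
  obtain ⟨ha', -, -, hz', -⟩ := R.integrable_all (t + 1)
  obtain ⟨hd, hdle⟩ := R.devα_succ t ha hy
  have h1 : ∫ ω, P.δα (P.iter p.Γ h I B S₀ (t + 1) ω) ∂μ
      ≤ ∫ ω, ((1 + θ) * P.devα h.η0 (P.iter p.Γ h I B S₀ (t + 1) ω) + (1 + 1 / θ) *
        (m * (p.lipα * h.η0) ^ 2 * ‖(P.iter p.Γ h I B S₀ (t + 1) ω).z‖ ^ 2)) ∂μ :=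
    integral_mono ha' ((hd.const_mul _).add ((hz'.const_mul _).const_mul _)) fun ω =>
      sum_norm_sub_sq_le R.structural.αStar_lipschitz hθ h.η0 _ _ _
  rw [integral_add (hd.const_mul _) ((hz'.const_mul _).const_mul _), integral_const_mul,
    integral_const_mul, integral_const_mul] at h1
  have e : s * h.η1 * p.μf / (2 * m) = 2 * θ := by
    rw [hθe]; ring
  rw [e, add_assoc] at hdle
  have := p.μf_pos; have := R.η1_pos
  have hy0 : 0 ≤ ∫ ω, P.δy (P.iter p.Γ h I B S₀ t ω) ∂μ := integral_nonneg fun _ => δy_nonneg _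
  have hz0 : 0 ≤ ∫ ω, ‖(P.iter p.Γ h I B S₀ (t + 1) ω).z‖ ^ 2 ∂μ :=
    integral_nonneg fun _ => sq_nonneg _
  exact h1.trans ((add_le_add (mul_le_mul_of_nonneg_left hdle (by positivity)) le_rfl).trans
    (contraction_combine hθ hθ1 (integral_nonneg fun _ => δα_nonneg _) (by positivity)
      (by positivity)))

theorem δy_succ {θ : ℝ} (hθ : 0 < θ) (hθ1 : θ ≤ 1) (hθe : θ = s * h.η2 * p.μg / (2 * m)) (t : ℕ) :
    ∫ ω, P.δy (P.iter p.Γ h I B S₀ (t + 1) ω) ∂μ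
      ≤ (1 - θ) * ∫ ω, P.δy (P.iter p.Γ h I B S₀ t ω) ∂μ
        + (2 * (s * (h.η2 ^ 2 * (σ ^ 2 / b))) + 2 / θ * (m * (p.Cy * h.η0) ^ 2
            * ∫ ω, ‖(P.iter p.Γ h I B S₀ (t + 1) ω).z‖ ^ 2 ∂μ)) := by
  obtain ⟨-, hy, -, -, -⟩ := R.integrable_all t
  obtain ⟨-, hy', -, hz', -⟩ := R.integrable_all (t + 1)
  obtain ⟨hd, hdle⟩ := R.devy_succ t hy
  have h1 : ∫ ω, P.δy (P.iter p.Γ h I B S₀ (t + 1) ω) ∂μ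
      ≤ ∫ ω, ((1 + θ) * P.devy h.η0 (P.iter p.Γ h I B S₀ (t + 1) ω) + (1 + 1 / θ) *
        (m * (p.Cy * h.η0) ^ 2 * ‖(P.iter p.Γ h I B S₀ (t + 1) ω).z‖ ^ 2)) ∂μ :=
    integral_mono hy' ((hd.const_mul _).add ((hz'.const_mul _).const_mul _)) fun ω =>
      sum_norm_sub_sq_le R.structural.yStar_lipschitz hθ h.η0 _ _ _
  rw [integral_add (hd.const_mul _) ((hz'.const_mul _).const_mul _), integral_const_mul,
    integral_const_mul, integral_const_mul] at h1
  have e : s * h.η2 * p.μg / m = 2 * θ := by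
    rw [hθe]; ring
  rw [e] at hdle
  have := R.η2_pos
  have hz0 : 0 ≤ ∫ ω, ‖(P.iter p.Γ h I B S₀ (t + 1) ω).z‖ ^ 2 ∂μ :=
    integral_nonneg fun _ => sq_nonneg _
  exact h1.trans ((add_le_add (mul_le_mul_of_nonneg_left hdle (by positivity)) le_rfl).trans
    (contraction_combine hθ hθ1 (integral_nonneg fun _ => δy_nonneg _) (by positivity)
      (by positivity)))

theorem δv_succ {θ : ℝ} (hθ : 0 < θ) (hθ1 : θ ≤ 1) (hθe : θ = s * h.η3 * p.μg / (4 * m)) (t : ℕ) :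
    ∫ ω, P.δv (P.iter p.Γ h I B S₀ (t + 1) ω) ∂μ
      ≤ (1 - θ) * ∫ ω, P.δv (P.iter p.Γ h I B S₀ t ω) ∂μ
        + (2 * (s / m * (6 * h.η3 / p.μg * (p.Lf + p.Lgyy * p.Γ) ^ 2)
          * (∫ ω, P.δα (P.iter p.Γ h I B S₀ t ω) ∂μ + ∫ ω, P.δy (P.iter p.Γ h I B S₀ t ω) ∂μ)
          + s * (h.η3 ^ 2 * (2 * (1 + p.Γ ^ 2) * (σ ^ 2 / b))))
          + 2 / θ * (m * (p.lipv * h.η0) ^ 2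
            * ∫ ω, ‖(P.iter p.Γ h I B S₀ (t + 1) ω).z‖ ^ 2 ∂μ)) := by
  obtain ⟨ha, hy, hv, -, -⟩ := R.integrable_all t
  obtain ⟨-, -, hv', hz', -⟩ := R.integrable_all (t + 1)
  obtain ⟨hd, hdle⟩ := R.devv_succ t ha hy hv
  have h1 : ∫ ω, P.δv (P.iter p.Γ h I B S₀ (t + 1) ω) ∂μ
      ≤ ∫ ω, ((1 + θ) * P.devv h.η0 (P.iter p.Γ h I B S₀ (t + 1) ω) + (1 + 1 / θ) *
        (m * (p.lipv * h.η0) ^ 2 * ‖(P.iter p.Γ h I B S₀ (t + 1) ω).z‖ ^ 2)) ∂μ :=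
    integral_mono hv' ((hd.const_mul _).add ((hz'.const_mul _).const_mul _)) fun ω =>
      sum_norm_sub_sq_le R.structural.vStar_lipschitz hθ h.η0 _ _ _
  rw [integral_add (hd.const_mul _) ((hz'.const_mul _).const_mul _), integral_const_mul,
    integral_const_mul, integral_const_mul] at h1
  have e : s * h.η3 * p.μg / (2 * m) = 2 * θ := by
    rw [hθe]; ring
  rw [e, add_assoc] at hdle
  have := p.μg_pos; have := R.η3_pos
  have hy0 : 0 ≤ ∫ ω, P.δy (P.iter p.Γ h I B S₀ t ω) ∂μ := integral_nonneg fun _ => δy_nonneg _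
  have ha0 : 0 ≤ ∫ ω, P.δα (P.iter p.Γ h I B S₀ t ω) ∂μ := integral_nonneg fun _ => δα_nonneg _
  have hz0 : 0 ≤ ∫ ω, ‖(P.iter p.Γ h I B S₀ (t + 1) ω).z‖ ^ 2 ∂μ :=
    integral_nonneg fun _ => sq_nonneg _
  exact h1.trans ((add_le_add (mul_le_mul_of_nonneg_left hdle (by positivity)) le_rfl).trans
    (contraction_combine hθ hθ1 (integral_nonneg fun _ => δv_nonneg _) (by positivity)
      (by positivity)))

end Run

end Problem

/-! ### The constants of the theorem. -/

namespace Params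
variable (p : Params)

/-- The smoothness constant used in the step-size conditions. -/
def smoothF : ℝ := 4 * p.lipGrad
/-- The influence of the lower-level error on the error of the dual variables. -/
def couplα : ℝ := 24 * p.Cα ^ 2
/-- The influence of the dual and lower-level errors on the error of the variables `v`. -/
def couplv : ℝ := 48 * ((p.Lf + p.Lgyy * p.Γ) / p.μg) ^ 2
-- Slack needed because the step conditions are stated with `Cα` and a given noise normalisation: `1
-- / μf²` pays for the noise, `(1 + Cy)² = (lipα / Cα)²` for the drift, and the leading 1 for the
-- initial error. `inflv` plays the same role for `v`.
def inflα : ℝ := 1 + 1 / p.μf ^ 2 + (1 + p.Cy) ^ 2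
def inflv : ℝ := 1 + 2 * (1 + p.Γ ^ 2) / p.μg ^ 2 + (p.lipv / p.Cv) ^ 2
/-- The influence of the block errors on the error of the momentum. -/
def biasC : ℝ := 6 * p.lipDir ^ 2
-- The three weights are matched to `mul_add_add_le_of_cascade`: each is large enough to absorb the
-- influence of its error on those further down the chain y, α, v, momentum.
def constα : ℝ := 3 * p.biasC * (1 + p.couplv) * p.inflα
def consty : ℝ := 3 * p.biasC * (1 + p.couplv) * (1 + p.couplα)
def constv : ℝ := 3 * p.biasC * p.inflv
-- The added 1 keeps the constant positive when the variance bound vanishes.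
def constVar (σ : ℝ) : ℝ := p.varDir σ + 1

theorem smoothF_pos : 0 < p.smoothF := by have := p.lipGrad_pos; unfold smoothF; positivity
theorem couplα_nonneg : 0 ≤ p.couplα := by unfold couplα; positivity
theorem couplv_nonneg : 0 ≤ p.couplv := by unfold couplv; positivity
theorem one_le_inflα : 1 ≤ p.inflα := by
  have : 0 ≤ 1 / p.μf ^ 2 := by positivity
  unfold inflα; nlinarith [sq_nonneg (1 + p.Cy)]
theorem one_le_inflv : 1 ≤ p.inflv := by
  have : 0 ≤ 2 * (1 + p.Γ ^ 2) / p.μg ^ 2 := by positivity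
  unfold inflv; nlinarith [sq_nonneg (p.lipv / p.Cv)]
theorem biasC_pos : 0 < p.biasC := by have := p.lipDir_pos; unfold biasC; positivity
theorem constα_pos : 0 < p.constα := by
  have := p.biasC_pos; have := p.couplv_nonneg; have := p.one_le_inflα
  unfold constα; positivity
theorem consty_pos : 0 < p.consty := by
  have := p.biasC_pos; have := p.couplv_nonneg; have := p.couplα_nonneg
  unfold consty; positivity
theorem constv_pos : 0 < p.constv := by
  have := p.biasC_pos; have := p.one_le_inflv
  unfold constv; positivity
theorem constVar_pos (σ : ℝ) : 0 < p.constVar σ := by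
  have := p.varDir_nonneg σ
  unfold constVar; positivity

end Params

/-- The weight `g` rescales a summed recursion. The initial error is allotted `e/15` and the noise
`e/12` per iteration, together `3e/20`; the drift is allotted `1/32` of the momentum, and `r`
collects the coupling terms. -/
theorem weighted_sum_le {θ g X x₀ N n c Z r κ e C : ℝ} (hg : 0 ≤ g) (hgθ : g * θ = C)
    (hsum : θ * X ≤ x₀ + (N * n + c * Z + r)) (h1 : g * x₀ ≤ N * (e / 15))
    (h2 : g * n ≤ κ * (e / 12)) (h3 : g * c ≤ κ / 32) (hκ : 1 ≤ κ) (hN : 0 ≤ N) (hZ : 0 ≤ Z)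
    (he : 0 ≤ e) : C * X ≤ κ * (N * (3 / 20 * e) + Z / 32) + g * r := by
  have h4 := mul_le_mul_of_nonneg_left hsum hg
  have h5 : N * (e / 15) ≤ κ * (N * (e / 15)) := le_mul_of_one_le_left (by positivity) hκ
  rw [← mul_assoc, hgθ] at h4
  nlinarith [mul_le_mul_of_nonneg_left h2 hN, mul_le_mul_of_nonneg_right h3 hZ]

theorem mul_sq_le_of_le_div {η A D c : ℝ} (hη : 0 ≤ η) (hD : 0 < D) (hc : 0 < c)
    (h : η ≤ A / (D * √c)) : D ^ 2 * c * η ^ 2 ≤ A ^ 2 := by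
  have hs := Real.sqrt_pos.2 hc
  rw [le_div_iff₀ (mul_pos hD hs)] at h
  have h2 := pow_le_pow_left₀ (by positivity) h 2
  rw [mul_pow, mul_pow, Real.sq_sqrt hc.le] at h2
  linarith

/-! ### Summed error bounds under the step-size conditions. -/

namespace Problem

variable {m dX dA dY b s : ℕ} {Ξ : Fin m → Type u} [∀ i, MeasurableSpace (Ξ i)]
  {P : Problem m dX dA dY b Ξ} {p : Params} {σ : ℝ}

section Sums

variable {Ω : Type w} [mΩ : MeasurableSpace Ω] {μ : Measure Ω}
  {I : ℕ → Ω → Finset (Fin m)} {B : ℕ → Ω → ∀ i, Fin b → Ξ i} {S₀ : State m dX dA dY}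
  {h : StepSizes} {ε : ℝ} {T : ℕ}

theorem run_of_stepConditions {LF C1 C2 C3 C4 : ℝ} (H : P.StructuralAssumptions p)
    (O : P.OracleAssumptions σ) (hI : P.IsSampling μ s I B) (hS : P.AdmissibleInit p.Γ S₀)
    (hs1 : 1 ≤ s) (hs : s ≤ m) (hb : 1 ≤ b)
    (hc : StepConditions p LF C1 C2 C3 C4 σ ε m s b h) : Run P p σ s μ I B S₀ h where
  structural := H
  oracle := O
  sampling := hI
  init := hS
  s_pos := hs1
  s_le := hs
  b_pos := hb
  η0_pos := hc.η0_pos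
  η1_pos := hc.η1_pos
  η2_pos := hc.η2_pos
  η3_pos := hc.η3_pos
  β0_pos := hc.β0_pos
  β0_le_one := hc.β0_le_one
  η1_le := (le_min_iff.1 hc.η1_le).1
  η1_le' := (le_min_iff.1 (le_min_iff.1 hc.η1_le).2).1
  η2_le := (le_min_iff.1 hc.η2_le).1
  η3_le := (le_min_iff.1 hc.η3_le).1
  η3_le' := (le_min_iff.1 (le_min_iff.1 hc.η3_le).2).1

variable [IsProbabilityMeasure μ] {LF C1 C2 C3 C4 : ℝ} (R : Run P p σ s μ I B S₀ h)
  (hc : StepConditions p LF C1 C2 C3 C4 σ ε m s b h) (hε : 0 < ε)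

include R hc hε in
theorem sum_δy_le (hC2 : 0 < C2)
    (hT : 30 * C2 * P.δy S₀ / (s * h.η2 * p.μg * ε ^ 2) ≤ T) :
    C2 * ((m : ℝ)⁻¹ * ∑ t ∈ Finset.range (T + 1), ∫ ω, P.δy (P.iter p.Γ h I B S₀ t ω) ∂μ)
      ≤ ((T : ℝ) + 1) * (3 / 20 * ε ^ 2) + (∑ t ∈ Finset.range (T + 1),
        ∫ ω, ‖(P.iter p.Γ h I B S₀ (t + 1) ω).z‖ ^ 2 ∂μ) / 32 := by
  have hm : (0 : ℝ) < m := by exact_mod_cast R.m_pos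
  have hs : (0 : ℝ) < s := by exact_mod_cast R.s_pos
  have hb : (0 : ℝ) < b := by exact_mod_cast R.b_pos
  have hη := R.η2_pos
  have hμ := p.μg_pos
  have hη0 := R.η0_pos
  have hCy := p.Cy_pos
  set θ : ℝ := s * h.η2 * p.μg / (2 * m) with hθ
  have hθ0 : 0 < θ := by positivity
  have hθ1 : θ ≤ 1 := by
    have h1 := (le_min_iff.1 hc.η2_le).2
    rw [le_div_iff₀ (by positivity)] at h1
    rw [hθ, div_le_one (by positivity)]
    linarith
  have hz0 : ∀ t, 0 ≤ ∫ ω, ‖(P.iter p.Γ h I B S₀ (t + 1) ω).z‖ ^ 2 ∂μ := fun t =>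
    integral_nonneg fun _ => sq_nonneg _
  set Z : ℝ := ∑ t ∈ Finset.range (T + 1), ∫ ω, ‖(P.iter p.Γ h I B S₀ (t + 1) ω).z‖ ^ 2 ∂μ with hZ
  have hsum := mul_sum_le_of_contraction hθ1 (fun t => integral_nonneg fun _ => δy_nonneg _)
    (fun t => R.δy_succ hθ0 hθ1 hθ t) T
  have hr : ∑ t ∈ Finset.range T, (2 * (s * (h.η2 ^ 2 * (σ ^ 2 / b))) + 2 / θ *
        (m * (p.Cy * h.η0) ^ 2 * ∫ ω, ‖(P.iter p.Γ h I B S₀ (t + 1) ω).z‖ ^ 2 ∂μ))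
      ≤ ((T : ℝ) + 1) * (2 * (s * (h.η2 ^ 2 * (σ ^ 2 / b))))
        + 2 / θ * (m * (p.Cy * h.η0) ^ 2) * Z + 0 := by
    -- One nonnegative term is added so that all sums run over the `T + 1` values of the random
    -- index.
    refine (Finset.sum_le_sum_of_subset_of_nonneg (Finset.range_mono T.le_succ) fun t _ _ => by
      have := hz0 t; positivity).trans_eq ?_
    rw [Finset.sum_add_distrib, Finset.sum_const, Finset.card_range, nsmul_eq_mul, ← Finset.mul_sum,
      ← Finset.mul_sum, ← hZ]
    push_cast; ring
  have h0 : ∫ ω, P.δy (P.iter p.Γ h I B S₀ 0 ω) ∂μ = P.δy S₀ := by simp [iter]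
  rw [h0] at hsum
  -- The weight is `C2 / (m θ)`. For `y` the conditions match the recursion exactly, so the slack
  -- `κ` is 1.
  have key := weighted_sum_le (g := 2 * C2 / (s * h.η2 * p.μg)) (C := C2 * (m : ℝ)⁻¹) (κ := 1)
    (e := ε ^ 2) (N := (T : ℝ) + 1) (Z := Z) (by positivity) (by rw [hθ]; field_simp)
    (hsum.trans (add_le_add le_rfl hr)) ?_ ?_ ?_ le_rfl (by positivity)
    (Finset.sum_nonneg fun t _ => hz0 t) (by positivity)
  · rw [← mul_assoc]; simpa using key
  · rw [div_le_iff₀ (by positivity)] at hT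
    rw [div_mul_eq_mul_div, div_le_iff₀ (by positivity)]
    nlinarith [mul_pos (mul_pos hs hη) (mul_pos hμ (pow_pos hε 2))]
  · have h1 := hc.η2_noise
    have e : 2 * C2 / (s * h.η2 * p.μg) * (2 * (s * (h.η2 ^ 2 * (σ ^ 2 / b))))
        = 4 * C2 * h.η2 * σ ^ 2 / (p.μg * b) := by field_simp; ring
    rw [e, div_le_iff₀ (by positivity)]
    linarith
  · have h1 := mul_sq_le_of_le_div (D := 16 * m * p.Cy) hη0.le (by positivity) hC2 hc.η0_le_y
    have e : 2 * C2 / (s * h.η2 * p.μg) * (2 / θ * (m * (p.Cy * h.η0) ^ 2))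
        = 8 * m ^ 2 * p.Cy ^ 2 * C2 * h.η0 ^ 2 / (s * h.η2 * p.μg) ^ 2 := by
      rw [hθ]; field_simp; ring
    rw [e, div_le_iff₀ (by positivity)]
    linarith

include R hc hε in
theorem sum_δα_le (hC1 : 0 < C1)
    (hT : 60 * C1 * P.δα S₀ / (p.μf * s * h.η1 * ε ^ 2) ≤ T) :
    C1 * ((m : ℝ)⁻¹ * ∑ t ∈ Finset.range (T + 1), ∫ ω, P.δα (P.iter p.Γ h I B S₀ t ω) ∂μ)
      ≤ p.inflα * (((T : ℝ) + 1) * (3 / 20 * ε ^ 2) + (∑ t ∈ Finset.range (T + 1),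
        ∫ ω, ‖(P.iter p.Γ h I B S₀ (t + 1) ω).z‖ ^ 2 ∂μ) / 32)
        + C1 * (p.couplα * ((m : ℝ)⁻¹ * ∑ t ∈ Finset.range (T + 1),
          ∫ ω, P.δy (P.iter p.Γ h I B S₀ t ω) ∂μ)) := by
  have hm : (0 : ℝ) < m := by exact_mod_cast R.m_pos
  have hs : (0 : ℝ) < s := by exact_mod_cast R.s_pos
  have hb : (0 : ℝ) < b := by exact_mod_cast R.b_pos
  have hη := R.η1_pos
  have hμ := p.μf_pos
  have hη0 := R.η0_pos
  have hCα := p.Cα_pos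
  have hCy := p.Cy_pos
  set θ : ℝ := s * h.η1 * p.μf / (4 * m) with hθ
  have hθ0 : 0 < θ := by positivity
  have hθ1 : θ ≤ 1 := by
    have h1 := (le_min_iff.1 (le_min_iff.1 hc.η1_le).2).2
    rw [le_div_iff₀ (by positivity)] at h1
    rw [hθ, div_le_one (by positivity)]
    linarith
  have hz0 : ∀ t, 0 ≤ ∫ ω, ‖(P.iter p.Γ h I B S₀ (t + 1) ω).z‖ ^ 2 ∂μ := fun t =>
    integral_nonneg fun _ => sq_nonneg _
  have hy0 : ∀ t, 0 ≤ ∫ ω, P.δy (P.iter p.Γ h I B S₀ t ω) ∂μ := fun t =>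
    integral_nonneg fun _ => δy_nonneg _
  set Z : ℝ := ∑ t ∈ Finset.range (T + 1), ∫ ω, ‖(P.iter p.Γ h I B S₀ (t + 1) ω).z‖ ^ 2 ∂μ with hZ
  set Y : ℝ := ∑ t ∈ Finset.range (T + 1), ∫ ω, P.δy (P.iter p.Γ h I B S₀ t ω) ∂μ with hY
  have hsum := mul_sum_le_of_contraction hθ1 (fun t => integral_nonneg fun _ => δα_nonneg _)
    (fun t => R.δα_succ hθ0 hθ1 hθ t) T
  have hr : ∑ t ∈ Finset.range T, (2 * (s / m * (3 * h.η1 / p.μf * p.Lf ^ 2)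
          * ∫ ω, P.δy (P.iter p.Γ h I B S₀ t ω) ∂μ + s * (h.η1 ^ 2 * (σ ^ 2 / b))) + 2 / θ *
        (m * (p.lipα * h.η0) ^ 2 * ∫ ω, ‖(P.iter p.Γ h I B S₀ (t + 1) ω).z‖ ^ 2 ∂μ))
      ≤ ((T : ℝ) + 1) * (2 * (s * (h.η1 ^ 2 * (σ ^ 2 / b))))
        + 2 / θ * (m * (p.lipα * h.η0) ^ 2) * Z
        + 2 * (s / m * (3 * h.η1 / p.μf * p.Lf ^ 2)) * Y := by
    refine (Finset.sum_le_sum_of_subset_of_nonneg (Finset.range_mono T.le_succ) fun t _ _ => by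
      have := hz0 t; have := hy0 t; positivity).trans_eq ?_
    rw [Finset.sum_add_distrib, ← Finset.mul_sum, Finset.sum_add_distrib, Finset.sum_const,
      Finset.card_range, nsmul_eq_mul, ← Finset.mul_sum, ← Finset.mul_sum, ← Finset.mul_sum, ← hZ,
      ← hY]
    push_cast; ring
  have h0 : ∫ ω, P.δα (P.iter p.Γ h I B S₀ 0 ω) ∂μ = P.δα S₀ := by simp [iter]
  rw [h0] at hsum
  have key := weighted_sum_le (g := 4 * C1 / (s * h.η1 * p.μf)) (C := C1 * (m : ℝ)⁻¹)
    (κ := p.inflα) (e := ε ^ 2) (N := (T : ℝ) + 1) (Z := Z) (by positivity)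
    (by rw [hθ]; field_simp)
    (hsum.trans (add_le_add le_rfl hr)) ?_ ?_ ?_ p.one_le_inflα (by positivity)
    (Finset.sum_nonneg fun t _ => hz0 t) (by positivity)
  · rw [← mul_assoc]
    refine key.trans_eq ?_
    rw [Params.couplα, Params.Cα]
    field_simp; ring
  · rw [div_le_iff₀ (by positivity)] at hT
    rw [div_mul_eq_mul_div, div_le_iff₀ (by positivity)]
    nlinarith [mul_pos (mul_pos hs hη) (mul_pos hμ (pow_pos hε 2))]
  · have h1 := hc.η1_noise
    have e : 4 * C1 / (s * h.η1 * p.μf) * (2 * (s * (h.η1 ^ 2 * (σ ^ 2 / b))))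
        = h.η1 * (96 * C1 * p.μf * σ ^ 2) / (12 * p.μf ^ 2 * b) := by field_simp; ring
    have e2 : 1 / p.μf ^ 2 * (ε ^ 2 / 12) = b * ε ^ 2 / (12 * p.μf ^ 2 * b) := by field_simp
    have h2 : 1 / p.μf ^ 2 ≤ p.inflα := by
      unfold Params.inflα; nlinarith [sq_nonneg (1 + p.Cy)]
    refine le_trans ?_ (mul_le_mul_of_nonneg_right h2 (by positivity))
    rw [e, e2]
    gcongr
  · have h1 := mul_sq_le_of_le_div (A := h.η1 * p.μf * s) (D := 32 * m * p.Cα) hη0.le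
      (by positivity) hC1 hc.η0_le_α
    -- The bound on `η₀` involves `Cα` instead of the true constant `lipα = Cα (1 + Cy)`; the excess
    -- `(1 + Cy)²` is absorbed by `inflα`.
    have e : 4 * C1 / (s * h.η1 * p.μf) * (2 / θ * (m * (p.lipα * h.η0) ^ 2))
        = (1 + p.Cy) ^ 2 / 32 * ((32 * m * p.Cα) ^ 2 * C1 * h.η0 ^ 2 / (h.η1 * p.μf * s) ^ 2) := by
      rw [hθ, Params.lipα]; field_simp; ring
    have h2 : (1 + p.Cy) ^ 2 ≤ p.inflα := by
      have : 0 ≤ 1 / p.μf ^ 2 := by positivity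
      unfold Params.inflα; linarith
    have h3 : (32 * m * p.Cα) ^ 2 * C1 * h.η0 ^ 2 / (h.η1 * p.μf * s) ^ 2 ≤ 1 := by
      rw [div_le_one (by positivity)]; exact h1
    rw [e]
    calc _ ≤ (1 + p.Cy) ^ 2 / 32 * 1 := mul_le_mul_of_nonneg_left h3 (by positivity)
      _ ≤ _ := by linarith

include R hc hε in
theorem sum_δv_le (hC3 : 0 < C3)
    (hT : 60 * C3 * P.δv S₀ / (h.η3 * p.μg * s * ε ^ 2) ≤ T) :
    C3 * ((m : ℝ)⁻¹ * ∑ t ∈ Finset.range (T + 1), ∫ ω, P.δv (P.iter p.Γ h I B S₀ t ω) ∂μ)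
      ≤ p.inflv * (((T : ℝ) + 1) * (3 / 20 * ε ^ 2) + (∑ t ∈ Finset.range (T + 1),
        ∫ ω, ‖(P.iter p.Γ h I B S₀ (t + 1) ω).z‖ ^ 2 ∂μ) / 32)
        + C3 * (p.couplv * ((m : ℝ)⁻¹ * ∑ t ∈ Finset.range (T + 1),
            ∫ ω, P.δα (P.iter p.Γ h I B S₀ t ω) ∂μ + (m : ℝ)⁻¹ * ∑ t ∈ Finset.range (T + 1),
            ∫ ω, P.δy (P.iter p.Γ h I B S₀ t ω) ∂μ)) := by
  have hm : (0 : ℝ) < m := by exact_mod_cast R.m_pos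
  have hs : (0 : ℝ) < s := by exact_mod_cast R.s_pos
  have hb : (0 : ℝ) < b := by exact_mod_cast R.b_pos
  have hη := R.η3_pos
  have hμ := p.μg_pos
  have hη0 := R.η0_pos
  have hCv : 0 < p.Cv := p.Cy_pos
  set θ : ℝ := s * h.η3 * p.μg / (4 * m) with hθ
  have hθ0 : 0 < θ := by positivity
  have hθ1 : θ ≤ 1 := by
    have h1 := (le_min_iff.1 (le_min_iff.1 hc.η3_le).2).2
    rw [Params.μγ, le_div_iff₀ (by positivity)] at h1
    rw [hθ, div_le_one (by positivity)]
    linarith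
  have hz0 : ∀ t, 0 ≤ ∫ ω, ‖(P.iter p.Γ h I B S₀ (t + 1) ω).z‖ ^ 2 ∂μ := fun t =>
    integral_nonneg fun _ => sq_nonneg _
  have hy0 : ∀ t, 0 ≤ ∫ ω, P.δy (P.iter p.Γ h I B S₀ t ω) ∂μ := fun t =>
    integral_nonneg fun _ => δy_nonneg _
  have ha0 : ∀ t, 0 ≤ ∫ ω, P.δα (P.iter p.Γ h I B S₀ t ω) ∂μ := fun t =>
    integral_nonneg fun _ => δα_nonneg _
  set Z : ℝ := ∑ t ∈ Finset.range (T + 1), ∫ ω, ‖(P.iter p.Γ h I B S₀ (t + 1) ω).z‖ ^ 2 ∂μ with hZ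
  set Y : ℝ := ∑ t ∈ Finset.range (T + 1), ∫ ω, P.δy (P.iter p.Γ h I B S₀ t ω) ∂μ with hY
  set A : ℝ := ∑ t ∈ Finset.range (T + 1), ∫ ω, P.δα (P.iter p.Γ h I B S₀ t ω) ∂μ with hA
  have hsum := mul_sum_le_of_contraction hθ1 (fun t => integral_nonneg fun _ => δv_nonneg _)
    (fun t => R.δv_succ hθ0 hθ1 hθ t) T
  have hr : ∑ t ∈ Finset.range T, (2 * (s / m * (6 * h.η3 / p.μg * (p.Lf + p.Lgyy * p.Γ) ^ 2)
          * (∫ ω, P.δα (P.iter p.Γ h I B S₀ t ω) ∂μ + ∫ ω, P.δy (P.iter p.Γ h I B S₀ t ω) ∂μ)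
          + s * (h.η3 ^ 2 * (2 * (1 + p.Γ ^ 2) * (σ ^ 2 / b)))) + 2 / θ *
        (m * (p.lipv * h.η0) ^ 2 * ∫ ω, ‖(P.iter p.Γ h I B S₀ (t + 1) ω).z‖ ^ 2 ∂μ))
      ≤ ((T : ℝ) + 1) * (2 * (s * (h.η3 ^ 2 * (2 * (1 + p.Γ ^ 2) * (σ ^ 2 / b)))))
        + 2 / θ * (m * (p.lipv * h.η0) ^ 2) * Z
        + 2 * (s / m * (6 * h.η3 / p.μg * (p.Lf + p.Lgyy * p.Γ) ^ 2)) * (A + Y) := by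
    refine (Finset.sum_le_sum_of_subset_of_nonneg (Finset.range_mono T.le_succ) fun t _ _ => by
      have := hz0 t; have := hy0 t; have := ha0 t; positivity).trans_eq ?_
    rw [Finset.sum_add_distrib, ← Finset.mul_sum, Finset.sum_add_distrib, Finset.sum_const,
      Finset.card_range, nsmul_eq_mul, ← Finset.mul_sum, ← Finset.mul_sum, ← Finset.mul_sum, ← hZ,
      Finset.sum_add_distrib, ← hY, ← hA]
    push_cast; ring
  have h0 : ∫ ω, P.δv (P.iter p.Γ h I B S₀ 0 ω) ∂μ = P.δv S₀ := by simp [iter]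
  rw [h0] at hsum
  have key := weighted_sum_le (g := 4 * C3 / (s * h.η3 * p.μg)) (C := C3 * (m : ℝ)⁻¹)
    (κ := p.inflv) (e := ε ^ 2) (N := (T : ℝ) + 1) (Z := Z) (by positivity)
    (by rw [hθ]; field_simp)
    (hsum.trans (add_le_add le_rfl hr)) ?_ ?_ ?_ p.one_le_inflv (by positivity)
    (Finset.sum_nonneg fun t _ => hz0 t) (by positivity)
  · rw [← mul_assoc]
    refine key.trans_eq ?_
    rw [Params.couplv]
    field_simp; ring
  · rw [div_le_iff₀ (by positivity)] at hT
    rw [div_mul_eq_mul_div, div_le_iff₀ (by positivity)]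
    nlinarith [mul_pos (mul_pos hs hη) (mul_pos hμ (pow_pos hε 2))]
  · have h1 := hc.η3_noise
    have e : 4 * C3 / (s * h.η3 * p.μg) * (2 * (s * (h.η3 ^ 2 * (2 * (1 + p.Γ ^ 2) * (σ ^ 2 / b)))))
        = 2 * (1 + p.Γ ^ 2) * (h.η3 * (96 * C3 * p.μg * σ ^ 2)) / (12 * p.μg ^ 2 * b) := by
      field_simp; ring
    have e2 : 2 * (1 + p.Γ ^ 2) / p.μg ^ 2 * (ε ^ 2 / 12)
        = 2 * (1 + p.Γ ^ 2) * (b * ε ^ 2) / (12 * p.μg ^ 2 * b) := by field_simp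
    have h2 : 2 * (1 + p.Γ ^ 2) / p.μg ^ 2 ≤ p.inflv := by
      unfold Params.inflv; nlinarith [sq_nonneg (p.lipv / p.Cv)]
    refine le_trans ?_ (mul_le_mul_of_nonneg_right h2 (by positivity))
    rw [e, e2]
    gcongr
  · have h1 := mul_sq_le_of_le_div (A := h.η3 * p.μg * s) (D := 32 * m * p.Cv) hη0.le
      (by positivity) hC3 hc.η0_le_v
    -- The ratio `lipv / Cv` measures by how much the true Lipschitz constant exceeds the one in the
    -- bound on `η₀`; `inflv` contains its square.
    have e : 4 * C3 / (s * h.η3 * p.μg) * (2 / θ * (m * (p.lipv * h.η0) ^ 2))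
        = (p.lipv / p.Cv) ^ 2 / 32
          * ((32 * m * p.Cv) ^ 2 * C3 * h.η0 ^ 2 / (h.η3 * p.μg * s) ^ 2) := by
      rw [hθ]; field_simp; ring
    have h2 : (p.lipv / p.Cv) ^ 2 ≤ p.inflv := by
      have : 0 ≤ 2 * (1 + p.Γ ^ 2) / p.μg ^ 2 := by positivity
      unfold Params.inflv; linarith
    have h3 : (32 * m * p.Cv) ^ 2 * C3 * h.η0 ^ 2 / (h.η3 * p.μg * s) ^ 2 ≤ 1 := by
      rw [div_le_one (by positivity)]; exact h1
    rw [e]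
    calc _ ≤ (p.lipv / p.Cv) ^ 2 / 32 * 1 := mul_le_mul_of_nonneg_left h3 (by positivity)
      _ ≤ _ := by linarith

include R hc hε in
-- The recursion is started at time 1, so the initial term is the error of `z₁` against the gradient
-- at `x₀`.
theorem sum_err_le (hLF : LF = p.smoothF) (hC4 : C4 = p.constVar σ)
    (hT : 15 * ∫ ω, P.err h.η0 (P.iter p.Γ h I B S₀ 1 ω) ∂μ ≤ T * (h.β0 * ε ^ 2)) :
    ∑ t ∈ Finset.range (T + 1), ∫ ω, P.err h.η0 (P.iter p.Γ h I B S₀ (t + 1) ω) ∂μ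
      ≤ (((T : ℝ) + 1) * (3 / 20 * ε ^ 2) + (∑ t ∈ Finset.range (T + 1),
        ∫ ω, ‖(P.iter p.Γ h I B S₀ (t + 1) ω).z‖ ^ 2 ∂μ) / 32)
        + p.biasC * ((m : ℝ)⁻¹ * ∑ t ∈ Finset.range (T + 1),
            ∫ ω, P.δα (P.iter p.Γ h I B S₀ t ω) ∂μ + (m : ℝ)⁻¹ * ∑ t ∈ Finset.range (T + 1),
            ∫ ω, P.δy (P.iter p.Γ h I B S₀ t ω) ∂μ + (m : ℝ)⁻¹ * ∑ t ∈ Finset.range (T + 1),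
            ∫ ω, P.δv (P.iter p.Γ h I B S₀ t ω) ∂μ) := by
  have hm : (0 : ℝ) < m := by exact_mod_cast R.m_pos
  have hβ := R.β0_pos
  have hη0 := R.η0_pos
  have hLG := p.lipGrad_pos
  have hmin : (0 : ℝ) < (min s b : ℕ) := by exact_mod_cast lt_min R.s_pos R.b_pos
  have hz0 : ∀ t, 0 ≤ ∫ ω, ‖(P.iter p.Γ h I B S₀ (t + 1) ω).z‖ ^ 2 ∂μ := fun t =>
    integral_nonneg fun _ => sq_nonneg _
  have hy0 : ∀ t, 0 ≤ ∫ ω, P.δy (P.iter p.Γ h I B S₀ t ω) ∂μ := fun t =>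
    integral_nonneg fun _ => δy_nonneg _
  have ha0 : ∀ t, 0 ≤ ∫ ω, P.δα (P.iter p.Γ h I B S₀ t ω) ∂μ := fun t =>
    integral_nonneg fun _ => δα_nonneg _
  have hv0 : ∀ t, 0 ≤ ∫ ω, P.δv (P.iter p.Γ h I B S₀ t ω) ∂μ := fun t =>
    integral_nonneg fun _ => δv_nonneg _
  have hvar := p.varDir_nonneg σ
  set Z : ℝ := ∑ t ∈ Finset.range (T + 1), ∫ ω, ‖(P.iter p.Γ h I B S₀ (t + 1) ω).z‖ ^ 2 ∂μ with hZ
  set Y : ℝ := ∑ t ∈ Finset.range (T + 1), ∫ ω, P.δy (P.iter p.Γ h I B S₀ t ω) ∂μ with hY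
  set A : ℝ := ∑ t ∈ Finset.range (T + 1), ∫ ω, P.δα (P.iter p.Γ h I B S₀ t ω) ∂μ with hA
  set V : ℝ := ∑ t ∈ Finset.range (T + 1), ∫ ω, P.δv (P.iter p.Γ h I B S₀ t ω) ∂μ with hV
  have hsum := mul_sum_le_of_contraction (θ := h.β0)
    (u := fun t => ∫ ω, P.err h.η0 (P.iter p.Γ h I B S₀ (t + 1) ω) ∂μ)
    (r := fun t => 2 / h.β0 * (p.lipGrad * h.η0) ^ 2
          * ∫ ω, ‖(P.iter p.Γ h I B S₀ (t + 1) ω).z‖ ^ 2 ∂μ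
        + 2 * h.β0 * ((m : ℝ)⁻¹ * (3 * p.lipDir ^ 2
          * (∫ ω, P.δα (P.iter p.Γ h I B S₀ (t + 1) ω) ∂μ
            + ∫ ω, P.δy (P.iter p.Γ h I B S₀ (t + 1) ω) ∂μ
            + ∫ ω, P.δv (P.iter p.Γ h I B S₀ (t + 1) ω) ∂μ)))
        + h.β0 ^ 2 * (p.varDir σ / (min s b : ℕ)))
    R.β0_le_one (fun t => integral_nonneg fun _ => err_nonneg _ _)
    (fun t => by
      obtain ⟨ha, hy, hv, hz, he⟩ := R.integrable_all (t + 1)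
      have := (R.err_succ (t + 1) ha hy hv hz he).2
      linarith) T
  -- Starting at time 1 shifts the block errors by one index; the missing term at time 0 is
  -- nonnegative.
  have hle : ∀ q : ℕ → ℝ, (∀ t, 0 ≤ q t) →
      ∑ t ∈ Finset.range T, q (t + 1) ≤ ∑ t ∈ Finset.range (T + 1), q t := fun q hq => by
    rw [Finset.sum_range_succ']; linarith [hq 0]
  have hzle : ∑ t ∈ Finset.range T, ∫ ω, ‖(P.iter p.Γ h I B S₀ (t + 1) ω).z‖ ^ 2 ∂μ ≤ Z :=
    Finset.sum_le_sum_of_subset_of_nonneg (Finset.range_mono T.le_succ) fun t _ _ => hz0 t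
  have hale := hle _ ha0
  have hyle := hle _ hy0
  have hvle := hle _ hv0
  rw [Finset.sum_add_distrib, Finset.sum_add_distrib, Finset.sum_const, Finset.card_range,
    nsmul_eq_mul, ← Finset.mul_sum, ← Finset.mul_sum, ← Finset.mul_sum, ← Finset.mul_sum,
    Finset.sum_add_distrib, Finset.sum_add_distrib] at hsum
  -- Since `LF` is four times the Lipschitz constant, `lipGrad * η₀ ≤ β₀ / 32`, which gives `1/512`,
  -- more than is needed.
  have h1 : 2 / h.β0 * (p.lipGrad * h.η0) ^ 2 ≤ h.β0 * (1 / 32) := by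
    have h2 := (le_min_iff.1 hc.η0_le_LF).2
    rw [hLF, Params.smoothF, le_div_iff₀ (by positivity)] at h2
    have h3 : (p.lipGrad * h.η0) ^ 2 ≤ (h.β0 / 32) ^ 2 :=
      pow_le_pow_left₀ (by positivity) (by linarith) 2
    calc 2 / h.β0 * (p.lipGrad * h.η0) ^ 2 ≤ 2 / h.β0 * (h.β0 / 32) ^ 2 :=
          mul_le_mul_of_nonneg_left h3 (by positivity)
      _ = h.β0 * (1 / 512) := by field_simp; ring
      _ ≤ _ := by linarith
  have h2 : h.β0 ^ 2 * (p.varDir σ / (min s b : ℕ)) ≤ h.β0 * (ε ^ 2 / 12) := by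
    have h3 := hc.β0_le
    rw [hC4, Params.constVar, le_div_iff₀ (by positivity)] at h3
    rw [sq, mul_assoc]
    refine mul_le_mul_of_nonneg_left ?_ hβ.le
    rw [mul_div_assoc', div_le_div_iff₀ hmin (by norm_num)]
    nlinarith
  have h3 : 2 * h.β0 * ((m : ℝ)⁻¹ * (3 * p.lipDir ^ 2
      * (∑ t ∈ Finset.range T, ∫ ω, P.δα (P.iter p.Γ h I B S₀ (t + 1) ω) ∂μ
        + ∑ t ∈ Finset.range T, ∫ ω, P.δy (P.iter p.Γ h I B S₀ (t + 1) ω) ∂μ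
        + ∑ t ∈ Finset.range T, ∫ ω, P.δv (P.iter p.Γ h I B S₀ (t + 1) ω) ∂μ)))
      ≤ h.β0 * (p.biasC * ((m : ℝ)⁻¹ * A + (m : ℝ)⁻¹ * Y + (m : ℝ)⁻¹ * V)) := by
    have e : h.β0 * (p.biasC * ((m : ℝ)⁻¹ * A + (m : ℝ)⁻¹ * Y + (m : ℝ)⁻¹ * V))
        = 2 * h.β0 * ((m : ℝ)⁻¹ * (3 * p.lipDir ^ 2 * (A + Y + V))) := by
      rw [Params.biasC]; ring
    rw [e]
    gcongr
  refine le_of_mul_le_mul_left (hsum.trans ?_) hβ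
  have h4 := mul_le_mul h1 hzle (Finset.sum_nonneg fun t _ => hz0 t) (by positivity)
  have h5 := mul_le_mul_of_nonneg_left h2 (Nat.cast_nonneg (α := ℝ) T)
  have h6 : 0 ≤ h.β0 * ε ^ 2 := by positivity
  simp only [zero_add]
  linarith

end Sums

end Problem

/-! ### Elimination of the couplings and the final guarantee. -/

/-- The couplings are triangular. Eliminating `V` raises the weight of `A + Y` to `3D(1 + R₃)`,
eliminating `A` raises that of `Y` to `3D(1 + R₃)(1 + R₁)`, and each of the three stages costs one
`W`. -/
theorem mul_add_add_le_of_cascade {D R₁ R₃ κ₁ κ₃ A Y V W : ℝ} (hκ₁ : 0 < κ₁) (hκ₃ : 0 < κ₃)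
    (hY : 3 * D * (1 + R₃) * (1 + R₁) * Y ≤ W)
    (hA : 3 * D * (1 + R₃) * κ₁ * A ≤ κ₁ * W + 3 * D * (1 + R₃) * κ₁ * (R₁ * Y))
    (hV : 3 * D * κ₃ * V ≤ κ₃ * W + 3 * D * κ₃ * (R₃ * (A + Y))) :
    D * (A + Y + V) ≤ W := by
  have h1 : 3 * D * (1 + R₃) * A ≤ W + 3 * D * (1 + R₃) * (R₁ * Y) :=
    le_of_mul_le_mul_left (by linarith) hκ₁
  have h3 : 3 * D * V ≤ W + 3 * D * (R₃ * (A + Y)) :=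
    le_of_mul_le_mul_left (by linarith) hκ₃
  linarith

theorem div_mul_le_of_one_le_mul {X κ c q M T : ℝ} (hX : X ≤ κ) (hκ : 0 ≤ κ) (hc : 0 < c)
    (hq : 0 < q) (hM : 1 ≤ q * M) (hT : κ / c * M ≤ T) : X / (c * q) ≤ T := by
  refine le_trans ?_ hT
  rw [div_le_iff₀ (mul_pos hc hq)]
  calc X ≤ κ * 1 := by linarith
    _ ≤ κ * (q * M) := mul_le_mul_of_nonneg_left hM hκ
    _ = κ / c * M * (c * q) := by field_simp

namespace Problem

variable {m dX dA dY b s : ℕ} {Ξ : Fin m → Type u} [∀ i, MeasurableSpace (Ξ i)]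
  {P : Problem m dX dA dY b Ξ} {p : Params} {σ : ℝ}

section Conclusion

variable {Ω : Type w}
  {I : ℕ → Ω → Finset (Fin m)} {B : ℕ → Ω → ∀ i, Fin b → Ξ i} {S₀ : State m dX dA dY}
  {h : StepSizes} {ε ΔF : ℝ} {T : ℕ} {τ : Ω → ℕ}

theorem norm_gradient_sub_z_sq (Γ : ℝ) (t : ℕ) (ω : Ω) :
    ‖gradient P.F (P.iter Γ h I B S₀ t ω).x - (P.iter Γ h I B S₀ (t + 1) ω).z‖ ^ 2
      = P.err h.η0 (P.iter Γ h I B S₀ (t + 1) ω) := by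
  have hx : (P.iter Γ h I B S₀ (t + 1) ω).x + h.η0 • (P.iter Γ h I B S₀ (t + 1) ω).z
      = (P.iter Γ h I B S₀ t ω).x := step_x_add _ _ _ _ _
  rw [norm_sub_rev, err, hx]

variable [mΩ : MeasurableSpace Ω] {μ : Measure Ω} [IsProbabilityMeasure μ]

theorem integrable_gradient_sq (R : Run P p σ s μ I B S₀ h) (t : ℕ) :
    Integrable (fun ω => ‖gradient P.F (P.iter p.Γ h I B S₀ t ω).x‖ ^ 2) μ := by
  have hit := measurable_iter R.structural R.oracle h R.sampling (S₀ := S₀) t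
  refine (integrable_const (p.boundDir ^ 2)).mono'
    (((continuous_gradient_F R.structural R.m_pos).measurable.comp
      (State.measurable_x.comp hit)).norm.pow_const 2).aestronglyMeasurable
    (Filter.Eventually.of_forall fun ω => ?_)
  rw [Real.norm_of_nonneg (sq_nonneg _)]
  exact pow_le_pow_left₀ (norm_nonneg _) (R.structural.norm_gradient_F_le R.m_pos _) 2

theorem sum_integral_gradient_sq_le (R : Run P p σ s μ I B S₀ h) (hη : h.η0 * p.lipGrad ≤ 1 / 8)
    (hF : ∀ x, P.F S₀.x - P.F x ≤ ΔF) (T : ℕ) :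
    ∑ t ∈ Finset.range T, ∫ ω, ‖gradient P.F (P.iter p.Γ h I B S₀ t ω).x‖ ^ 2 ∂μ
      ≤ 2 / h.η0 * ΔF
        + ∑ t ∈ Finset.range T, ∫ ω, P.err h.η0 (P.iter p.Γ h I B S₀ (t + 1) ω) ∂μ
        - 3 / 4 * ∑ t ∈ Finset.range T,
          ∫ ω, ‖(P.iter p.Γ h I B S₀ (t + 1) ω).z‖ ^ 2 ∂μ := by
  have hG : ∀ t ∈ Finset.range T, Integrable
      (fun ω => ‖gradient P.F (P.iter p.Γ h I B S₀ t ω).x‖ ^ 2) μ :=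
    fun t _ => integrable_gradient_sq R t
  have hE : ∀ t ∈ Finset.range T, Integrable
      (fun ω => P.err h.η0 (P.iter p.Γ h I B S₀ (t + 1) ω)) μ :=
    fun t _ => (R.integrable_all (t + 1)).2.2.2.2
  have hZ : ∀ t ∈ Finset.range T, Integrable
      (fun ω => ‖(P.iter p.Γ h I B S₀ (t + 1) ω).z‖ ^ 2) μ :=
    fun t _ => (R.integrable_all (t + 1)).2.2.2.1
  have hE' := integrable_finsetSum _ hE
  have hZ' := (integrable_finsetSum _ hZ).const_mul (3 / 4)
  have hC : Integrable (fun _ : Ω => 2 / h.η0 * ΔF) μ := integrable_const _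
  have key := integral_mono (integrable_finsetSum _ hG) ((hC.add hE').sub hZ') fun ω => by
    refine (R.sum_gradient_sq_le hη T ω).trans ?_
    have := mul_le_mul_of_nonneg_left (hF (P.iter p.Γ h I B S₀ T ω).x)
      (div_nonneg zero_le_two R.η0_pos.le)
    simp only [Pi.add_apply, Pi.sub_apply]
    linarith
  rw [integral_finsetSum _ hG, integral_sub' (hC.add hE') hZ', integral_add' hC hE',
    integral_const_mul (3 / 4 : ℝ), integral_finsetSum _ hE, integral_finsetSum _ hZ] at key
  simpa using key

/-- The momentum bound involves `Z` and the descent bound contains `-3Z/4`, so the two inequalities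
close on each other. -/
theorem guarantee_of_enoughIterations (R : Run P p σ s μ I B S₀ h) (hε : 0 < ε)
    (hc : StepConditions p p.smoothF p.constα p.consty p.constv (p.constVar σ) σ ε m s b h)
    (hF : ∀ x, P.F S₀.x - P.F x ≤ ΔF) (hτ : IsRandomIndex μ T τ I B)
    (hT : P.EnoughIterations p p.constα p.consty p.constv h s ε ΔF
      (∫ ω, ‖gradient P.F S₀.x - (P.iter p.Γ h I B S₀ 1 ω).z‖ ^ 2 ∂μ) S₀ T) :
    P.Guarantee μ (P.iter p.Γ h I B S₀) τ ε := by
  obtain ⟨hTF, hTe, hTα, hTv, hTy⟩ := hT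
  have hη0 := R.η0_pos
  have hβ := R.β0_pos
  have hLG := p.lipGrad_pos
  have he1 : ∫ ω, ‖gradient P.F S₀.x - (P.iter p.Γ h I B S₀ 1 ω).z‖ ^ 2 ∂μ
      = ∫ ω, P.err h.η0 (P.iter p.Γ h I B S₀ 1 ω) ∂μ :=
    integral_congr_ae (Filter.Eventually.of_forall fun ω => norm_gradient_sub_z_sq p.Γ 0 ω)
  rw [he1, div_le_iff₀ (by positivity)] at hTe
  rw [div_le_iff₀ (by positivity)] at hTF
  have hη : h.η0 * p.lipGrad ≤ 1 / 8 := by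
    have h1 := (le_min_iff.1 hc.η0_le_LF).1
    rw [Params.smoothF, le_div_iff₀ (by positivity)] at h1
    linarith
  have hy := sum_δy_le R hc hε p.consty_pos hTy
  have hα := sum_δα_le R hc hε p.constα_pos hTα
  have hv := sum_δv_le R hc hε p.constv_pos hTv
  have he := sum_err_le R hc hε rfl rfl hTe
  have hg := sum_integral_gradient_sq_le R hη hF (T + 1)
  have hbias := mul_add_add_le_of_cascade (lt_of_lt_of_le one_pos p.one_le_inflα)
    (lt_of_lt_of_le one_pos p.one_le_inflv) hy hα hv
  have hZ : 0 ≤ ∑ t ∈ Finset.range (T + 1), ∫ ω, ‖(P.iter p.Γ h I B S₀ (t + 1) ω).z‖ ^ 2 ∂μ :=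
    Finset.sum_nonneg fun t _ => integral_nonneg fun _ => sq_nonneg _
  have hG : 0 ≤ ∑ t ∈ Finset.range (T + 1),
      ∫ ω, ‖gradient P.F (P.iter p.Γ h I B S₀ t ω).x‖ ^ 2 ∂μ :=
    Finset.sum_nonneg fun t _ => integral_nonneg fun _ => sq_nonneg _
  have hN : 0 < ((T : ℝ) + 1) * ε ^ 2 := by positivity
  have hΔ : 2 / h.η0 * ΔF ≤ ((T : ℝ) + 1) * ε ^ 2 / 16 := by
    rw [div_mul_eq_mul_div (2 : ℝ), div_le_iff₀ hη0]
    nlinarith [mul_pos hη0 (pow_pos hε 2)]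
  have hit1 := integral_randomIndex R.structural R.oracle h (S₀ := S₀) hτ 0
    (Φ := fun S => ‖gradient P.F S.x‖ ^ 2)
    (((continuous_gradient_F R.structural R.m_pos).measurable.comp
      State.measurable_x).norm.pow_const 2) (integrable_gradient_sq R)
  have hit2 := integral_randomIndex R.structural R.oracle h (S₀ := S₀) hτ 1
    (measurable_err R.structural R.m_pos h.η0) (fun t => (R.integrable_all t).2.2.2.2)
  simp only [← norm_gradient_sub_z_sq] at hit2
  simp only [← norm_gradient_sub_z_sq] at he hg
  refine ⟨hit1.1, hit1.2.trans_le ?_, hit2.1, hit2.2.trans_lt ?_⟩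
  -- Per iteration `1/16 + 3/10 < 1` in units of `ε²`; the `Z` terms have total coefficient `1/16 -
  -- 3/4 < 0`.
  · rw [inv_mul_le_iff₀ (by positivity)]
    simp only [add_zero]
    linarith
  -- Dropping the nonnegative gradient sum `hG` from the descent bound controls `Z` by the momentum
  -- error, whose coefficient on the right is then only `1/12`.
  · rw [inv_mul_lt_iff₀ (by positivity)]
    linarith

end Conclusion

end Problem

/-! ### Admissibility of the scaled step sizes. -/

theorem stepConditions_scaledSteps {p : Params} {LF C1 C2 C3 C4 σ ε c0 c1 c2 c3 c4 : ℝ}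
    {m s b : ℕ} (hC1 : 0 < C1) (hC2 : 0 < C2) (hC3 : 0 < C3)
    (hs1 : 1 ≤ s) (hs : s ≤ m) (hb : 1 ≤ b) (hε : 0 < ε) (hbε : b * ε ^ 2 ≤ 1)
    (h0 : 0 < c0) (h1 : 0 < c1) (h2 : 0 < c2) (h3 : 0 < c3) (h4 : 0 < c4)
    (h1a : c1 ≤ p.μf / p.Lf ^ 2) (h1b : c1 ≤ 1 / p.μf) (h1c : c1 * (96 * C1 * p.μf * σ ^ 2) ≤ 1)
    (h2a : c2 ≤ p.μg / p.Lg ^ 2) (h2b : c2 ≤ 2 / p.μg) (h2c : c2 * (48 * C2 * σ ^ 2) ≤ p.μg)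
    (h3a : c3 ≤ p.μg / p.Lg ^ 2) (h3b : c3 ≤ 1 / p.μg) (h3c : c3 * (96 * C3 * p.μg * σ ^ 2) ≤ 1)
    (h4a : c4 ≤ 1) (h4b : c4 ≤ 1 / (12 * C4))
    (h0a : c0 ≤ 1 / (2 * LF)) (h0b : c0 ≤ c4 / (8 * LF))
    (h0v : c0 ≤ c3 * p.μg / (32 * p.Cv * √C3)) (h0α : c0 ≤ c1 * p.μf / (32 * p.Cα * √C1))
    (h0y : c0 ≤ c2 * p.μg / (16 * p.Cy * √C2)) :
    StepConditions p LF C1 C2 C3 C4 σ ε m s b (scaledSteps c0 c1 c2 c3 c4 m s b ε) := by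
  have hs0 : (0 : ℝ) < s := by exact_mod_cast hs1
  have hm0 : (0 : ℝ) < m := by exact_mod_cast hs1.trans hs
  have hsm : (s : ℝ) ≤ m := by exact_mod_cast hs
  have hb0 : (0 : ℝ) < b := by exact_mod_cast hb
  have hk0 : (0 : ℝ) < (min s b : ℕ) := by exact_mod_cast lt_min hs1 hb
  have hkb : ((min s b : ℕ) : ℝ) ≤ b := by exact_mod_cast min_le_right s b
  set k : ℝ := ((min s b : ℕ) : ℝ) with hk
  have hkε : k * ε ^ 2 ≤ 1 := (mul_le_mul_of_nonneg_right hkb (sq_nonneg ε)).trans hbε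
  have hμf := p.μf_pos
  have hμg := p.μg_pos
  have hCy := p.Cy_pos
  have hCα := p.Cα_pos
  have hCv : 0 < p.Cv := p.Cy_pos
  have q1 := Real.sqrt_pos.2 hC1
  have q2 := Real.sqrt_pos.2 hC2
  have q3 := Real.sqrt_pos.2 hC3
  have hle : ∀ {c r d : ℝ}, 0 < c → r ≤ 1 → c ≤ d → c * r ≤ d := fun hc hr hd =>
    (mul_le_of_le_one_right hc.le hr).trans hd
  have hratio : ∀ {a μ : ℝ}, 0 < a → 0 < μ → a / μ ≤ a * m / (μ * s) := fun {a μ} ha hμ => by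
    rw [div_le_div_iff₀ hμ (by positivity)]
    nlinarith [mul_le_mul_of_nonneg_left hsm (mul_pos ha hμ).le]
  have hfour : ∀ {μ : ℝ}, 0 < μ → 1 / μ ≤ 4 * m / (μ * s) := fun {μ} hμ =>
    (div_le_div_of_nonneg_right (by norm_num) hμ.le).trans (hratio four_pos hμ)
  -- The second entry `b s ε² / m` of the minimum in `η₀` matches the factor `s / m` in the
  -- conditions relating `η₀` to a block step size.
  have hblock : ∀ {c d A D q : ℝ}, c ≤ d * A / (D * q) → 0 < D → 0 < q →
      c * min (k * ε ^ 2) (b * s * ε ^ 2 / m) ≤ d * (b * ε ^ 2) * A * s / (D * m * q) ∨ c < 0 :=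
    fun {c d A D q} hc hD hq => by
      rcases lt_or_ge c 0 with h | h
      · exact Or.inr h
      refine Or.inl ((mul_le_mul_of_nonneg_left (min_le_right _ _) h).trans ?_)
      refine (mul_le_mul_of_nonneg_right hc (by positivity)).trans_eq ?_
      field_simp
  refine
    { η0_pos := ?_
      η1_pos := mul_pos h1 (by positivity)
      η2_pos := mul_pos h2 (by positivity)
      η3_pos := mul_pos h3 (by positivity)
      β0_pos := mul_pos h4 (by positivity)
      β0_le_one := hle h4 hkε h4a
      η1_le := le_min (hle h1 hbε h1a) (le_min (hle h1 hbε h1b) (hle h1 hbε (h1b.trans (hfour hμf))))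
      η1_noise := ?_
      η3_le := le_min (hle h3 hbε h3a) (le_min (hle h3 hbε h3b) (hle h3 hbε (h3b.trans (hfour hμg))))
      η3_noise := ?_
      η2_le := le_min (hle h2 hbε h2a) (hle h2 hbε (h2b.trans ?_))
      η2_noise := ?_
      β0_le := ?_
      η0_le_LF := le_min ?_ ?_
      η0_le_v := ?_
      η0_le_α := ?_
      η0_le_y := ?_ }
  · exact mul_pos h0 (lt_min (by positivity) (by positivity))
  · calc c1 * (b * ε ^ 2) * (96 * C1 * p.μf * σ ^ 2)
        = c1 * (96 * C1 * p.μf * σ ^ 2) * (b * ε ^ 2) := by ring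
      _ ≤ 1 * (b * ε ^ 2) := mul_le_mul_of_nonneg_right h1c (by positivity)
      _ = _ := one_mul _
  · calc c3 * (b * ε ^ 2) * (96 * C3 * p.μg * σ ^ 2)
        = c3 * (96 * C3 * p.μg * σ ^ 2) * (b * ε ^ 2) := by ring
      _ ≤ 1 * (b * ε ^ 2) := mul_le_mul_of_nonneg_right h3c (by positivity)
      _ = _ := one_mul _
  · rw [mul_comm (s : ℝ)]
    exact hratio two_pos hμg
  · calc c2 * (b * ε ^ 2) * (48 * C2 * σ ^ 2)
        = c2 * (48 * C2 * σ ^ 2) * (b * ε ^ 2) := by ring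
      _ ≤ p.μg * (b * ε ^ 2) := mul_le_mul_of_nonneg_right h2c (by positivity)
      _ = _ := by ring
  · refine (mul_le_mul_of_nonneg_right h4b (by positivity)).trans_eq ?_
    ring
  · exact hle h0 ((min_le_left _ _).trans hkε) h0a
  · refine (mul_le_mul_of_nonneg_left (min_le_left _ _) h0.le).trans
      ((mul_le_mul_of_nonneg_right h0b (by positivity)).trans_eq ?_)
    simp only [scaledSteps]
    ring
  · refine ((hblock h0v (by positivity) q3).resolve_right h0.not_gt).trans_eq ?_
    simp only [scaledSteps]
    ring
  · refine ((hblock h0α (by positivity) q1).resolve_right h0.not_gt).trans_eq ?_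
    simp only [scaledSteps]
    ring
  · refine ((hblock h0y (by positivity) q2).resolve_right h0.not_gt).trans_eq ?_
    simp only [scaledSteps]
    ring

/-- Constants for `scaledSteps` that are compatible with the step-size conditions. -/
theorem exists_scaledSteps_constants (p : Params) {LF C1 C2 C3 C4 : ℝ} (σ : ℝ) (hLF : 0 < LF)
    (hC1 : 0 < C1) (hC2 : 0 < C2) (hC3 : 0 < C3) (hC4 : 0 < C4) :
    ∃ c0 c1 c2 c3 c4 : ℝ, 0 < c0 ∧ 0 < c1 ∧ 0 < c2 ∧ 0 < c3 ∧ 0 < c4 ∧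
      ∀ (m s b : ℕ) (ε : ℝ), 1 ≤ s → s ≤ m → 1 ≤ b → 0 < ε → b * ε ^ 2 ≤ 1 →
        StepConditions p LF C1 C2 C3 C4 σ ε m s b (scaledSteps c0 c1 c2 c3 c4 m s b ε) := by
  have hμf := p.μf_pos
  have hμg := p.μg_pos
  have hLf := p.Lf_pos
  have hLg := p.Lg_pos
  have hCy := p.Cy_pos
  have hCα := p.Cα_pos
  have hCv : 0 < p.Cv := p.Cy_pos
  have q1 := Real.sqrt_pos.2 hC1
  have q2 := Real.sqrt_pos.2 hC2
  have q3 := Real.sqrt_pos.2 hC3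
  -- The `+ 1` in the denominator keeps the bound meaningful when `σ = 0`.
  have hnoise : ∀ {c x a : ℝ}, 0 ≤ x → 0 ≤ a → c ≤ a / (x + 1) → c * x ≤ a := fun {c x a} hx ha hc => by
    refine (mul_le_mul_of_nonneg_right hc hx).trans ?_
    rw [div_mul_eq_mul_div, div_le_iff₀ (by positivity)]
    nlinarith
  obtain ⟨c1, h1, h1a, h1b, h1c⟩ : ∃ c1 : ℝ, 0 < c1 ∧ c1 ≤ p.μf / p.Lf ^ 2 ∧ c1 ≤ 1 / p.μf ∧
      c1 ≤ 1 / (96 * C1 * p.μf * σ ^ 2 + 1) :=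
    ⟨min (p.μf / p.Lf ^ 2) (min (1 / p.μf) (1 / (96 * C1 * p.μf * σ ^ 2 + 1))),
      lt_min (by positivity) (lt_min (by positivity) (by positivity)), min_le_left _ _,
      (min_le_right _ _).trans (min_le_left _ _), (min_le_right _ _).trans (min_le_right _ _)⟩
  obtain ⟨c2, h2, h2a, h2b, h2c⟩ : ∃ c2 : ℝ, 0 < c2 ∧ c2 ≤ p.μg / p.Lg ^ 2 ∧ c2 ≤ 2 / p.μg ∧
      c2 ≤ p.μg / (48 * C2 * σ ^ 2 + 1) :=
    ⟨min (p.μg / p.Lg ^ 2) (min (2 / p.μg) (p.μg / (48 * C2 * σ ^ 2 + 1))),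
      lt_min (by positivity) (lt_min (by positivity) (by positivity)), min_le_left _ _,
      (min_le_right _ _).trans (min_le_left _ _), (min_le_right _ _).trans (min_le_right _ _)⟩
  obtain ⟨c3, h3, h3a, h3b, h3c⟩ : ∃ c3 : ℝ, 0 < c3 ∧ c3 ≤ p.μg / p.Lg ^ 2 ∧ c3 ≤ 1 / p.μg ∧
      c3 ≤ 1 / (96 * C3 * p.μg * σ ^ 2 + 1) :=
    ⟨min (p.μg / p.Lg ^ 2) (min (1 / p.μg) (1 / (96 * C3 * p.μg * σ ^ 2 + 1))),
      lt_min (by positivity) (lt_min (by positivity) (by positivity)), min_le_left _ _,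
      (min_le_right _ _).trans (min_le_left _ _), (min_le_right _ _).trans (min_le_right _ _)⟩
  obtain ⟨c4, h4, h4a, h4b⟩ : ∃ c4 : ℝ, 0 < c4 ∧ c4 ≤ 1 ∧ c4 ≤ 1 / (12 * C4) :=
    ⟨min 1 (1 / (12 * C4)), lt_min one_pos (by positivity), min_le_left _ _, min_le_right _ _⟩
  -- `c0` comes last, since it must be small relative to `c1`, `c2`, `c3` and `c4`.
  obtain ⟨c0, h0, h0a, h0b, h0v, h0α, h0y⟩ : ∃ c0 : ℝ, 0 < c0 ∧ c0 ≤ 1 / (2 * LF) ∧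
      c0 ≤ c4 / (8 * LF) ∧ c0 ≤ c3 * p.μg / (32 * p.Cv * √C3) ∧
      c0 ≤ c1 * p.μf / (32 * p.Cα * √C1) ∧ c0 ≤ c2 * p.μg / (16 * p.Cy * √C2) :=
    ⟨min (min (1 / (2 * LF)) (c4 / (8 * LF))) (min (c3 * p.μg / (32 * p.Cv * √C3))
        (min (c1 * p.μf / (32 * p.Cα * √C1)) (c2 * p.μg / (16 * p.Cy * √C2)))),
      lt_min (lt_min (by positivity) (by positivity))
        (lt_min (by positivity) (lt_min (by positivity) (by positivity))),
      (min_le_left _ _).trans (min_le_left _ _), (min_le_left _ _).trans (min_le_right _ _),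
      (min_le_right _ _).trans (min_le_left _ _),
      (min_le_right _ _).trans ((min_le_right _ _).trans (min_le_left _ _)),
      (min_le_right _ _).trans ((min_le_right _ _).trans (min_le_right _ _))⟩
  exact ⟨c0, c1, c2, c3, c4, h0, h1, h2, h3, h4, fun m s b ε hs1 hs hb hε hbε =>
    stepConditions_scaledSteps hC1 hC2 hC3 hs1 hs hb hε hbε h0 h1 h2 h3 h4
      h1a h1b (hnoise (by positivity) zero_le_one h1c) h2a h2b
      (hnoise (by positivity) hμg.le h2c) h3a h3b (hnoise (by positivity) zero_le_one h3c)
      h4a h4b h0a h0b h0v h0α h0y⟩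

/-! ### Initial error and iteration complexity. -/

namespace Params

/-- A bound for the error of the first momentum in terms of a bound `D` for the initial data. -/
def initErr (p : Params) (σ D : ℝ) : ℝ :=
  3 * D + 2 * p.boundDir ^ 2 + 18 * p.lipDir ^ 2 * D + p.varDir σ

theorem initErr_nonneg (p : Params) (σ : ℝ) {D : ℝ} (hD : 0 ≤ D) : 0 ≤ p.initErr σ D := by
  have := p.varDir_nonneg σ
  unfold initErr; positivity

end Params

namespace Problem

variable {m dX dA dY b s : ℕ} {Ξ : Fin m → Type u} [∀ i, MeasurableSpace (Ξ i)]
  {P : Problem m dX dA dY b Ξ} {p : Params} {σ : ℝ}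

section Complexity

variable {Ω : Type w} [mΩ : MeasurableSpace Ω] {μ : Measure Ω} [IsProbabilityMeasure μ]
  {I : ℕ → Ω → Finset (Fin m)} {B : ℕ → Ω → ∀ i, Fin b → Ξ i} {S₀ : State m dX dA dY}
  {h : StepSizes} {D : ℝ}

/-- The momentum recursion is applied once from time 0, where the error compares `z₀` with the
gradient at the fictitious earlier point `x₀ + η₀ z₀`; boundedness of `∇F` controls it. The bound
does not depend on `m`, `s`, `b` or `ε`. -/
theorem integral_norm_gradient_sub_z_one_le (R : Run P p σ s μ I B S₀ h)
    (hη : h.η0 ≤ h.β0 / (8 * p.smoothF)) (hz : ‖S₀.z‖ ^ 2 ≤ D) (hα : P.δα S₀ ≤ m * D)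
    (hy : P.δy S₀ ≤ m * D) (hv : P.δv S₀ ≤ m * D) :
    ∫ ω, ‖gradient P.F S₀.x - (P.iter p.Γ h I B S₀ 1 ω).z‖ ^ 2 ∂μ ≤ p.initErr σ D := by
  have hm : (0 : ℝ) < m := by exact_mod_cast R.m_pos
  have hβ := R.β0_pos
  have hβ1 := R.β0_le_one
  have hη0 := R.η0_pos
  have hLG := p.lipGrad_pos
  have hvar := p.varDir_nonneg σ
  have hD : 0 ≤ D := (sq_nonneg _).trans hz
  have hmin : (1 : ℝ) ≤ (min s b : ℕ) := by exact_mod_cast le_min R.s_pos R.b_pos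
  have he1 : ∫ ω, ‖gradient P.F S₀.x - (P.iter p.Γ h I B S₀ 1 ω).z‖ ^ 2 ∂μ
      = ∫ ω, P.err h.η0 (P.iter p.Γ h I B S₀ 1 ω) ∂μ :=
    integral_congr_ae (Filter.Eventually.of_forall fun ω => norm_gradient_sub_z_sq p.Γ 0 ω)
  obtain ⟨ia, iy, iv, iz, ie⟩ := R.integrable_all 0
  have h1 := (R.err_succ 0 ia iy iv iz ie).2
  simp only [iter, integral_const, probReal_univ, one_smul] at h1
  have herr : P.err h.η0 S₀ ≤ 2 * D + 2 * p.boundDir ^ 2 := by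
    have hg : ‖gradient P.F (S₀.x + h.η0 • S₀.z)‖ ^ 2 ≤ p.boundDir ^ 2 :=
      pow_le_pow_left₀ (norm_nonneg _) (R.structural.norm_gradient_F_le R.m_pos _) 2
    have hsub := pow_le_pow_left₀ (norm_nonneg _)
      (norm_sub_le S₀.z (gradient P.F (S₀.x + h.η0 • S₀.z))) 2
    unfold err
    nlinarith [sq_nonneg (‖S₀.z‖ - ‖gradient P.F (S₀.x + h.η0 • S₀.z)‖)]
  have t1 : (1 - h.β0) * P.err h.η0 S₀ ≤ 2 * D + 2 * p.boundDir ^ 2 :=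
    (mul_le_of_le_one_left (err_nonneg _ _) (by linarith)).trans herr
  have t2 : 2 / h.β0 * (p.lipGrad * h.η0) ^ 2 * ‖S₀.z‖ ^ 2 ≤ D := by
    rw [Params.smoothF, le_div_iff₀ (by positivity)] at hη
    have h3 : (p.lipGrad * h.η0) ^ 2 ≤ (h.β0 / 32) ^ 2 :=
      pow_le_pow_left₀ (by positivity) (by linarith) 2
    refine (mul_le_of_le_one_left (sq_nonneg _) ?_).trans hz
    rw [div_mul_eq_mul_div (2 : ℝ), div_le_one hβ]
    nlinarith
  have t3 : 2 * h.β0 * ((m : ℝ)⁻¹ * (3 * p.lipDir ^ 2 * (P.δα S₀ + P.δy S₀ + P.δv S₀)))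
      ≤ 18 * p.lipDir ^ 2 * D := by
    calc _ ≤ 2 * 1 * ((m : ℝ)⁻¹ * (3 * p.lipDir ^ 2 * (m * D + m * D + m * D))) := by
          have := δα_nonneg (P := P) S₀; have := δy_nonneg (P := P) S₀
          have := δv_nonneg (P := P) S₀
          gcongr
      _ = _ := by field_simp; ring
  have t4 : h.β0 ^ 2 * (p.varDir σ / (min s b : ℕ)) ≤ p.varDir σ :=
    (mul_le_of_le_one_left (by positivity) (pow_le_one₀ hβ.le hβ1)).trans (div_le_self hvar hmin)
  rw [he1, Params.initErr]
  simp only [iter]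
  linarith

end Complexity

variable {S₀ : State m dX dA dY} {C1 C2 C3 c0 c1 c2 c3 c4 ε D E e₀ : ℝ} {T : ℕ}

/-- Up to constants every requirement is `m/(s b ε⁴)` or `1/(min(s,b) ε⁴)`: the block errors are
bounded by `m D`, and the factor `m` cancels against their normalisation. Adding the constants meets
all five requirements at once. -/
theorem enoughIterations_scaledSteps (hC1 : 0 < C1) (hC2 : 0 < C2) (hC3 : 0 < C3)
    (h0 : 0 < c0) (h1 : 0 < c1) (h2 : 0 < c2) (h3 : 0 < c3) (h4 : 0 < c4)
    (hm : 1 ≤ m) (hs : 1 ≤ s) (hb : 1 ≤ b) (hε : 0 < ε) (hD : 0 ≤ D) (hE : 0 ≤ E) (he : e₀ ≤ E)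
    (hα : P.δα S₀ ≤ m * D) (hy : P.δy S₀ ≤ m * D) (hv : P.δv S₀ ≤ m * D)
    (hT : (1 + (32 * D / c0 + (15 * E / c4 + (60 * C1 * D / (p.μf * c1)
        + (60 * C3 * D / (p.μg * c3) + 30 * C2 * D / (p.μg * c2))))))
      * max (m / (s * b * ε ^ 4)) (1 / ((min s b : ℕ) * ε ^ 4)) ≤ T) :
    P.EnoughIterations p C1 C2 C3 (scaledSteps c0 c1 c2 c3 c4 m s b ε) s ε D e₀ S₀ T := by
  have hs0 : (0 : ℝ) < s := by exact_mod_cast hs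
  have hm0 : (0 : ℝ) < m := by exact_mod_cast hm
  have hb0 : (0 : ℝ) < b := by exact_mod_cast hb
  have hk0 : (0 : ℝ) < (min s b : ℕ) := by exact_mod_cast lt_min hs hb
  set k : ℝ := ((min s b : ℕ) : ℝ) with hk
  set M : ℝ := max (m / (s * b * ε ^ 4)) (1 / (k * ε ^ 4)) with hM
  have hM1 : m / (s * b * ε ^ 4) ≤ M := le_max_left _ _
  have hM2 : 1 / (k * ε ^ 4) ≤ M := le_max_right _ _
  have hM0 : 0 < M := lt_of_lt_of_le (by positivity) hM1
  have hμf := p.μf_pos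
  have hμg := p.μg_pos
  have q1 : 1 ≤ s * b * ε ^ 4 / m * M := by
    rw [div_le_iff₀ (by positivity)] at hM1
    rw [div_mul_eq_mul_div, le_div_iff₀ hm0]; linarith
  have q2 : 1 ≤ k * ε ^ 4 * M := by
    rw [div_le_iff₀ (by positivity)] at hM2; linarith
  have a0 : 0 ≤ 32 * D / c0 * M := by positivity
  have a1 : 0 ≤ 15 * E / c4 * M := by positivity
  have a2 : 0 ≤ 60 * C1 * D / (p.μf * c1) * M := by positivity
  have a3 : 0 ≤ 60 * C3 * D / (p.μg * c3) * M := by positivity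
  have a4 : 0 ≤ 30 * C2 * D / (p.μg * c2) * M := by positivity
  simp only [add_mul] at hT
  have hdiv : ∀ {C δ : ℝ}, 0 < C → δ ≤ m * D → C * (δ / m) ≤ C * D := fun hC hδ =>
    mul_le_mul_of_nonneg_left ((div_le_iff₀' hm0).2 hδ) hC.le
  refine ⟨?_, ?_, ?_, ?_, ?_⟩ <;> simp only [scaledSteps, ← hk]
  · rw [mul_assoc]
    refine div_mul_le_of_one_le_mul (M := M) le_rfl (by positivity) h0
      (mul_pos (lt_min (by positivity) (by positivity)) (by positivity)) ?_ (by linarith)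
    -- Whichever entry of the minimum defines `η₀`, the corresponding entry of the maximum dominates
    -- its reciprocal.
    rcases min_choice (k * ε ^ 2) (b * s * ε ^ 2 / m) with h | h <;> rw [h]
    · exact q2.trans_eq (by ring)
    · exact q1.trans_eq (by ring)
  · rw [mul_assoc]
    refine div_mul_le_of_one_le_mul (M := M) (mul_le_mul_of_nonneg_left he (by norm_num)) (by positivity) h4
      (by positivity) (q2.trans_eq (by ring)) (by linarith)
  · have e : 60 * C1 * P.δα S₀ / (p.μf * s * (c1 * (b * ε ^ 2)) * ε ^ 2)
        = 60 * C1 * (P.δα S₀ / m) / (p.μf * c1 * (s * b * ε ^ 4 / m)) := by field_simp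
    rw [e]
    exact div_mul_le_of_one_le_mul (M := M) (hdiv (by positivity) hα) (by positivity) (by positivity)
      (by positivity) q1 (by linarith)
  · have e : 60 * C3 * P.δv S₀ / (c3 * (b * ε ^ 2) * p.μg * s * ε ^ 2)
        = 60 * C3 * (P.δv S₀ / m) / (p.μg * c3 * (s * b * ε ^ 4 / m)) := by field_simp
    rw [e]
    exact div_mul_le_of_one_le_mul (M := M) (hdiv (by positivity) hv) (by positivity) (by positivity)
      (by positivity) q1 (by linarith)
  · have e : 30 * C2 * P.δy S₀ / (s * (c2 * (b * ε ^ 2)) * p.μg * ε ^ 2)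
        = 30 * C2 * (P.δy S₀ / m) / (p.μg * c2 * (s * b * ε ^ 4 / m)) := by field_simp
    rw [e]
    exact div_mul_le_of_one_le_mul (M := M) (hdiv (by positivity) hy) (by positivity) (by positivity)
      (by positivity) q1 (by linarith)

end Problem

end MinMaxBilevel

end

/-! ### The main theorem. -/

theorem mainTheorem2 (p : MinMaxBilevel.Params) :
    -- constants depending only on the structural parameters, and `C4` also on `σ`
    ∃ LF C1 C2 C3 : ℝ, 0 < LF ∧ 0 < C1 ∧ 0 < C2 ∧ 0 < C3 ∧ ∀ σ : ℝ, 0 ≤ σ → ∃ C4 : ℝ, 0 < C4 ∧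
    -- detailed form, with explicit step-size conditions
    (∀ (m dX dA dY s b : ℕ) (Ξ : Fin m → Type u) [∀ i, MeasurableSpace (Ξ i)]
        (P : MinMaxBilevel.Problem m dX dA dY b Ξ),
      1 ≤ s → s ≤ m → 1 ≤ b →
      P.StructuralAssumptions p → P.OracleAssumptions σ →
      Differentiable ℝ P.F ∧
      (∀ x x', ‖gradient P.F x - gradient P.F x'‖ ≤ LF * ‖x - x'‖) ∧
      ∀ (Ω : Type w) [MeasurableSpace Ω] (μ : Measure Ω) [IsProbabilityMeasure μ]
        (I : ℕ → Ω → Finset (Fin m)) (B : ℕ → Ω → ∀ i, Fin b → Ξ i)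
        (S₀ : MinMaxBilevel.State m dX dA dY) (h : MinMaxBilevel.StepSizes)
        (ε ΔF : ℝ) (T : ℕ) (τ : Ω → ℕ),
        P.IsSampling μ s I B → MinMaxBilevel.IsRandomIndex μ T τ I B →
        P.AdmissibleInit p.Γ S₀ → (∀ x, P.F S₀.x - P.F x ≤ ΔF) → 0 < ε →
        MinMaxBilevel.StepConditions p LF C1 C2 C3 C4 σ ε m s b h →
        P.EnoughIterations p C1 C2 C3 h s ε ΔF
          (∫ ω, ‖gradient P.F S₀.x - (P.iter p.Γ h I B S₀ 1 ω).z‖ ^ 2 ∂μ) S₀ T →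
        P.Guarantee μ (P.iter p.Γ h I B S₀) τ ε) ∧
    -- iteration complexity
    (∃ c0 c1 c2 c3 c4 : ℝ, 0 < c0 ∧ 0 < c1 ∧ 0 < c2 ∧ 0 < c3 ∧ 0 < c4 ∧ ∀ D : ℝ, ∃ K : ℝ, 0 < K ∧
      ∀ (m dX dA dY s b : ℕ) (Ξ : Fin m → Type u) [∀ i, MeasurableSpace (Ξ i)]
        (P : MinMaxBilevel.Problem m dX dA dY b Ξ)
        (Ω : Type w) [MeasurableSpace Ω] (μ : Measure Ω) [IsProbabilityMeasure μ]
        (I : ℕ → Ω → Finset (Fin m)) (B : ℕ → Ω → ∀ i, Fin b → Ξ i)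
        (S₀ : MinMaxBilevel.State m dX dA dY) (ε : ℝ) (T : ℕ) (τ : Ω → ℕ),
      1 ≤ s → s ≤ m → 1 ≤ b →
      P.StructuralAssumptions p → P.OracleAssumptions σ →
      P.IsSampling μ s I B → MinMaxBilevel.IsRandomIndex μ T τ I B →
      P.AdmissibleInit p.Γ S₀ → (∀ x, P.F S₀.x - P.F x ≤ D) →
      ‖S₀.z‖ ^ 2 ≤ D → P.δα S₀ ≤ m * D → P.δy S₀ ≤ m * D → P.δv S₀ ≤ m * D →
      0 < ε → b * ε ^ 2 ≤ 1 →
      K * max (m / (s * b * ε ^ 4)) (1 / ((min s b : ℕ) * ε ^ 4)) ≤ T →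
      P.Guarantee μ
        (P.iter p.Γ (MinMaxBilevel.scaledSteps c0 c1 c2 c3 c4 m s b ε) I B S₀) τ ε) := by
  refine ⟨p.smoothF, p.constα, p.consty, p.constv, p.smoothF_pos, p.constα_pos, p.consty_pos,
    p.constv_pos, fun σ _ => ⟨p.constVar σ, p.constVar_pos σ, ?_, ?_⟩⟩
  · intro m dX dA dY s b Ξ _ P hs1 hs hb H O
    refine ⟨H.differentiable_F, fun x x' => (H.gradient_F_lipschitz (hs1.trans hs) x x').trans ?_, ?_⟩
    · have := p.lipGrad_pos
      refine mul_le_mul_of_nonneg_right ?_ (norm_nonneg _)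
      unfold MinMaxBilevel.Params.smoothF
      linarith
    · intro Ω _ μ _ I B S₀ h ε ΔF T τ hI hτ hS hF hε hc hT
      exact MinMaxBilevel.Problem.guarantee_of_enoughIterations
        (MinMaxBilevel.Problem.run_of_stepConditions H O hI hS hs1 hs hb hc) hε hc hF hτ hT
  · obtain ⟨c0, c1, c2, c3, c4, h0, h1, h2, h3, h4, hsteps⟩ :=
      MinMaxBilevel.exists_scaledSteps_constants p σ p.smoothF_pos p.constα_pos p.consty_pos
        p.constv_pos (p.constVar_pos σ)
    -- `K` must be positive for every real `D`, hence the absolute values and the leading 1; the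
    -- hypothesis on `‖S₀.z‖` later forces `0 ≤ D`.
    refine ⟨c0, c1, c2, c3, c4, h0, h1, h2, h3, h4, fun D =>
      ⟨1 + (32 * |D| / c0 + (15 * p.initErr σ |D| / c4 + (60 * p.constα * |D| / (p.μf * c1)
        + (60 * p.constv * |D| / (p.μg * c3) + 30 * p.consty * |D| / (p.μg * c2))))), ?_, ?_⟩⟩
    · have := p.initErr_nonneg σ (abs_nonneg D)
      have := p.constα_pos; have := p.constv_pos; have := p.consty_pos
      have := p.μf_pos; have := p.μg_pos
      positivity
    · intro m dX dA dY s b Ξ _ P Ω _ μ _ I B S₀ ε T τ hs1 hs hb H O hI hτ hS hF hz hα hy hv hε hbε hT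
      have hD : 0 ≤ D := (sq_nonneg _).trans hz
      rw [abs_of_nonneg hD] at hT
      have hc := hsteps m s b ε hs1 hs hb hε hbε
      have R := MinMaxBilevel.Problem.run_of_stepConditions H O hI hS hs1 hs hb hc
      exact MinMaxBilevel.Problem.guarantee_of_enoughIterations R hε hc hF hτ
        (MinMaxBilevel.Problem.enoughIterations_scaledSteps p.constα_pos p.consty_pos p.constv_pos
          h0 h1 h2 h3 h4 (hs1.trans hs) hs1 hb hε hD (p.initErr_nonneg σ hD)
          (MinMaxBilevel.Problem.integral_norm_gradient_sub_z_one_le R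
            (le_min_iff.1 hc.η0_le_LF).2 hz hα hy hv) hα hy hv hT)
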